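/- **Chord diagrams.** A chord diagram of size $n$ is a perfect matching of $\{1,\dots,2n\}$ into chords $(x,y)$, $x<y$, with source $x$ and sink $y$; a set of chords, relabelled in an order-preserving way, is a subdiagram. Chords $(x_1,y_1),(x_2,y_2)$ with $x_1<x_2<y_1<y_2$ cross, and the second is then a right neighbor of the first. A diagram is connected if it is nonempty and its graph of crossings is connected. The root of a nonempty set of chords is the chord with the smallest source. The intersection order of a connected diagram lists its root first, then removes the root and lists the resulting connected components one after the other, in the order of their roots, each recursively by the same rule. A chord is terminal if it has no right neighbor, and $t_1(C)$ is the position (from $1$) of the first terminal chord of $C$ in the intersection order. For $m\ge 3$ the top cycle diagram of size $m$ consists of the chords $(2,2m-1)$ and $(2k-1,2k+2)$, $1\le k\le m-1$. A diagram is top-cycle-free if no subdiagram of it is a top cycle diagram of size $m \ge 3$. **Triangulations.** A triangulation of a disk is a finite simple connected plane graph whose outer face is bounded by a cycle and all of whose bounded faces are triangles; a single edge also counts as one. It is rooted by distinguishing an edge of its boundary (for a single edge, equivalently one of its two orientations), and rooted triangulations are taken up to root- and orientation-preserving isomorphism. Its vertices on the boundary of the outer face are exterior, the others interior. Its exterior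 vertices are read counterclockwise as $v_0,v_1,\dots,v_i$, where $v_iv_0$ is the root edge. **Decompositions.** Let $C$ be a connected top-cycle-free diagram with first terminal chord $c$ in the intersection order. Its decomposition is $((C_1,i_1),\dots,(C_k,i_k))$, where $C_1,\dots,C_k$ are the connected components of $C-c$ in the order of their roots and $i_\ell$ is the number of chords of $C_\ell$ that precede $c$ in the intersection order of $C$. (For a single chord, $k=0$.) Let $T$ be a rooted triangulation with exterior vertices $v_0,\dots,v_i$ as above. A decomposition of $T$ is a tuple $((T_1,i_1),\dots,(T_k,i_k))$ with all $i_\ell\ge 1$ and $i_1+\dots+i_k=i-1$, in which $T_1,\dots,T_k$ are the triangulations, successively joined at exterior vertices of $T$, that remain when $v_i$ and all edges at it are deleted, and $T_\ell$ is rooted so that, with its exterior vertices read counterclockwise as $v_{\ell,0},v_{\ell,1},\dots$ as above, $v_{\ell,j}=v_{i_1+\dots+i_{\ell-1}+j}$ for $0\le j\le i_\ell$. **Theorem 7.3.** There is a map $\omega$ from connected top-cycle-free diagrams to rooted triangulations of a disk such that 1. for all integers $n,i\ge 0$, $\omega$ restricts to a bijection from the connected top-cycle-free diagrams with $n$ chords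 and $t_1=i$ onto the rooted triangulations of a disk with $n-i$ interior vertices and $i+1$ exterior vertices (in particular a single chord is mapped to a single edge); 2. $\omega$ is recursive: if $C$ has decomposition $((C_1,i_1),\dots,(C_k,i_k))$, then $((\omega(C_1),i_1),\dots,(\omega(C_k),i_k))$ is a decomposition of $\omega(C)$. -/

import Mathlib

section

open scoped Classical

/-! ### Chord diagrams -/

/-- A (rooted) chord diagram with `n` chords: a perfect matching of the `2 * n` linearly ordered
points `Fin (2 * n)`, given by the map sending each point to the point it is matched with. -/
structure ChordDiagram (n : ℕ) where
  mate : Fin (2 * n) → Fin (2 * n)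
  mate_mate : ∀ x, mate (mate x) = x
  mate_ne : ∀ x, mate x ≠ x

namespace ChordDiagram

/-- The chords of a diagram, each represented by its source, the smaller of its two endpoints.
The order inherited from `Fin (2 * n)` is the standard order (the order of the sources). -/
abbrev Chord {n : ℕ} (C : ChordDiagram n) : Type := {x : Fin (2 * n) // x < C.mate x}

/-- The sink (the larger endpoint) of a chord. -/
def sink {n : ℕ} (C : ChordDiagram n) (c : C.Chord) : Fin (2 * n) := C.mate c.1

/-- `d` is a right neighbor of `c`: the directed intersection graph has the edge `c d`. -/
def RightNbr {n : ℕ} (C : ChordDiagram n) (c d : C.Chord) : Prop :=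
  c.1 < d.1 ∧ d.1 < C.sink c ∧ C.sink c < C.sink d

/-- The undirected intersection graph: chords are adjacent when they cross. -/
def graph {n : ℕ} (C : ChordDiagram n) : SimpleGraph C.Chord :=
  SimpleGraph.fromRel C.RightNbr

/-- A chord is terminal if it has no right neighbor. -/
def IsTerminal {n : ℕ} (C : ChordDiagram n) (c : C.Chord) : Prop := ∀ d, ¬ C.RightNbr c d

/-- For `r ∈ S`, the connected component of the chord `r` in the set of chords `S`. -/
noncomputable def component {n : ℕ} (C : ChordDiagram n) (S : Finset C.Chord) (r : C.Chord) :
    Finset C.Chord :=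
  S.filter fun d => Relation.ReflTransGen (fun a b => b ∈ S ∧ C.graph.Adj a b) r d

/-- The intersection order on a set `S` of chords, as a list without repetitions.  The connected
components of `S` are listed one after the other in the standard order of their roots (first
chords); each component is listed by its root `r`, followed by the recursively obtained list of
the rest of the component. -/
noncomputable def orderList {n : ℕ} (C : ChordDiagram n) (S : Finset C.Chord) : List C.Chord :=
  if h : S.Nonempty then
    S.min' h :: (C.orderList ((C.component S (S.min' h)).erase (S.min' h)) ++
      C.orderList (S \ C.component S (S.min' h)))
  else []
termination_by S.card
decreasing_by
  · have hr : S.min' h ∈ C.component S (S.min' h) :=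
      Finset.mem_filter.2 ⟨S.min'_mem h, Relation.ReflTransGen.refl⟩
    exact lt_of_lt_of_le (Finset.card_erase_lt_of_mem hr)
      (Finset.card_le_card (Finset.filter_subset _ _))
  · have hr : S.min' h ∈ C.component S (S.min' h) :=
      Finset.mem_filter.2 ⟨S.min'_mem h, Relation.ReflTransGen.refl⟩
    exact Finset.card_lt_card ⟨Finset.sdiff_subset,
      fun hs => (Finset.mem_sdiff.1 (hs (S.min'_mem h))).2 hr⟩

/-- The intersection order on the chords of a diagram. -/
noncomputable def intersectionOrder {n : ℕ} (C : ChordDiagram n) : List C.Chord :=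
  C.orderList Finset.univ

/-- The index (counted from `1`) of a chord in the intersection order. -/
noncomputable def index {n : ℕ} (C : ChordDiagram n) (c : C.Chord) : ℕ :=
  C.intersectionOrder.idxOf c + 1

/-- `t₁`: the index of the first terminal chord in the intersection order. -/
noncomputable def t1 {n : ℕ} (C : ChordDiagram n) : ℕ :=
  C.intersectionOrder.findIdx (fun c => decide (C.IsTerminal c)) + 1

/-- An order embedding of the points of `D` into those of `C` that carries the chords of `D` to
chords of `C`; its image is a subdiagram of `C` which is a copy of `D`. -/
structure Embedding {m n : ℕ} (D : ChordDiagram m) (C : ChordDiagram n) where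
  toFun : Fin (2 * m) ↪o Fin (2 * n)
  map_mate : ∀ x, toFun (D.mate x) = C.mate (toFun x)

/-- The chord `c` of `C` belongs to the subdiagram given by the embedding. -/
def Embedding.Contains {m n : ℕ} {D : ChordDiagram m} {C : ChordDiagram n} (e : D.Embedding C)
    (c : C.Chord) : Prop :=
  c.1 ∈ Set.range e.toFun

/-- The top cycle diagram with `m ≥ 3` chords.  With the points numbered `1, …, 2 m` its chords
are `(2, 2 m - 1)` and `(2 k - 1, 2 k + 2)` for `1 ≤ k ≤ m - 1`; the code numbers the points from
`0`. -/
def topCycle (m : ℕ) (hm : 3 ≤ m) : ChordDiagram m where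
  mate x :=
    if h1 : x.1 = 1 then ⟨2 * m - 2, by omega⟩
    else if h2 : x.1 = 2 * m - 2 then ⟨1, by omega⟩
    else if h3 : x.1 % 2 = 0 then ⟨x.1 + 3, by omega⟩
    else ⟨x.1 - 3, by omega⟩
  mate_mate := by
    rintro ⟨x, hx⟩
    apply Fin.ext
    by_cases h1 : x = 1
    · subst h1
      have : 2 * m - 2 ≠ 1 := by omega
      simp [this]
    by_cases h2 : x = 2 * m - 2
    · have : 2 * m - 2 ≠ 1 := by omega
      simp [h2, this]
    by_cases h3 : x % 2 = 0
    · have e1 : x + 3 ≠ 1 := by omega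
      have e2 : x + 3 ≠ 2 * m - 2 := by omega
      have e3 : ¬ (x + 3) % 2 = 0 := by omega
      simp only [h1, h2, h3, e1, e2, e3, dite_true, dite_false]
      omega
    · have e1 : x - 3 ≠ 1 := by omega
      have e2 : x - 3 ≠ 2 * m - 2 := by omega
      have e3 : (x - 3) % 2 = 0 := by omega
      simp only [h1, h2, h3, e1, e2, e3, dite_true, dite_false]
      omega
  mate_ne := by
    rintro ⟨x, hx⟩ h
    have := congrArg Fin.val h
    dsimp only at this
    split_ifs at this <;> simp at this <;> omega

/-- No subdiagram is a top cycle. -/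
def TopCycleFree {n : ℕ} (C : ChordDiagram n) : Prop :=
  ∀ (m : ℕ) (hm : 3 ≤ m), IsEmpty ((topCycle m hm).Embedding C)

end ChordDiagram

/-- Connected top-cycle-free diagrams, of all sizes. (`SimpleGraph.Connected` includes that there
is at least one chord.) -/
structure TopFreeDiagram where
  size : ℕ
  diagram : ChordDiagram size
  connected : diagram.graph.Connected
  topCycleFree : diagram.TopCycleFree

namespace TopFreeDiagram

/-- `((C₁, i₁), …, (C_k, i_k))` is the decomposition of `C` at its first terminal chord `c`: the
`C_ℓ` are the connected components of `C - c`, listed in the standard order of their roots, and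
`i_ℓ` is the number of chords of `C_ℓ` which precede `c` in the intersection order of `C`. -/
def IsDecomposition (C : TopFreeDiagram) {k : ℕ} (Cs : Fin k → TopFreeDiagram)
    (is : Fin k → ℕ) : Prop :=
  ∃ (c : C.diagram.Chord) (e : ∀ l, (Cs l).diagram.Embedding C.diagram),
    C.diagram.IsTerminal c ∧ C.diagram.index c = C.diagram.t1 ∧
    -- every chord other than `c` lies in exactly one of the `C_ℓ`, and `c` lies in none
    (∀ d, d ≠ c → ∃! l, (e l).Contains d) ∧ (∀ l, ¬ (e l).Contains c) ∧
    -- chords of different `C_ℓ` do not cross (each `C_ℓ` is connected by its type)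
    (∀ l l' d d', l ≠ l' → (e l).Contains d → (e l').Contains d' → ¬ C.diagram.graph.Adj d d') ∧
    -- the root of an earlier component precedes all chords of a later one
    (∀ l l', l < l' → ∃ d, (e l).Contains d ∧ ∀ d', (e l').Contains d' → d < d') ∧
    ∀ l, is l = Nat.card {d // (e l).Contains d ∧ C.diagram.index d < C.diagram.t1}

end TopFreeDiagram

/-! ### Rooted triangulations of a disk -/

/-- The data of a finite graph embedded in an oriented surface with a distinguished dart (oriented
edge), as a combinatorial map.  `rot` turns a dart counterclockwise to the next dart with the same
initial vertex, `inv` reverses a dart. -/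
structure RootedMap where
  card : ℕ
  rot : Equiv.Perm (Fin card)
  inv : Equiv.Perm (Fin card)
  root : Fin card

namespace RootedMap

/-- The permutation whose cycles are the boundary walks of the faces.  The face of a dart lies to
its right, so that the outer face is traversed counterclockwise around the graph. -/
def face (M : RootedMap) : Equiv.Perm (Fin M.card) := M.rot * M.inv

/-- Vertices, edges and faces are the cycles of `rot`, `inv` and `face`. -/
abbrev Vertex (M : RootedMap) : Type := Quotient (Equiv.Perm.SameCycle.setoid M.rot)
abbrev Edge (M : RootedMap) : Type := Quotient (Equiv.Perm.SameCycle.setoid M.inv)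
abbrev Face (M : RootedMap) : Type := Quotient (Equiv.Perm.SameCycle.setoid M.face)

/-- The initial vertex of a dart. -/
def vertex (M : RootedMap) (d : Fin M.card) : M.Vertex := Quotient.mk _ d

/-- The dart `d` is on the boundary walk of the outer face, which is the face of the root. -/
def IsOuter (M : RootedMap) (d : Fin M.card) : Prop := M.face.SameCycle M.root d

/-- A vertex is exterior if it is incident to the outer face. -/
def IsExterior (M : RootedMap) (v : M.Vertex) : Prop := ∃ d, M.IsOuter d ∧ M.vertex d = v

/-- The number of exterior vertices. -/
noncomputable def numExterior (M : RootedMap) : ℕ := Nat.card {v : M.Vertex // M.IsExterior v}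

/-- The number of interior vertices. -/
noncomputable def numInterior (M : RootedMap) : ℕ := Nat.card {v : M.Vertex // ¬ M.IsExterior v}

/-- `M` is a triangulation of a disk (or a single edge), rooted at an edge of its boundary: it is
a simple connected plane graph, the outer face is bounded by a cycle (in the case of a single
edge, by the walk along the edge and back) and all other faces are triangles. -/
structure IsDiskTriangulation (M : RootedMap) : Prop where
  inv_inv : ∀ d, M.inv (M.inv d) = d
  inv_ne : ∀ d, M.inv d ≠ d
  connected : ∀ d d', ∃ g ∈ Subgroup.closure {M.rot, M.inv}, g d = d'
  planar : Nat.card M.Vertex + Nat.card M.Face = Nat.card M.Edge + 2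
  no_loop : ∀ d, M.vertex (M.inv d) ≠ M.vertex d
  no_multiple_edge : ∀ d d', M.vertex d = M.vertex d' →
    M.vertex (M.inv d) = M.vertex (M.inv d') → d = d'
  outer_cycle : ∀ d d', M.IsOuter d → M.IsOuter d' → M.vertex d = M.vertex d' → d = d'
  bounded_triangle : ∀ d, ¬ M.IsOuter d → Nat.card {d' // M.face.SameCycle d d'} = 3

/-- Root-preserving (and orientation-preserving) isomorphism. -/
def Iso (M N : RootedMap) : Prop :=
  ∃ e : Fin M.card ≃ Fin N.card,
    (∀ d, e (M.rot d) = N.rot (e d)) ∧ (∀ d, e (M.inv d) = N.inv (e d)) ∧ e M.root = N.root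

/-- `((M₁, i₁), …, (M_k, i_k))` is the decomposition of the triangulation `M` at the initial vertex
`v` of its root dart.  Let the boundary of `M` be `v₀, v₁, …, v_i = v` in counterclockwise order,
where the root dart goes from `v_i` to `v₀`.  Deleting `v` and all its edges leaves `M₁, …, M_k`,
joined at boundary vertices of `M`; the first `i_ℓ` boundary edges of `M_ℓ` that follow its root
dart are, for `ℓ = 1, …, k`, the consecutive boundary edges `v₀v₁, …, v_{i-2}v_{i-1}` of `M`. -/
def IsDecomposition (M : RootedMap) {k : ℕ} (Ms : Fin k → RootedMap) (is : Fin k → ℕ) : Prop :=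
  ∃ f : ∀ l, Fin (Ms l).card ↪ Fin M.card,
    -- the darts of the `M_ℓ` are the darts of `M` not incident to `v`, without repetition
    (∀ d, (M.vertex d ≠ M.vertex M.root ∧ M.vertex (M.inv d) ≠ M.vertex M.root) →
      ∃! l, d ∈ Set.range (f l)) ∧
    (∀ l d, M.vertex (f l d) ≠ M.vertex M.root) ∧
    (∀ l d, f l ((Ms l).inv d) = M.inv (f l d)) ∧
    -- the rotation of `M_ℓ` is obtained from that of `M` by skipping the darts outside `M_ℓ`
    (∀ l d, ∃ m : ℕ, 1 ≤ m ∧ f l ((Ms l).rot d) = (M.rot ^ m) (f l d) ∧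
      ∀ m', 1 ≤ m' → m' < m → (M.rot ^ m') (f l d) ∉ Set.range (f l)) ∧
    -- the boundary edges
    (∀ l, 1 ≤ is l) ∧ (∑ l, is l) + 2 = M.numExterior ∧
    ∀ l j, 1 ≤ j → j ≤ is l →
      f l (((Ms l).face ^ j) (Ms l).root) =
        (M.face ^ ((∑ l' ∈ Finset.univ.filter (· < l), is l') + j)) M.root

end RootedMap

/-- Representatives of rooted triangulations of a disk. -/
abbrev PreTriangulation : Type := {M : RootedMap // M.IsDiskTriangulation}

/-- Isomorphism of rooted triangulations. -/
def PreTriangulation.setoid : Setoid PreTriangulation where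
  r M N := M.1.Iso N.1
  iseqv :=
    { refl := fun M => ⟨Equiv.refl _, fun _ => rfl, fun _ => rfl, rfl⟩
      symm := by
        rintro M N ⟨e, h1, h2, h3⟩
        exact ⟨e.symm, fun d => by rw [Equiv.symm_apply_eq, h1, Equiv.apply_symm_apply],
          fun d => by rw [Equiv.symm_apply_eq, h2, Equiv.apply_symm_apply],
          by rw [Equiv.symm_apply_eq, h3]⟩
      trans := by
        rintro M N P ⟨e, h1, h2, h3⟩ ⟨e', h1', h2', h3'⟩
        exact ⟨e.trans e', fun d => by simp [h1, h1'], fun d => by simp [h2, h2'],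
          by simp [h3, h3']⟩ }

/-- Rooted triangulations of a disk, up to root-preserving isomorphism. -/
def RootedTriangulation : Type := Quotient PreTriangulation.setoid

namespace RootedMap

theorem sameCycle_of_intertwine {α β : Type*} (e : α ≃ β) (p : Equiv.Perm α) (q : Equiv.Perm β)
    (h : ∀ d, e (p d) = q (e d)) (x y : α) : p.SameCycle x y ↔ q.SameCycle (e x) (e y) := by
  have hq : q = (e.symm.trans p).trans e := by
    ext d
    simp [h]
  have hz : ∀ (n : ℤ) (x : α), e ((p ^ n) x) = (q ^ n) (e x) := by
    intro n
    have h' : ∀ d, e (p⁻¹ d) = q⁻¹ (e d) := by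
      intro d
      rw [Equiv.Perm.eq_inv_iff_eq, ← h]
      simp
    induction n using Int.induction_on with
    | zero => simp
    | succ n ih => intro x; rw [zpow_add_one, zpow_add_one, Equiv.Perm.mul_apply, Equiv.Perm.mul_apply, ih, h]
    | pred n ih => intro x; rw [zpow_sub_one, zpow_sub_one, Equiv.Perm.mul_apply, Equiv.Perm.mul_apply, ih, h']
  constructor
  · rintro ⟨n, rfl⟩
    exact ⟨n, (hz n x).symm⟩
  · rintro ⟨n, hn⟩
    exact ⟨n, e.injective (by rw [hz, hn])⟩

theorem Iso.exists_vertexEquiv {M N : RootedMap} (h : M.Iso N) :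
    ∃ E : M.Vertex ≃ N.Vertex, ∀ v, M.IsExterior v ↔ N.IsExterior (E v) := by
  obtain ⟨e, h1, h2, h3⟩ := h
  have hv := sameCycle_of_intertwine e M.rot N.rot h1
  have hf := sameCycle_of_intertwine e M.face N.face (fun d => by simp [face, h1, h2])
  refine ⟨Quotient.congr e hv, fun v => ?_⟩
  induction v using Quotient.inductionOn with
  | h x =>
    constructor
    · rintro ⟨d, hd, hx⟩
      refine ⟨e d, ?_, ?_⟩
      · have := (hf _ _).1 hd
        rwa [h3] at this
      · exact Quotient.sound ((hv _ _).1 (Quotient.exact hx))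
    · rintro ⟨d, hd, hx⟩
      refine ⟨e.symm d, (hf _ _).2 ?_, Quotient.sound ((hv _ _).2 ?_)⟩
      · rw [h3, Equiv.apply_symm_apply]
        exact hd
      · rw [Equiv.apply_symm_apply]
        exact Quotient.exact hx

theorem Iso.numExterior_eq {M N : RootedMap} (h : M.Iso N) : M.numExterior = N.numExterior := by
  obtain ⟨E, hE⟩ := h.exists_vertexEquiv
  exact Nat.card_congr (E.subtypeEquiv hE)

theorem Iso.numInterior_eq {M N : RootedMap} (h : M.Iso N) : M.numInterior = N.numInterior := by
  obtain ⟨E, hE⟩ := h.exists_vertexEquiv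
  exact Nat.card_congr (E.subtypeEquiv fun v => not_congr (hE v))

end RootedMap

namespace RootedTriangulation

/-- The number of exterior vertices. -/
noncomputable def numExterior : RootedTriangulation → ℕ :=
  Quotient.lift (s := PreTriangulation.setoid) (fun M => M.1.numExterior)
    fun _ _ h => RootedMap.Iso.numExterior_eq h

/-- The number of interior vertices. -/
noncomputable def numInterior : RootedTriangulation → ℕ :=
  Quotient.lift (s := PreTriangulation.setoid) (fun M => M.1.numInterior)
    fun _ _ h => RootedMap.Iso.numInterior_eq h

/-- The decomposition of a rooted triangulation at the initial vertex of its root dart, for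
isomorphism classes. -/
def IsDecomposition (T : RootedTriangulation) {k : ℕ} (Ts : Fin k → RootedTriangulation)
    (is : Fin k → ℕ) : Prop :=
  ∃ (M : PreTriangulation) (Ms : Fin k → PreTriangulation),
    T = Quotient.mk _ M ∧ (∀ l, Ts l = Quotient.mk _ (Ms l)) ∧
    M.1.IsDecomposition (fun l => (Ms l).1) is

end RootedTriangulation

end

/-!
Both classes of objects are built from one atom by the same kind of binary operation, and this is
why they correspond. Call a class with a size, a parameter `t ≥ 1`, an atom of size `1` with `t = 1`
and a relation "`x` is the composition of `a` and `b` at place `i`" a *composition system* if the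
composition of `a` and `b` exists and is unique for every `1 ≤ i ≤ t a`, if sizes add, if
`t x = i + t b`, and if every `x` other than the atom is a composition in exactly one way. Any two
composition systems are in bijection by a map that preserves the composition relation
(`IsCompositionSystem.exists_bijective`), and hence the size and `t`. A decomposition
`((x₁, i₁), …, (x_k, i_k))` of `x` is an iterated composition: `x` is the composition of `x₁` at
place `i₁` and of an object with decomposition `((x₂, i₂), …, (x_k, i_k))`. Hence the bijection
respects decompositions.

*Diagrams* (`TopFreeDiagram.isCompositionSystem`, `TopFreeDiagram.IsDecomposition.exists_isComp`).
The size is the number of chords and `t = t₁`. In a connected diagram the first terminal chord is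
the chord `c` that ends at the last point. The chords that precede `c` are those that can be
linked to `c` through crossing chords none of which starts before them; together with `c` they form
the *spine*, so that `t₁` is the number of chords of the spine (`ChordDiagram.t1_eq_spineCount`).
The composition of `A` and `B` inserts all of `B` but its last point into a gap of `A`, and appends
the last point of `B` at the end (`Matching.IsGlue`); conversely `A` is recovered as the component
of the root in `C - c`. The result is top-cycle-free exactly if `A` and `B` are and the gap is
*good* (`Matching.Good`), and the good gaps of `A` are the gap before its last point and the gaps
just before the sources of the spine chords other than the root (`IsMatching.good_of_spine`,
`IsMatching.spine_of_good`). There are `t₁ A` of them. A description of top-cycle-freeness that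
looks at one pair of consecutive crossings at a time is used in place of the definition
(`ChordDiagram.topFree_iff`).

*Triangulations* (`RootedTriangulation.isCompositionSystem`,
`RootedTriangulation.IsComp.isDecomposition`). The size is the number of vertices minus `1`, and `t`
is the number of exterior vertices minus `1`. The composition of `T₁` and `T₂` at place `i`
identifies the vertex `v_i` of `T₁` with the vertex `v₀` of `T₂`, and joins the last vertex `v` of
`T₂`, by one edge at a time, to the vertices that follow `v_i` on the boundary of `T₁`, up to `v₀`;
each of these edges closes a triangle (`DartMap.comp`). Conversely, the edges at the last vertex `v`
of `T` are removed one after the other, starting with the root edge, until some vertex occurs twice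
on the boundary; there the map is cut into `T₁` and `T₂`. All this is done for combinatorial maps
on arbitrary finite sets of darts (`DartMap`). That the pieces of a cut map are again planar follows
from the inequality `V + F ≤ E + 2` for connected maps.
-/

section

open scoped Classical

/-! ### Two recursive classes with the same composition rule are in bijection -/

/-- A class of objects `X` with a size and a parameter `t`, generated from one atom by a
composition: `Comp a i b x` says that `x` is the composite of `a` and `b` along the
index `i`, where `1 ≤ i ≤ t a`.  Composites exist, are unique, and can be decomposed uniquely. -/
structure IsCompositionSystem {X : Type*} (size t : X → ℕ) (atom : X)
    (Comp : X → ℕ → X → X → Prop) : Prop where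
  size_atom : size atom = 1
  t_atom : t atom = 1
  size_pos : ∀ x, 1 ≤ size x
  bounds : ∀ {a i b x}, Comp a i b x → 1 ≤ i ∧ i ≤ t a
  size_comp : ∀ {a i b x}, Comp a i b x → size x = size a + size b
  t_comp : ∀ {a i b x}, Comp a i b x → t x = i + t b
  exists_comp : ∀ a i b, 1 ≤ i → i ≤ t a → ∃ x, Comp a i b x
  comp_unique : ∀ {a i b x y}, Comp a i b x → Comp a i b y → x = y
  decomp : ∀ x, x = atom ∨ ∃ a i b, Comp a i b x
  decomp_unique : ∀ {a i b a' i' b' x}, Comp a i b x → Comp a' i' b' x → a = a' ∧ i = i' ∧ b = b'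

namespace IsCompositionSystem

/-- The correspondence between two composition systems: atoms correspond to each other, and
composites of corresponding objects correspond to each other. -/
inductive Rel {X Y : Type*} (atom : X) (Comp : X → ℕ → X → X → Prop) (atom' : Y)
    (Comp' : Y → ℕ → Y → Y → Prop) : X → Y → Prop
  | atom : Rel atom Comp atom' Comp' atom atom'
  | comp {a i b x a' b' x'} : Rel atom Comp atom' Comp' a a' → Rel atom Comp atom' Comp' b b' →
      Comp a i b x → Comp' a' i b' x' → Rel atom Comp atom' Comp' x x'

theorem Rel.symm {X Y : Type*} {atom : X} {Comp : X → ℕ → X → X → Prop} {atom' : Y}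
    {Comp' : Y → ℕ → Y → Y → Prop} {x : X} {y : Y} (h : Rel atom Comp atom' Comp' x y) :
    Rel atom' Comp' atom Comp y x := by
  induction h with
  | atom => exact .atom
  | comp _ _ h1 h2 ih1 ih2 => exact .comp ih1 ih2 h2 h1

variable {X Y : Type*} {size t : X → ℕ} {atom : X} {Comp : X → ℕ → X → X → Prop}
  {size' t' : Y → ℕ} {atom' : Y} {Comp' : Y → ℕ → Y → Y → Prop}

theorem Rel.size_t_eq (hX : IsCompositionSystem size t atom Comp)
    (hY : IsCompositionSystem size' t' atom' Comp') {x : X} {y : Y}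
    (h : Rel atom Comp atom' Comp' x y) : size' y = size x ∧ t' y = t x := by
  induction h with
  | atom => exact ⟨by rw [hX.size_atom, hY.size_atom], by rw [hX.t_atom, hY.t_atom]⟩
  | comp _ _ h1 h2 ih1 ih2 =>
    rw [hX.size_comp h1, hY.size_comp h2, hX.t_comp h1, hY.t_comp h2]
    omega

theorem not_comp_atom (hX : IsCompositionSystem size t atom Comp) {a i b} :
    ¬ Comp a i b atom := by
  intro h
  have h1 := hX.size_comp h
  have h2 := hX.size_pos a
  have h3 := hX.size_pos b
  have h4 := hX.size_atom
  omega

theorem existsUnique_rel (hX : IsCompositionSystem size t atom Comp)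
    (hY : IsCompositionSystem size' t' atom' Comp') (x : X) :
    ∃! y, Rel atom Comp atom' Comp' x y := by
  induction hn : size x using Nat.strong_induction_on generalizing x with
  | _ n ih =>
    subst hn
    rcases hX.decomp x with rfl | ⟨a, i, b, hx⟩
    · refine ⟨atom', .atom, fun y hy => ?_⟩
      cases hy with
      | atom => rfl
      | comp _ _ h1 _ => exact (hX.not_comp_atom h1).elim
    · have hs := hX.size_comp hx
      have ha := hX.size_pos a
      have hb := hX.size_pos b
      obtain ⟨a', ha', hua⟩ := ih (size a) (by omega) a rfl
      obtain ⟨b', hb', hub⟩ := ih (size b) (by omega) b rfl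
      have hi := hX.bounds hx
      obtain ⟨x', hx'⟩ := hY.exists_comp a' i b' hi.1 (by
        rw [(ha'.size_t_eq hX hY).2]; exact hi.2)
      refine ⟨x', .comp ha' hb' hx hx', fun y hy => ?_⟩
      cases hy with
      | atom => exact (hX.not_comp_atom hx).elim
      | comp h1 h2 h3 h4 =>
        obtain ⟨rfl, rfl, rfl⟩ := hX.decomp_unique hx h3
        rw [hua _ h1, hub _ h2] at h4
        exact hY.comp_unique h4 hx'

theorem exists_bijective (hX : IsCompositionSystem size t atom Comp)
    (hY : IsCompositionSystem size' t' atom' Comp') :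
    ∃ ω : X → Y, Function.Bijective ω ∧ (∀ x, size' (ω x) = size x) ∧ (∀ x, t' (ω x) = t x) ∧
      ω atom = atom' ∧ ∀ {a i b x}, Comp a i b x → Comp' (ω a) i (ω b) (ω x) := by
  choose ω hω huω using hX.existsUnique_rel hY
  choose ψ hψ huψ using hY.existsUnique_rel hX
  have h1 : ∀ x, ψ (ω x) = x := fun x => (huψ _ _ (hω x).symm).symm
  have h2 : ∀ y, ω (ψ y) = y := fun y => (huω _ _ (hψ y).symm).symm
  refine ⟨ω, ⟨fun x y h => by rw [← h1 x, h, h1], fun y => ⟨ψ y, h2 y⟩⟩,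
    fun x => ((hω x).size_t_eq hX hY).1, fun x => ((hω x).size_t_eq hX hY).2,
    (huω _ _ .atom).symm, fun {a i b x} h => ?_⟩
  have hi := hX.bounds h
  obtain ⟨x', hx'⟩ := hY.exists_comp (ω a) i (ω b) hi.1 (by
    rw [((hω a).size_t_eq hX hY).2]; exact hi.2)
  rwa [← huω _ _ (.comp (hω a) (hω b) h hx')]

end IsCompositionSystem

/-! ### Cycles of permutations -/

namespace Equiv.Perm

theorem SameCycle.map_of {α β : Type*} {σ : Perm α} {τ : Perm β} (g : α → β)
    (h : ∀ d, τ.SameCycle (g d) (g (σ d))) {x y : α} (hxy : σ.SameCycle x y) :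
    τ.SameCycle (g x) (g y) := by
  obtain ⟨n, rfl⟩ := hxy
  induction n using Int.induction_on with
  | zero => exact SameCycle.refl _ _
  | succ n ih =>
    rw [add_comm, zpow_add, zpow_one, mul_apply]
    exact ih.trans (h _)
  | pred n ih =>
    rw [sub_eq_neg_add, zpow_add, zpow_neg_one, mul_apply]
    have := h (σ⁻¹ ((σ ^ (-(n : ℤ))) x))
    rw [show σ (σ⁻¹ ((σ ^ (-(n : ℤ))) x)) = (σ ^ (-(n : ℤ))) x by simp] at this
    exact ih.trans this.symm

theorem SameCycle.eq_of_invariant {α X : Type*} {σ : Perm α} (G : α → X)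
    (h : ∀ d, G (σ d) = G d) {x y : α} (hxy : σ.SameCycle x y) : G x = G y := by
  have := SameCycle.map_of (τ := (1 : Perm X)) G (fun d => by rw [h]) hxy
  simpa [sameCycle_one] using this

theorem sameCycle_apply (σ : Perm α) (x : α) : σ.SameCycle x (σ x) :=
  sameCycle_apply_right.2 (SameCycle.refl _ _)

/-- The number of cycles of a permutation, fixed points included. -/
noncomputable def numCycles {α : Type*} (σ : Perm α) : ℕ :=
  Nat.card (Quotient (SameCycle.setoid σ))

theorem numCycles_eq_card {α X : Type*} {σ : Perm α} (G : α → X) (hG : Function.Surjective G)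
    (h : ∀ x y, σ.SameCycle x y ↔ G x = G y) : σ.numCycles = Nat.card X := by
  refine Nat.card_congr (Equiv.ofBijective
    (Quotient.lift (s := SameCycle.setoid σ) G fun a b hab => (h a b).1 hab) ⟨?_, ?_⟩)
  · rintro ⟨x⟩ ⟨y⟩ hxy
    exact Quotient.sound ((h x y).2 hxy)
  · intro y
    obtain ⟨x, rfl⟩ := hG y
    exact ⟨Quotient.mk _ x, rfl⟩

theorem numCycles_congr {α β : Type*} {σ : Perm α} {τ : Perm β} (e : α ≃ β)
    (h : ∀ d, e (σ d) = τ (e d)) : σ.numCycles = τ.numCycles :=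
  Nat.card_congr (Quotient.congr e (RootedMap.sameCycle_of_intertwine e σ τ h))

end Equiv.Perm

/-- The equivalence relation obtained from `s` by merging the classes of `x` and `y`. -/
def Setoid.merge {α : Type*} (s : Setoid α) (x y : α) : Setoid α where
  r d e := s d e ∨ ((s d x ∨ s d y) ∧ (s e x ∨ s e y))
  iseqv :=
    { refl := fun d => .inl (s.refl d)
      symm := by
        rintro d e (h | ⟨h1, h2⟩)
        · exact .inl (s.symm h)
        · exact .inr ⟨h2, h1⟩
      trans := by
        rintro d e f (h | ⟨h1, h2⟩) (h' | ⟨h1', h2'⟩)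
        · exact .inl (s.trans h h')
        · exact .inr ⟨h1'.imp (s.trans h) (s.trans h), h2'⟩
        · exact .inr ⟨h1, h2.imp (s.trans (s.symm h')) (s.trans (s.symm h'))⟩
        · exact .inr ⟨h1, h2'⟩ }

theorem Setoid.merge_apply {α : Type*} (s : Setoid α) (x y d e : α) :
    s.merge x y d e ↔ s d e ∨ ((s d x ∨ s d y) ∧ (s e x ∨ s e y)) := Iff.rfl

theorem Setoid.card_merge {α : Type*} [Finite α] (s : Setoid α) {x y : α} (h : ¬ s x y) :
    Nat.card (Quotient (s.merge x y)) + 1 = Nat.card (Quotient s) := by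
  let q : Quotient s := Quotient.mk s y
  have hx : (Quotient.mk s x) ≠ q := fun e => h (Quotient.exact e)
  have hG : Nat.card (Quotient (s.merge x y)) = Nat.card {p : Quotient s // p ≠ q} := by
    refine Nat.card_congr (Equiv.ofBijective (Quotient.lift (s := s.merge x y)
      (fun d => if hd : Quotient.mk s d = q then (⟨_, hx⟩ : {p : Quotient s // p ≠ q})
        else ⟨Quotient.mk s d, hd⟩) ?_) ⟨?_, ?_⟩)
    · intro d e hde
      rcases hde with hde | ⟨h1, h2⟩
      · have : Quotient.mk s d = Quotient.mk s e := Quotient.sound hde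
        simp only [this]
      · have key : ∀ d, (s d x ∨ s d y) → (if hd : Quotient.mk s d = q then
            (⟨_, hx⟩ : {p : Quotient s // p ≠ q}) else ⟨Quotient.mk s d, hd⟩) = ⟨_, hx⟩ := by
          intro d hd
          split_ifs with h'
          · rfl
          · rcases hd with hd | hd
            · exact Subtype.ext (Quotient.sound hd)
            · exact (h' (Quotient.sound hd)).elim
        simp only [key d h1, key e h2]
    · rintro ⟨d⟩ ⟨e⟩ hde
      refine Quotient.sound (s := s.merge x y) ?_
      change (s.merge x y) d e
      rw [Setoid.merge_apply]
      change (if hd : Quotient.mk s d = q then (⟨_, hx⟩ : {p : Quotient s // p ≠ q})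
        else ⟨Quotient.mk s d, hd⟩) = (if hd : Quotient.mk s e = q then ⟨_, hx⟩
        else ⟨Quotient.mk s e, hd⟩) at hde
      split_ifs at hde with h1 h2 h2
      · exact .inl (s.trans (Quotient.exact h1) (s.symm (Quotient.exact h2)))
      · exact .inr ⟨.inr (Quotient.exact h1),
          .inl (s.symm (Quotient.exact (congrArg Subtype.val hde)))⟩
      · exact .inr ⟨.inl (Quotient.exact (congrArg Subtype.val hde)), .inr (Quotient.exact h2)⟩
      · exact .inl (Quotient.exact (congrArg Subtype.val hde))
    · rintro ⟨p, hp⟩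
      induction p using Quotient.inductionOn with
      | h d => exact ⟨Quotient.mk _ d, dif_neg hp⟩
  rw [hG]
  have := Fintype.ofFinite (Quotient s)
  rw [Nat.card_eq_fintype_card, Nat.card_eq_fintype_card, Fintype.card_subtype_compl,
    Fintype.card_subtype_eq]
  have : 0 < Fintype.card (Quotient s) := Fintype.card_pos_iff.2 ⟨q⟩
  omega

namespace Equiv.Perm

variable {α : Type*} [DecidableEq α] [Finite α] {σ : Perm α} {x y : α}

/-- Two cycles are joined by a transposition of one of their elements each: on the intersection of
the cycle of `y` under `σ` with the cycle of `x` under `swap x y * σ`, injectivity of `σ` would be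
violated otherwise. -/
theorem sameCycle_swap_mul_of_not (h : ¬ σ.SameCycle x y) : (swap x y * σ).SameCycle x y := by
  by_contra hτ
  set τ := swap x y * σ with hτdef
  let A : Set α := {d | τ.SameCycle x d ∧ σ.SameCycle y d}
  have hxy : x ≠ y := fun e => h (e ▸ SameCycle.refl _ _)
  have hσ : ∀ d, σ d = swap x y (τ d) := fun d => by simp [τ]
  have hyA : y ∉ A := fun hy => hτ hy.1
  have hsub : insert y A ⊆ σ '' A := by
    intro e he
    refine ⟨σ⁻¹ e, ?_, by simp⟩
    have hye : σ.SameCycle y e := by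
      rcases he with rfl | he
      · exact SameCycle.refl _ _
      · exact he.2
    have hτe : τ (σ⁻¹ e) = swap x y e := by simp [τ]
    refine ⟨?_, hye.trans (sameCycle_symm_apply_right.2 (SameCycle.refl _ _))⟩
    rw [← sameCycle_apply_right, hτe]
    rcases he with rfl | he
    · simpa using SameCycle.refl _ _
    · have h1 : e ≠ x := by rintro rfl; exact h hye.symm
      have h2 : e ≠ y := by rintro rfl; exact hyA he
      rw [swap_apply_of_ne_of_ne h1 h2]
      exact he.1
  have h1 := Set.ncard_le_ncard hsub (Set.toFinite _)
  rw [Set.ncard_insert_of_notMem hyA (Set.toFinite _),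
    Set.ncard_image_of_injective _ σ.injective] at h1
  omega

theorem setoid_swap_mul_le {α : Type*} [DecidableEq α] (σ : Perm α) (x y : α) {d e : α}
    (h : (swap x y * σ).SameCycle d e) :
    ((SameCycle.setoid σ).merge x y) d e := by
  have := SameCycle.eq_of_invariant (σ := swap x y * σ)
    (fun d => Quotient.mk ((SameCycle.setoid σ).merge x y) d) (fun d => ?_) h
  · exact Quotient.exact this
  · refine Quotient.sound ?_
    have h0 : (SameCycle.setoid σ) (σ d) d := (sameCycle_apply σ d).symm
    change ((SameCycle.setoid σ).merge x y) _ _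
    rw [mul_apply, Setoid.merge_apply]
    by_cases h1 : σ d = x
    · rw [h1, swap_apply_left]
      rw [h1] at h0
      exact .inr ⟨.inr ((SameCycle.setoid σ).refl _), .inl ((SameCycle.setoid σ).symm h0)⟩
    by_cases h2 : σ d = y
    · rw [h2, swap_apply_right]
      rw [h2] at h0
      exact .inr ⟨.inl ((SameCycle.setoid σ).refl _), .inr ((SameCycle.setoid σ).symm h0)⟩
    rw [swap_apply_of_ne_of_ne h1 h2]
    exact .inl h0

theorem sameCycle_swap_mul_iff (h : ¬ σ.SameCycle x y) (d e : α) :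
    (swap x y * σ).SameCycle d e ↔ σ.SameCycle d e ∨
      ((σ.SameCycle d x ∨ σ.SameCycle d y) ∧ (σ.SameCycle e x ∨ σ.SameCycle e y)) := by
  have hxy := sameCycle_swap_mul_of_not h
  have hmono : ∀ {d e}, σ.SameCycle d e → (swap x y * σ).SameCycle d e := by
    intro d e hde
    refine SameCycle.map_of (σ := σ) id (fun d => ?_) hde
    have h0 := sameCycle_apply (swap x y * σ) d
    rw [mul_apply] at h0
    by_cases h1 : σ d = x
    · rw [h1, swap_apply_left] at h0
      simpa [h1] using h0.trans hxy.symm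
    by_cases h2 : σ d = y
    · rw [h2, swap_apply_right] at h0
      simpa [h2] using h0.trans hxy
    rwa [swap_apply_of_ne_of_ne h1 h2] at h0
  constructor
  · exact setoid_swap_mul_le σ x y
  · rintro (h1 | ⟨h1, h2⟩)
    · exact hmono h1
    · have key : ∀ d, (σ.SameCycle d x ∨ σ.SameCycle d y) → (swap x y * σ).SameCycle d x := by
        rintro d (hd | hd)
        · exact hmono hd
        · exact (hmono hd).trans hxy.symm
      exact (key d h1).trans (key e h2).symm

theorem numCycles_swap_mul_of_not (h : ¬ σ.SameCycle x y) :
    (swap x y * σ).numCycles + 1 = σ.numCycles := by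
  have : SameCycle.setoid (swap x y * σ) = (SameCycle.setoid σ).merge x y :=
    Setoid.ext fun d e => sameCycle_swap_mul_iff h d e
  rw [numCycles, this]
  exact Setoid.card_merge _ h

/-- A cycle is split by a transposition of two of its elements. -/
theorem not_sameCycle_swap_mul (hne : x ≠ y) (h : σ.SameCycle x y) :
    ¬ (swap x y * σ).SameCycle x y := by
  obtain ⟨k, hk⟩ : ∃ k : ℕ, (σ ^ k) x = y := by
    obtain ⟨k, -, hk⟩ := h.exists_pow_eq'
    exact ⟨k, hk⟩
  have hex : ∃ k : ℕ, (σ ^ k) x = y := ⟨k, hk⟩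
  set m := Nat.find hex with hm
  have hmk : (σ ^ m) x = y := Nat.find_spec hex
  have hlt : ∀ j, j < m → (σ ^ j) x ≠ y := fun j hj => Nat.find_min hex hj
  have hm0 : 0 < m := Nat.pos_of_ne_zero fun h0 => hne (by simpa [h0] using hmk)
  let U : Set α := {d | ∃ j < m, (σ ^ j) x = d}
  have hU : ∀ d, d ∈ U → (swap x y * σ) d ∈ U := by
    rintro d ⟨j, hj, rfl⟩
    rw [mul_apply, ← mul_apply σ, ← pow_succ']
    rcases Nat.lt_or_ge (j + 1) m with h1 | h1
    · by_cases hx : (σ ^ (j + 1)) x = x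
      · -- the orbit of `x` would close up before it reaches `y`
        exfalso
        apply hlt (m - (j + 1)) (by omega)
        rw [← hmk]
        conv_rhs => rw [show m = (m - (j + 1)) + (j + 1) by omega, pow_add, mul_apply, hx]
      · rw [swap_apply_of_ne_of_ne hx (hlt _ h1)]
        exact ⟨j + 1, h1, rfl⟩
    · rw [show j + 1 = m by omega, hmk, swap_apply_right]
      exact ⟨0, hm0, rfl⟩
  intro hτ
  obtain ⟨k, -, hk⟩ := hτ.exists_pow_eq'
  have : ∀ k : ℕ, ((swap x y * σ) ^ k) x ∈ U := by
    intro k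
    induction k with
    | zero => exact ⟨0, hm0, rfl⟩
    | succ k ih => rw [pow_succ', mul_apply]; exact hU _ ih
  obtain ⟨j, hj, hj'⟩ := hk ▸ this k
  exact hlt j hj hj'

theorem numCycles_swap_mul (hne : x ≠ y) (h : σ.SameCycle x y) :
    (swap x y * σ).numCycles = σ.numCycles + 1 := by
  have h1 := not_sameCycle_swap_mul hne h
  have h2 := numCycles_swap_mul_of_not h1
  rw [← mul_assoc, swap_mul_self, one_mul] at h2
  exact h2.symm

end Equiv.Perm

open Equiv Equiv.Perm

/-! ### Combinatorial maps on arbitrary finite sets of darts -/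

theorem Equiv.Perm.sameCycle_involutive {D : Type*} {α : Perm D} (h : ∀ d, α (α d) = d) (x y : D) :
    α.SameCycle x y ↔ y = x ∨ y = α x := by
  constructor
  · intro hxy
    have := SameCycle.eq_of_invariant (fun d => (d = x ∨ d = α x : Prop)) (fun d => ?_) hxy
    · simpa using this
    · have h1 : α d = x ↔ d = α x := ⟨fun e => by rw [← e, h], fun e => by rw [e, h]⟩
      have h2 : α d = α x ↔ d = x := α.injective.eq_iff
      simp only [h1, h2, eq_iff_iff]
      tauto
  · rintro (rfl | rfl)
    · exact SameCycle.refl _ _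
    · exact sameCycle_apply _ _

theorem Equiv.Perm.two_mul_numCycles_involutive {D : Type*} [Finite D] {α : Perm D}
    (h : ∀ d, α (α d) = d) (hne : ∀ d, α d ≠ d) : 2 * α.numCycles = Nat.card D := by
  have := Fintype.ofFinite D
  have := Fintype.ofFinite (Quotient (SameCycle.setoid α))
  rw [Nat.card_congr (Equiv.sigmaFiberEquiv (Quotient.mk (SameCycle.setoid α))).symm, numCycles,
    Nat.card_sigma, Finset.sum_const_nat (m := 2), Finset.card_univ, Nat.card_eq_fintype_card,
    mul_comm]
  rintro q -
  induction q using Quotient.inductionOn with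
  | h x =>
    have : {d : D | Quotient.mk (SameCycle.setoid α) d = Quotient.mk _ x} = {x, α x} := by
      ext d
      simp only [Set.mem_ofPred_eq, Set.mem_insert_iff, Set.mem_singleton_iff]
      rw [← sameCycle_involutive h]
      exact ⟨fun e => (Quotient.exact e).symm, fun e => Quotient.sound e.symm⟩
    change Nat.card {d : D | Quotient.mk (SameCycle.setoid α) d = Quotient.mk _ x} = 2
    rw [this]
    exact Set.ncard_pair (hne x).symm

/-- An inequality behind Euler's formula, for an involution `α` that need not be free of fixed
points: the transpositions of `α` are added one at a time, and each changes the number of cycles of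
the product by one, with a decrease only if it merges two cycles.  Every
set that is invariant under both permutations is a union of classes of `s`. -/
theorem Equiv.Perm.exists_setoid_numCycles_le {D : Type*} [Finite D] (σ : Perm D) (n : ℕ)
    (α : Perm D) (hα : ∀ d, α (α d) = d) (hn : {d | α d ≠ d}.ncard ≤ 2 * n) :
    ∃ s : Setoid D, (∀ d e, σ.SameCycle d e → s d e) ∧ (∀ d e, (α * σ).SameCycle d e → s d e) ∧
      (∀ G : D → Prop, (∀ d, G (σ d) ↔ G d) → (∀ d, G (α d) ↔ G d) → ∀ d e, s d e → (G d ↔ G e)) ∧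
      σ.numCycles + (α * σ).numCycles ≤ n + 2 * Nat.card (Quotient s) := by
  induction n generalizing α with
  | zero =>
    have h1 : α = 1 := by
      ext d
      by_contra hd
      have : {d | α d ≠ d} = ∅ := (Set.ncard_eq_zero (Set.toFinite _)).1 (by omega)
      exact Set.eq_empty_iff_forall_notMem.1 this d hd
    subst h1
    refine ⟨SameCycle.setoid σ, fun d e h => h, fun d e h => by rw [one_mul] at h; exact h,
        fun G hG _ d e h => ?_, ?_⟩
    · exact (SameCycle.eq_of_invariant G (fun d => propext (hG d)) h).to_iff
    · rw [one_mul, zero_add, two_mul]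
      exact le_rfl
  | succ n ih =>
    by_cases h1 : ∀ d, α d = d
    · have h1 : α = 1 := Equiv.ext h1
      subst h1
      refine ⟨SameCycle.setoid σ, fun d e h => h, fun d e h => by rw [one_mul] at h; exact h,
        fun G hG _ d e h => ?_, ?_⟩
      · exact (SameCycle.eq_of_invariant G (fun d => propext (hG d)) h).to_iff
      · rw [one_mul, two_mul]
        exact Nat.le_add_left _ _
    obtain ⟨x, hx⟩ := not_forall.1 h1
    set y := α x with hy
    have hyx : α y = x := hα x
    let β : Perm D := swap x y * α
    have hβx : β x = x := by simp [β, ← hy]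
    have hβy : β y = y := by simp [β, hyx]
    have hβ : ∀ d, d ≠ x → d ≠ y → β d = α d := by
      intro d h1 h2
      refine swap_apply_of_ne_of_ne (fun e => h2 ?_) (fun e => h1 (α.injective e))
      rw [← hα d, e]
    have hββ : ∀ d, β (β d) = d := by
      intro d
      by_cases h1 : d = x
      · rw [h1, hβx, hβx]
      by_cases h2 : d = y
      · rw [h2, hβy, hβy]
      rw [hβ d h1 h2, hβ, hα]
      · intro e; exact h2 (by rw [← hα d, e])
      · intro e; exact h1 (α.injective e)
    have hcard : {d | β d ≠ d}.ncard ≤ 2 * n := by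
      have hsub : insert x (insert y {d | β d ≠ d}) ⊆ {d | α d ≠ d} := by
        rintro d (rfl | rfl | hd)
        · exact hx
        · exact fun e => hx (by rw [hyx] at e; exact e.symm)
        · have h1 : d ≠ x := by rintro rfl; exact hd hβx
          have h2 : d ≠ y := by rintro rfl; exact hd hβy
          rwa [Set.mem_ofPred_eq, hβ d h1 h2] at hd
      have h3 := Set.ncard_le_ncard hsub (Set.toFinite _)
      rw [Set.ncard_insert_of_notMem (by
          rintro (e | e)
          · exact hx e.symm
          · exact e hβx) (Set.toFinite _),
        Set.ncard_insert_of_notMem (fun (e : y ∈ {d | β d ≠ d}) => (show β y ≠ y from e) hβy)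
          (Set.toFinite _)] at h3
      omega
    obtain ⟨s, hs0, hs1, hs2, hs3⟩ := ih β hββ hcard
    have hαβ : α * σ = swap x y * (β * σ) := by
      simp only [β, ← mul_assoc, swap_mul_self, one_mul]
    refine ⟨s.merge x y, fun d e h => .inl (hs0 d e h), fun d e h => ?_,
      fun G hσ hG d e h => ?_, ?_⟩
    · rw [hαβ] at h
      have := setoid_swap_mul_le _ _ _ h
      rw [Setoid.merge_apply] at this ⊢
      rcases this with h | ⟨h, h'⟩
      · exact .inl (hs1 _ _ h)
      · exact .inr ⟨h.imp (hs1 _ _) (hs1 _ _), h'.imp (hs1 _ _) (hs1 _ _)⟩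
    · have hGβ : ∀ d, G (β d) ↔ G d := by
        intro d
        by_cases h1 : d = x
        · rw [h1, hβx]
        by_cases h2 : d = y
        · rw [h2, hβy]
        rw [hβ d h1 h2, hG]
      have hxy : G y ↔ G x := hG x
      rw [Setoid.merge_apply] at h
      have h0 := hs2 G hσ hGβ
      rcases h with h | ⟨h, h'⟩
      · exact h0 _ _ h
      · have e1 : G d ↔ G x := h.elim (h0 _ _) fun h => (h0 _ _ h).trans hxy
        have e2 : G e ↔ G x := h'.elim (h0 _ _) fun h => (h0 _ _ h).trans hxy
        exact e1.trans e2.symm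
    · rw [hαβ]
      by_cases hc : (β * σ).SameCycle x y
      · rw [numCycles_swap_mul (Ne.symm hx) hc]
        have : s.merge x y = s := by
          ext d e
          rw [Setoid.merge_apply]
          have hxy := hs1 _ _ hc
          constructor
          · rintro (h | ⟨h, h'⟩)
            · exact h
            · have e1 : s d x := h.elim id fun h => s.trans h (s.symm hxy)
              have e2 : s e x := h'.elim id fun h => s.trans h (s.symm hxy)
              exact s.trans e1 (s.symm e2)
          · exact .inl
        rw [this]
        omega
      · have h4 := numCycles_swap_mul_of_not hc
        by_cases hsx : s x y
        · have : s.merge x y = s := by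
            ext d e
            rw [Setoid.merge_apply]
            constructor
            · rintro (h | ⟨h, h'⟩)
              · exact h
              · have e1 : s d x := h.elim id fun h => s.trans h (s.symm hsx)
                have e2 : s e x := h'.elim id fun h => s.trans h (s.symm hsx)
                exact s.trans e1 (s.symm e2)
            · exact .inl
          rw [this]
          omega
        · have := Setoid.card_merge s hsx
          omega

/-- A map on the set `D` of darts with a root dart, as in `RootedMap`, but on an arbitrary type of
darts. -/
structure DartMap (D : Type) where
  rot : Perm D
  inv : Perm D
  root : D

namespace DartMap

variable {D D' : Type} (M : DartMap D)

/-- The permutation whose cycles are the boundary walks of the faces. -/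
def face : Perm D := M.rot * M.inv

theorem face_apply (d : D) : M.face d = M.rot (M.inv d) := rfl

/-- The dart is on the boundary walk of the outer face. -/
def IsOuter (d : D) : Prop := M.face.SameCycle M.root d

theorem isOuter_root : M.IsOuter M.root := SameCycle.refl _ _

theorem isOuter_face {d : D} : M.IsOuter (M.face d) ↔ M.IsOuter d := sameCycle_apply_right

/-- Connectedness, phrased through invariant predicates: an invariant predicate that holds at one
dart holds at all. -/
def Connected : Prop :=
  ∀ G : D → Prop, (∀ d, G (M.rot d) ↔ G d) → (∀ d, G (M.inv d) ↔ G d) → ∀ d e, G d → G e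

/-- A simple connected plane map all of whose bounded faces are triangles.  The Euler relation is
stated without the number of edges, which is half the number of darts. -/
structure IsTriangulated : Prop where
  inv_inv : ∀ d, M.inv (M.inv d) = d
  inv_ne : ∀ d, M.inv d ≠ d
  connected : M.Connected
  planar : 2 * (M.rot.numCycles + M.face.numCycles) = Nat.card D + 4
  no_loop : ∀ d, ¬ M.rot.SameCycle (M.inv d) d
  no_multiple_edge : ∀ d e, M.rot.SameCycle d e → M.rot.SameCycle (M.inv d) (M.inv e) → d = e
  bounded_triangle : ∀ d, ¬ M.IsOuter d → M.face (M.face (M.face d)) = d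

/-- A triangulation of a disk: moreover, the boundary walk of the outer face is a cycle. -/
structure IsDisk : Prop extends M.IsTriangulated where
  outer_cycle : ∀ d e, M.IsOuter d → M.IsOuter e → M.rot.SameCycle d e → d = e

/-- The number of darts on the boundary walk of the outer face. -/
noncomputable def outerLength : ℕ := Nat.card {d // M.IsOuter d}

/-- Root-preserving isomorphism of maps. -/
def Iso (M : DartMap D) (N : DartMap D') : Prop :=
  ∃ e : D ≃ D', (∀ d, e (M.rot d) = N.rot (e d)) ∧ (∀ d, e (M.inv d) = N.inv (e d)) ∧
    e M.root = N.root

variable {M}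

theorem Iso.refl (M : DartMap D) : M.Iso M := ⟨Equiv.refl _, fun _ => rfl, fun _ => rfl, rfl⟩

theorem Iso.symm {N : DartMap D'} (h : M.Iso N) : N.Iso M := by
  obtain ⟨e, h1, h2, h3⟩ := h
  exact ⟨e.symm, fun d => by rw [Equiv.symm_apply_eq, h1, Equiv.apply_symm_apply],
    fun d => by rw [Equiv.symm_apply_eq, h2, Equiv.apply_symm_apply],
    by rw [Equiv.symm_apply_eq, h3]⟩

theorem Iso.trans {D'' : Type} {N : DartMap D'} {P : DartMap D''} (h : M.Iso N) (h' : N.Iso P) :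
    M.Iso P := by
  obtain ⟨e, h1, h2, h3⟩ := h
  obtain ⟨e', h1', h2', h3'⟩ := h'
  exact ⟨e.trans e', fun d => by simp [h1, h1'], fun d => by simp [h2, h2'], by simp [h3, h3']⟩

theorem face_intertwine {N : DartMap D'} {e : D ≃ D'} (h1 : ∀ d, e (M.rot d) = N.rot (e d))
    (h2 : ∀ d, e (M.inv d) = N.inv (e d)) (d : D) : e (M.face d) = N.face (e d) := by
  rw [face_apply, face_apply, h1, h2]

theorem Iso.isTriangulated {N : DartMap D'} (h : M.Iso N) (hM : M.IsTriangulated) :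
    N.IsTriangulated := by
  obtain ⟨e, h1, h2, h3⟩ := h.symm
  have hf := face_intertwine h1 h2
  have hv := fun x y => RootedMap.sameCycle_of_intertwine e N.rot M.rot h1 x y
  have ho : ∀ d, N.IsOuter d ↔ M.IsOuter (e d) := by
    intro d
    rw [IsOuter, IsOuter, RootedMap.sameCycle_of_intertwine e N.face M.face hf, h3]
  refine ⟨fun d => e.injective ?_, fun d hd => ?_, fun G hG1 hG2 d d' hd => ?_, ?_, fun d => ?_,
    fun d d' => ?_, fun d hd => e.injective ?_⟩
  · rw [h2, h2, hM.inv_inv]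
  · exact hM.inv_ne (e d) (by rw [← h2, hd])
  · have := hM.connected (fun d => G (e.symm d)) (fun d => ?_) (fun d => ?_) (e d) (e d') (by simpa)
    · simpa using this
    · rw [show e.symm (M.rot d) = N.rot (e.symm d) by rw [Equiv.symm_apply_eq, h1]; simp, hG1]
    · rw [show e.symm (M.inv d) = N.inv (e.symm d) by rw [Equiv.symm_apply_eq, h2]; simp, hG2]
  · rw [numCycles_congr e h1, numCycles_congr e hf, hM.planar, Nat.card_congr e]
  · rw [hv, h2]
    exact hM.no_loop _
  · rw [hv, hv, h2, h2]
    exact fun a b => e.injective (hM.no_multiple_edge _ _ a b)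
  · rw [hf, hf, hf]
    exact hM.bounded_triangle _ (fun h => hd ((ho d).2 h))

theorem Iso.isOuter_iff {N : DartMap D'} {e : D ≃ D'} (h1 : ∀ d, e (M.rot d) = N.rot (e d))
    (h2 : ∀ d, e (M.inv d) = N.inv (e d)) (h3 : e M.root = N.root) (d : D) :
    M.IsOuter d ↔ N.IsOuter (e d) := by
  rw [IsOuter, IsOuter, RootedMap.sameCycle_of_intertwine e M.face N.face (face_intertwine h1 h2),
    h3]

theorem Iso.isDisk {N : DartMap D'} (h : M.Iso N) (hM : M.IsDisk) : N.IsDisk := by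
  refine { h.isTriangulated hM.toIsTriangulated with outer_cycle := ?_ }
  obtain ⟨e, h1, h2, h3⟩ := h.symm
  intro d d' hd hd' hdd
  refine e.injective (hM.outer_cycle _ _ ((Iso.isOuter_iff h1 h2 h3 d).1 hd)
    ((Iso.isOuter_iff h1 h2 h3 d').1 hd') ?_)
  exact (RootedMap.sameCycle_of_intertwine e N.rot M.rot h1 _ _).1 hdd

theorem Iso.outerLength_eq {N : DartMap D'} (h : M.Iso N) : M.outerLength = N.outerLength := by
  obtain ⟨e, h1, h2, h3⟩ := h
  exact Nat.card_congr (e.subtypeEquiv fun d => Iso.isOuter_iff h1 h2 h3 d)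

theorem Iso.numCycles_rot_eq {N : DartMap D'} (h : M.Iso N) :
    M.rot.numCycles = N.rot.numCycles := by
  obtain ⟨e, h1, h2, h3⟩ := h
  exact numCycles_congr e h1

/-- The Euler characteristic of a connected map is at most `2`. -/
theorem two_mul_numCycles_le [Finite D] (h : ∀ d, M.inv (M.inv d) = d) (hne : ∀ d, M.inv d ≠ d)
    (hc : M.Connected) : 2 * (M.rot.numCycles + M.face.numCycles) ≤ Nat.card D + 4 := by
  have hE := two_mul_numCycles_involutive h hne
  obtain ⟨s, h0, h1, -, h3⟩ := exists_setoid_numCycles_le M.rot M.inv.numCycles M.inv h (by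
    rw [hE, ← Set.ncard_univ]
    exact Set.ncard_le_ncard (Set.subset_univ _) (Set.toFinite _))
  have h4 : (M.inv * M.rot).numCycles = M.face.numCycles :=
    (numCycles_congr (σ := M.face) (τ := M.inv * M.rot) M.inv (fun d => rfl)).symm
  have h5 : Nat.card (Quotient s) = 1 := by
    rw [Nat.card_eq_one_iff_unique]
    refine ⟨⟨?_⟩, ⟨Quotient.mk _ M.root⟩⟩
    rintro ⟨d⟩ ⟨e⟩
    refine Quotient.sound ?_
    have hr : ∀ d, s d (M.rot d) := fun d => h0 _ _ (sameCycle_apply _ _)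
    have hi : ∀ d, s d (M.inv d) := by
      intro d
      have e1 := h1 _ _ (sameCycle_apply (M.inv * M.rot) (M.rot.symm d))
      have e2 := hr (M.rot.symm d)
      rw [mul_apply, apply_symm_apply] at e1
      rw [apply_symm_apply] at e2
      exact s.trans (s.symm e2) e1
    exact hc (fun e => s d e)
      (fun e => ⟨fun h => s.trans h (s.symm (hr e)), fun h => s.trans h (hr e)⟩)
      (fun e => ⟨fun h => s.trans h (s.symm (hi e)), fun h => s.trans h (hi e)⟩) d e (s.refl d)
  omega

end DartMap

/-! ### Cutting off a boundary corner by an edge -/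

namespace DartMap

variable {D D' : Type} (M : DartMap D)

/-- Let `r` be the root of `M`, and let `r` and `face r` be the darts from `v` to `w` and from `w`
to `v₀`.  The map `addEdge M` has an additional edge in the outer face, with the darts `inr true`
from `v` to `v₀`, which is the new root, and `inr false` from `v₀` to `v`.  The new edge cuts off
the triangle with the vertices `v`, `w`, `v₀` from the outer face. -/
noncomputable def addEdge : DartMap (D ⊕ Bool) where
  rot := swap (Sum.inr true) (Sum.inl M.root) *
    (swap (Sum.inr false) (Sum.inl (M.face (M.face M.root))) * Perm.sumCongr M.rot 1)
  inv := Perm.sumCongr M.inv (swap true false)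
  root := Sum.inr true

@[simp] theorem addEdge_root : M.addEdge.root = .inr true := rfl
@[simp] theorem addEdge_inv_inl (d : D) : M.addEdge.inv (.inl d) = .inl (M.inv d) := rfl
@[simp] theorem addEdge_inv_true : M.addEdge.inv (.inr true) = .inr false := by simp [addEdge]
@[simp] theorem addEdge_inv_false : M.addEdge.inv (.inr false) = .inr true := by simp [addEdge]

theorem addEdge_rot_true : M.addEdge.rot (.inr true) = .inl M.root := by
  simp [addEdge, swap_apply_def]

theorem addEdge_rot_inl (d : D) : M.addEdge.rot (.inl d) =
    if M.rot d = M.face (M.face M.root) then .inr false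
    else if M.rot d = M.root then .inr true else .inl (M.rot d) := by
  simp [addEdge, swap_apply_def]
  split_ifs <;> simp_all

variable {M}

theorem addEdge_rot_false (h : M.root ≠ M.face (M.face M.root)) :
    M.addEdge.rot (.inr false) = .inl (M.face (M.face M.root)) := by
  simp [addEdge, swap_apply_def, h.symm]

theorem addEdge_face_inl (d : D) : M.addEdge.face (.inl d) =
    if d = M.face M.root then .inr false
    else if M.face d = M.root then .inr true else .inl (M.face d) := by
  rw [face_apply, addEdge_inv_inl, addEdge_rot_inl, ← face_apply]
  simp only [M.face.injective.eq_iff]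

theorem addEdge_face_true (h : M.root ≠ M.face (M.face M.root)) :
    M.addEdge.face (.inr true) = .inl (M.face (M.face M.root)) := by
  rw [face_apply, addEdge_inv_true, addEdge_rot_false h]

theorem addEdge_face_false : M.addEdge.face (.inr false) = .inl M.root := by
  rw [face_apply, addEdge_inv_false, addEdge_rot_true]

/-- For each dart of `addEdge M`, a dart of `M` with the same initial vertex. -/
def base (M : DartMap D) : D ⊕ Bool → D :=
  Sum.elim id fun b => cond b M.root (M.face (M.face M.root))

@[simp] theorem base_inl (d : D) : M.base (.inl d) = d := rfl
@[simp] theorem base_true : M.base (.inr true) = M.root := rfl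
@[simp] theorem base_false : M.base (.inr false) = M.face (M.face M.root) := rfl

theorem addEdge_sameVertex (h : M.root ≠ M.face (M.face M.root)) (x y : D ⊕ Bool) :
    M.addEdge.rot.SameCycle x y ↔ M.rot.SameCycle (M.base x) (M.base y) := by
  have ht := sameCycle_apply M.addEdge.rot (.inr true)
  have hf := sameCycle_apply M.addEdge.rot (.inr false)
  rw [addEdge_rot_true] at ht
  rw [addEdge_rot_false h] at hf
  constructor
  · refine SameCycle.map_of _ fun d => ?_
    rcases d with d | (_ | _)
    · rw [addEdge_rot_inl, base_inl]
      split_ifs with h1 h2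
      · simpa [← h1] using sameCycle_apply _ _
      · simpa [← h2] using sameCycle_apply _ _
      · exact sameCycle_apply _ _
    · rw [addEdge_rot_false h]
      exact SameCycle.refl _ _
    · rw [addEdge_rot_true]
      exact SameCycle.refl _ _
  · have key : ∀ x, M.addEdge.rot.SameCycle x (.inl (M.base x)) := by
      rintro (d | (_ | _))
      · exact SameCycle.refl _ _
      · exact hf
      · exact ht
    intro hxy
    refine (key x).trans (SameCycle.trans ?_ (key y).symm)
    refine SameCycle.map_of Sum.inl (fun d => ?_) hxy
    have h0 := sameCycle_apply M.addEdge.rot (.inl d)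
    rw [addEdge_rot_inl] at h0
    split_ifs at h0 with h1 h2
    · rw [h1]; exact h0.trans hf
    · rw [h2]; exact h0.trans ht
    · exact h0

theorem addEdge_numCycles_rot (h : M.root ≠ M.face (M.face M.root)) :
    M.addEdge.rot.numCycles = M.rot.numCycles := by
  refine numCycles_eq_card (fun x => (Quotient.mk (SameCycle.setoid M.rot) (M.base x))) ?_
    fun x y => ?_
  · rintro ⟨d⟩
    exact ⟨.inl d, rfl⟩
  · rw [addEdge_sameVertex h]
    exact ⟨fun e => Quotient.sound e, fun e => Quotient.exact e⟩

/-- The face of `addEdge M` that contains the given dart, as a face of `M`, or `none` for the new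
triangle. -/
noncomputable def faceBase (M : DartMap D) :
    D ⊕ Bool → Option (Quotient (SameCycle.setoid M.face)) :=
  Sum.elim (fun d => if d = M.root ∨ d = M.face M.root then none else some (Quotient.mk _ d))
    fun b => cond b (some (Quotient.mk _ M.root)) none

theorem addEdge_sameFace (h : M.root ≠ M.face (M.face M.root)) (h' : M.face M.root ≠ M.root)
    (x y : D ⊕ Bool) : M.addEdge.face.SameCycle x y ↔ M.faceBase x = M.faceBase y := by
  have e1 : M.face (M.face M.root) ≠ M.face M.root := fun e => h' (M.face.injective e)
  constructor
  · refine SameCycle.eq_of_invariant _ fun d => ?_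
    rcases d with d | (_ | _)
    · rw [addEdge_face_inl]
      split_ifs with h1 h2
      · simp [faceBase, h1]
      · have h3 : d ≠ M.root := by rintro rfl; exact h' h2
        have h4 : M.faceBase (.inl d) = some (Quotient.mk _ d) := if_neg (by tauto)
        rw [h4]
        exact congrArg some (Quotient.sound (h2 ▸ (sameCycle_apply M.face d).symm))
      · by_cases h3 : d = M.root
        · simp [faceBase, h3]
        · simp only [faceBase, Sum.elim_inl, h1, h2, h3, or_false, if_false,
            M.face.injective.eq_iff, Option.some.injEq]
          exact Quotient.sound (sameCycle_apply _ _).symm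
    · rw [addEdge_face_false]
      simp [faceBase]
    · rw [addEdge_face_true h]
      simp only [faceBase, Sum.elim_inr, Sum.elim_inl, e1, h.symm, cond_true, or_false, if_false,
          Option.some.injEq]
      exact Quotient.sound ((sameCycle_apply _ _).trans (sameCycle_apply _ _)).symm
  · have ht := sameCycle_apply M.addEdge.face (.inr true)
    rw [addEdge_face_true h] at ht
    have hf := sameCycle_apply M.addEdge.face (.inr false)
    rw [addEdge_face_false] at hf
    have hf' := sameCycle_apply M.addEdge.face (.inl (M.face M.root))
    rw [addEdge_face_inl, if_pos rfl] at hf'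
    -- the darts of `M` outside the new triangle, with the new root in the place of the latter
    let g : D → D ⊕ Bool := fun d => if d = M.root ∨ d = M.face M.root then .inr true else .inl d
    have hg : ∀ d, M.addEdge.face.SameCycle (g d) (g (M.face d)) := by
      intro d
      by_cases h1 : d = M.root
      · simpa [g, h1] using SameCycle.refl _ _
      by_cases h2 : d = M.face M.root
      · simp only [g, h2, h.symm, e1, or_true, or_false, if_true, if_false]
        exact ht
      have h3 := sameCycle_apply M.addEdge.face (.inl d)
      rw [addEdge_face_inl, if_neg h2] at h3
      simp only [g, h1, h2, or_false, if_false, M.face.injective.eq_iff]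
      exact h3
    have hnone : ∀ x, M.faceBase x = none → M.addEdge.face.SameCycle x (.inr false) := by
      rintro (d | (_ | _)) hx
      · simp only [faceBase, Sum.elim_inl] at hx
        split_ifs at hx with h1
        rcases h1 with rfl | rfl
        · exact hf.symm
        · exact hf'
      · exact SameCycle.refl _ _
      · simp [faceBase] at hx
    have hsome : ∀ x d, M.faceBase x = some (Quotient.mk _ d) →
        M.addEdge.face.SameCycle x (g d) := by
      rintro (d' | (_ | _)) d hx
      · simp only [faceBase, Sum.elim_inl] at hx
        split_ifs at hx with h1
        have h2 := SameCycle.map_of g hg (Quotient.exact (Option.some.inj hx))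
        simpa only [g, if_neg h1] using h2
      · simp [faceBase] at hx
      · simp only [faceBase, Sum.elim_inr, cond_true] at hx
        have h2 := SameCycle.map_of g hg (Quotient.exact (Option.some.inj hx))
        simpa [g] using h2
    intro hxy
    rcases hx : M.faceBase x with _ | q
    · exact (hnone x hx).trans (hnone y (hxy ▸ hx)).symm
    · induction q using Quotient.inductionOn with
      | h d => exact (hsome x d hx).trans (hsome y d (hxy ▸ hx)).symm

theorem addEdge_numCycles_face [Finite D] (h : M.root ≠ M.face (M.face M.root))
    (h' : M.face M.root ≠ M.root) : M.addEdge.face.numCycles = M.face.numCycles + 1 := by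
  rw [numCycles_eq_card M.faceBase ?_ (addEdge_sameFace h h')]
  · rw [Finite.card_option]; rfl
  · rintro (_ | ⟨⟨d⟩⟩)
    · exact ⟨.inr false, rfl⟩
    · by_cases h1 : d = M.root ∨ d = M.face M.root
      · refine ⟨.inr true, ?_⟩
        refine congrArg some (Quotient.sound ?_)
        rcases h1 with rfl | rfl
        · exact SameCycle.refl _ _
        · exact sameCycle_apply _ _
      · refine ⟨.inl d, ?_⟩
        simp only [faceBase, Sum.elim_inl, h1, if_false]
        rfl

theorem addEdge_isOuter_inl (h : M.root ≠ M.face (M.face M.root)) (h' : M.face M.root ≠ M.root)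
    (d : D) : M.addEdge.IsOuter (.inl d) ↔ M.IsOuter d ∧ d ≠ M.root ∧ d ≠ M.face M.root := by
  rw [IsOuter, addEdge_sameFace h h', addEdge_root]
  simp only [faceBase, Sum.elim_inr, Sum.elim_inl, cond_true]
  split_ifs with h1
  · simp only [false_iff]
    tauto
  · rw [Option.some.injEq]
    refine ⟨fun e => ⟨Quotient.exact e, by tauto⟩, fun e => Quotient.sound e.1⟩

theorem addEdge_isOuter_false (h : M.root ≠ M.face (M.face M.root))
    (h' : M.face M.root ≠ M.root) : ¬ M.addEdge.IsOuter (.inr false) := by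
  rw [IsOuter, addEdge_sameFace h h', addEdge_root]
  simp [faceBase]

theorem addEdge_outerLength [Finite D] (h : M.root ≠ M.face (M.face M.root))
    (h' : M.face M.root ≠ M.root) : M.addEdge.outerLength + 1 = M.outerLength := by
  have h1 : M.addEdge.outerLength = ({d | M.IsOuter d} \ {M.root, M.face M.root}).ncard + 1 := by
    have : {x | M.addEdge.IsOuter x} =
        insert (.inr true) (Sum.inl '' ({d | M.IsOuter d} \ {M.root, M.face M.root})) := by
      ext x
      rcases x with d | (_ | _)
      · simp [addEdge_isOuter_inl h h', not_or]
      · simp [addEdge_isOuter_false h h']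
      · simpa using M.addEdge.isOuter_root
    change Set.ncard {x | M.addEdge.IsOuter x} = _
    rw [this, Set.ncard_insert_of_notMem (by simp) (Set.toFinite _),
      Set.ncard_image_of_injective _ Sum.inl_injective]
  have h2 := Set.ncard_sdiff_add_ncard_of_subset (s := {M.root, M.face M.root})
    (t := {d | M.IsOuter d}) (by
      rintro d (rfl | rfl)
      · exact M.isOuter_root
      · exact M.isOuter_face.2 M.isOuter_root) (Set.toFinite _)
  rw [Set.ncard_pair h'.symm] at h2
  have h3 : M.outerLength = Set.ncard {d | M.IsOuter d} := rfl
  omega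

/-- The maps that turn into a disk triangulation, other than a single edge, when the corner at the
end of the root is cut off. -/
structure Closable (M : DartMap D) : Prop extends M.IsTriangulated where
  not_sameVertex : ¬ M.rot.SameCycle M.root (M.face (M.face M.root))
  not_adj : ∀ d, M.rot.SameCycle M.root d →
    ¬ M.rot.SameCycle (M.face (M.face M.root)) (M.inv d)
  outer_almost_cycle : ∀ d e, M.IsOuter d → M.IsOuter e → d ≠ M.face M.root →
    e ≠ M.face M.root → M.rot.SameCycle d e → d = e

theorem IsTriangulated.face_ne (hM : M.IsTriangulated) (d : D) : M.face d ≠ d := by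
  intro e
  apply hM.no_loop d
  have := sameCycle_apply M.rot (M.inv d)
  rwa [← face_apply, e] at this

theorem sameVertex_face (M : DartMap D) (d : D) : M.rot.SameCycle (M.inv d) (M.face d) :=
  sameCycle_apply M.rot (M.inv d)

theorem Closable.root_ne (h : M.Closable) : M.root ≠ M.face (M.face M.root) :=
  fun e => h.not_sameVertex (e ▸ SameCycle.refl _ _)

/-- Cutting off a corner of a closable map: the new edge neither is a loop nor doubles an edge, and
the only boundary vertex that may be repeated is covered. -/
theorem Closable.isDisk_addEdge [Finite D] (h : M.Closable) : M.addEdge.IsDisk := by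
  have h1 := h.root_ne
  have h2 := h.face_ne M.root
  have hv := addEdge_sameVertex h1
  refine ⟨⟨?_, ?_, ?_, ?_, ?_, ?_, ?_⟩, ?_⟩
  · rintro (d | (_ | _)) <;> simp [h.inv_inv]
  · rintro (d | (_ | _)) <;> simp [h.inv_ne]
  · intro G hG1 hG2
    have ht := hG1 (.inr true)
    rw [addEdge_rot_true] at ht
    have hf := hG1 (.inr false)
    rw [addEdge_rot_false h1] at hf
    have hG : ∀ d e, G (.inl d) → G (.inl e) := by
      refine h.connected (fun d => G (.inl d)) (fun d => ?_) (fun d => ?_)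
      · have := hG1 (.inl d)
        rw [addEdge_rot_inl] at this
        split_ifs at this with h3 h4
        · rw [h3]; exact hf.trans this
        · rw [h4]; exact ht.trans this
        · exact this
      · exact hG2 (.inl d)
    have key : ∀ x, G x ↔ G (.inl (M.base x)) := by
      rintro (d | (_ | _))
      · rfl
      · exact hf.symm
      · exact ht.symm
    intro d e
    rw [key d, key e]
    exact hG _ _
  · rw [addEdge_numCycles_rot h1, addEdge_numCycles_face h1 h2, Nat.card_sum]
    have := h.planar
    have : Nat.card Bool = 2 := by simp
    omega
  · rintro (d | (_ | _))
    · rw [hv]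
      exact h.no_loop d
    · rw [hv]
      simpa using h.not_sameVertex
    · rw [hv]
      simpa using fun e => h.not_sameVertex e.symm
  · rintro (d | (_ | _)) (e | (_ | _)) <;> rw [hv, hv] <;>
      simp only [addEdge_inv_inl, addEdge_inv_true, addEdge_inv_false, base_inl, base_true,
        base_false]
    · intro a b
      rw [h.no_multiple_edge d e a b]
    · intro a b
      exact (h.not_adj (M.inv d) b.symm (by rw [h.inv_inv]; exact a.symm)).elim
    · intro a b
      exact (h.not_adj d a.symm b.symm).elim
    · intro a b
      exact (h.not_adj (M.inv e) b (by rw [h.inv_inv]; exact a)).elim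
    · simp
    · intro a b
      exact (h.not_sameVertex b).elim
    · intro a b
      exact (h.not_adj e a b).elim
    · intro a b
      exact (h.not_sameVertex a).elim
    · simp
  · rintro (d | (_ | _)) hd
    · rw [addEdge_isOuter_inl h1 h2] at hd
      rw [addEdge_face_inl]
      split_ifs with h3 h4
      · rw [addEdge_face_false, addEdge_face_inl, if_neg h2.symm, if_neg h2, h3]
      · have h5 : M.IsOuter d := by
          rw [← M.isOuter_face, h4]
          exact M.isOuter_root
        have h6 : d = M.root := by tauto
        rw [h6] at h4
        exact (h2 h4).elim
      · by_cases h5 : d = M.root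
        · rw [h5, addEdge_face_inl, if_pos rfl, addEdge_face_false]
        · have h6 : ¬ M.IsOuter d := by tauto
          have h7 : ∀ d, ¬ M.IsOuter d → M.addEdge.face (.inl d) = .inl (M.face d) := by
            intro d hd
            rw [addEdge_face_inl, if_neg, if_neg]
            · exact fun e => hd (M.isOuter_face.1 (e ▸ M.isOuter_root))
            · exact fun e => hd (e ▸ M.isOuter_face.2 M.isOuter_root)
          have h8 : ¬ M.IsOuter (M.face d) := by rwa [isOuter_face]
          rw [h7 _ h8, h7 _ (by rwa [isOuter_face]), h.bounded_triangle d h6]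
    · rw [addEdge_face_false, addEdge_face_inl, if_neg h2.symm, if_neg h2, addEdge_face_inl,
        if_pos rfl]
    · exact (hd M.addEdge.isOuter_root).elim
  · -- the tail of the new root is the tail of the old one
    have hr : ∀ d, M.addEdge.IsOuter (.inl d) → ¬ M.rot.SameCycle M.root d := by
      intro d hd hc
      rw [addEdge_isOuter_inl h1 h2] at hd
      exact hd.2.1 (h.outer_almost_cycle _ _ M.isOuter_root hd.1 h2.symm hd.2.2 hc).symm
    rintro (d | (_ | _)) (e | (_ | _)) hd he <;> rw [hv] <;> simp only [base_inl, base_true,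
        base_false]
    · rw [addEdge_isOuter_inl h1 h2] at hd he
      intro a
      rw [h.outer_almost_cycle _ _ hd.1 he.1 hd.2.2 he.2.2 a]
    · exact (addEdge_isOuter_false h1 h2 he).elim
    · intro a
      exact (hr d hd a.symm).elim
    · exact (addEdge_isOuter_false h1 h2 hd).elim
    · simp
    · exact (addEdge_isOuter_false h1 h2 hd).elim
    · intro a
      exact (hr e he a).elim
    · exact (addEdge_isOuter_false h1 h2 he).elim
    · simp

/-- The conditions of `Closable` are necessary: they say that the map obtained by adding the edge is
simple and that its outer face is bounded by a cycle. -/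
theorem closable_of_isDisk_addEdge [Finite D] (h1 : M.root ≠ M.face (M.face M.root))
    (h2 : M.face M.root ≠ M.root) (h : M.addEdge.IsDisk) : M.Closable := by
  have hv := addEdge_sameVertex h1
  refine ⟨⟨fun d => ?_, fun d e => ?_, ?_, ?_, fun d => ?_, fun d e => ?_, fun d hd => ?_⟩,
    ?_, fun d => ?_, fun d e hd he hd' he' hde => ?_⟩
  · simpa using h.inv_inv (.inl d)
  · exact h.inv_ne (.inl d) (by simp [e])
  · intro G hG1 hG2 d e hd
    have hr : G (M.face (M.face M.root)) ↔ G M.root := by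
      simp only [face_apply, hG1, hG2]
    refine h.connected (fun x => G (M.base x)) ?_ ?_ (.inl d) (.inl e) hd
    · rintro (d | (_ | _))
      · rw [addEdge_rot_inl]
        split_ifs with h3 h4
        · simp [← h3, hG1]
        · simp [← h4, hG1]
        · simp [hG1]
      · rw [addEdge_rot_false h1]; rfl
      · rw [addEdge_rot_true]; rfl
    · rintro (d | (_ | _))
      · exact hG2 d
      · simpa using hr.symm
      · simpa using hr
  · have := h.planar
    rw [addEdge_numCycles_rot h1, addEdge_numCycles_face h1 h2, Nat.card_sum] at this
    have : Nat.card Bool = 2 := by simp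
    omega
  · have := h.no_loop (.inl d)
    rwa [hv] at this
  · have := h.no_multiple_edge (.inl d) (.inl e)
    rw [hv, hv] at this
    simpa using this
  · have h6 : M.addEdge.face (.inl d) = .inl (M.face d) ∧ ¬ M.addEdge.IsOuter (.inl d) := by
      rw [addEdge_isOuter_inl h1 h2]
      refine ⟨?_, fun e => hd e.1⟩
      rw [addEdge_face_inl, if_neg, if_neg]
      · exact fun e => hd (M.isOuter_face.1 (e ▸ M.isOuter_root))
      · exact fun e => hd (e ▸ M.isOuter_face.2 M.isOuter_root)
    have h7 : ∀ d, ¬ M.IsOuter d → M.addEdge.face (.inl d) = .inl (M.face d) := by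
      intro d hd
      rw [addEdge_face_inl, if_neg, if_neg]
      · exact fun e => hd (M.isOuter_face.1 (e ▸ M.isOuter_root))
      · exact fun e => hd (e ▸ M.isOuter_face.2 M.isOuter_root)
    have h8 : ¬ M.IsOuter (M.face d) := by rwa [isOuter_face]
    have := h.bounded_triangle _ h6.2
    rw [h6.1, h7 _ h8, h7 _ (by rwa [isOuter_face])] at this
    exact Sum.inl_injective this
  · have := h.no_loop (.inr false)
    rwa [hv] at this
  · intro h3 h4
    have := h.no_multiple_edge (.inr true) (.inl d)
    rw [hv, hv] at this
    simpa using this h3 (by simpa using h4)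
  · have key : ∀ d, M.IsOuter d → d ≠ M.face M.root → ∃ x, M.addEdge.IsOuter x ∧ M.base x = d := by
      intro d hd hd'
      by_cases h3 : d = M.root
      · exact ⟨.inr true, M.addEdge.isOuter_root, h3.symm⟩
      · exact ⟨.inl d, (addEdge_isOuter_inl h1 h2 d).2 ⟨hd, h3, hd'⟩, rfl⟩
    obtain ⟨x, hx, rfl⟩ := key d hd hd'
    obtain ⟨y, hy, rfl⟩ := key e he he'
    rw [h.outer_cycle x y hx hy ((hv _ _).2 hde)]

end DartMap

/-! ### Joining two maps at a boundary vertex -/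

namespace Equiv.Perm

variable {α β : Type*} (σ : Perm α) (τ : Perm β)

theorem sameCycle_sumCongr_inl {x y : α} :
    (Perm.sumCongr σ τ).SameCycle (Sum.inl x) (Sum.inl y) ↔ σ.SameCycle x y := by
  constructor
  · intro h
    refine SameCycle.map_of (τ := σ) (Sum.elim id fun _ => x) (fun d => ?_) h
    rcases d with d | d
    · exact sameCycle_apply σ d
    · exact SameCycle.refl _ _
  · exact SameCycle.map_of _ fun d => sameCycle_apply (Perm.sumCongr σ τ) (Sum.inl d)

theorem sameCycle_sumCongr_inr {x y : β} :
    (Perm.sumCongr σ τ).SameCycle (Sum.inr x) (Sum.inr y) ↔ τ.SameCycle x y := by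
  constructor
  · intro h
    refine SameCycle.map_of (τ := τ) (Sum.elim (fun _ => x) id) (fun d => ?_) h
    rcases d with d | d
    · exact SameCycle.refl _ _
    · exact sameCycle_apply τ d
  · exact SameCycle.map_of _ fun d => sameCycle_apply (Perm.sumCongr σ τ) (Sum.inr d)

theorem not_sameCycle_sumCongr {x : α} {y : β} :
    ¬ (Perm.sumCongr σ τ).SameCycle (Sum.inl x) (Sum.inr y) := by
  intro h
  have := SameCycle.eq_of_invariant Sum.isLeft (fun d => by rcases d with d | d <;> rfl) h
  simp at this

theorem not_sameCycle_sumCongr' {x : α} {y : β} :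
    ¬ (Perm.sumCongr σ τ).SameCycle (Sum.inr y) (Sum.inl x) :=
  fun h => not_sameCycle_sumCongr σ τ h.symm

theorem numCycles_sumCongr [Finite α] [Finite β] :
    (Perm.sumCongr σ τ).numCycles = σ.numCycles + τ.numCycles := by
  rw [show σ.numCycles + τ.numCycles = Nat.card (Quotient (SameCycle.setoid σ) ⊕
    Quotient (SameCycle.setoid τ)) from Nat.card_sum.symm]
  refine numCycles_eq_card (Sum.map (Quotient.mk (SameCycle.setoid σ))
    (Quotient.mk (SameCycle.setoid τ))) ?_ ?_
  · rintro (⟨⟨d⟩⟩ | ⟨⟨d⟩⟩)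
    · exact ⟨.inl d, rfl⟩
    · exact ⟨.inr d, rfl⟩
  · rintro (x | x) (y | y)
    · rw [sameCycle_sumCongr_inl]
      exact ⟨fun h => congrArg Sum.inl (Quotient.sound h),
        fun h => Quotient.exact (Sum.inl_injective h)⟩
    · simp [not_sameCycle_sumCongr]
    · simp [not_sameCycle_sumCongr']
    · rw [sameCycle_sumCongr_inr]
      exact ⟨fun h => congrArg Sum.inr (Quotient.sound h),
        fun h => Quotient.exact (Sum.inr_injective h)⟩

end Equiv.Perm

namespace DartMap

variable {D₁ D₂ : Type} (M₁ : DartMap D₁) (M₂ : DartMap D₂)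

/-- The disjoint union of `M₁` and `M₂` with the initial vertex of the root of `M₁` identified with
the terminal vertex of the root of `M₂`.  On the boundary walk of the outer face, the root of `M₁`
follows the root of `M₂`, which is the root of the join. -/
noncomputable def join : DartMap (D₁ ⊕ D₂) where
  rot := swap (Sum.inl M₁.root) (Sum.inr (M₂.face M₂.root)) * Perm.sumCongr M₁.rot M₂.rot
  inv := Perm.sumCongr M₁.inv M₂.inv
  root := Sum.inr M₂.root

@[simp] theorem join_root : (M₁.join M₂).root = .inr M₂.root := rfl
@[simp] theorem join_inv_inl (d : D₁) : (M₁.join M₂).inv (.inl d) = .inl (M₁.inv d) := rfl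
@[simp] theorem join_inv_inr (d : D₂) : (M₁.join M₂).inv (.inr d) = .inr (M₂.inv d) := rfl

theorem join_rot : (M₁.join M₂).rot =
    swap (Sum.inl M₁.root) (Sum.inr (M₂.face M₂.root)) * Perm.sumCongr M₁.rot M₂.rot := rfl

theorem join_face : (M₁.join M₂).face =
    swap (Sum.inl M₁.root) (Sum.inr (M₂.face M₂.root)) * Perm.sumCongr M₁.face M₂.face := by
  ext d
  rcases d with d | d <;> rfl

theorem join_rot_inl (d : D₁) : (M₁.join M₂).rot (.inl d) =
    if M₁.rot d = M₁.root then .inr (M₂.face M₂.root) else .inl (M₁.rot d) := by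
  simp [join, swap_apply_def]

theorem join_rot_inr (d : D₂) : (M₁.join M₂).rot (.inr d) =
    if M₂.rot d = M₂.face M₂.root then .inl M₁.root else .inr (M₂.rot d) := by
  simp [join, swap_apply_def]

theorem join_face_inl (d : D₁) : (M₁.join M₂).face (.inl d) =
    if M₁.face d = M₁.root then .inr (M₂.face M₂.root) else .inl (M₁.face d) :=
  join_rot_inl M₁ M₂ (M₁.inv d)

theorem join_face_inr (d : D₂) : (M₁.join M₂).face (.inr d) =
    if d = M₂.root then .inl M₁.root else .inr (M₂.face d) := by
  rw [← M₂.face.injective.eq_iff (a := d)]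
  exact join_rot_inr M₁ M₂ (M₂.inv d)

@[simp] theorem join_face_root : (M₁.join M₂).face (.inr M₂.root) = .inl M₁.root := by
  rw [join_face_inr, if_pos rfl]

section

variable {M₁ M₂} [Finite D₁] [Finite D₂]

theorem join_sameVertex_inl {d e : D₁} : (M₁.join M₂).rot.SameCycle (.inl d) (.inl e) ↔
    M₁.rot.SameCycle d e := by
  rw [join_rot, sameCycle_swap_mul_iff (not_sameCycle_sumCongr _ _)]
  simp only [sameCycle_sumCongr_inl, not_sameCycle_sumCongr, or_false]
  exact ⟨fun h => h.elim id fun h => h.1.trans h.2.symm, .inl⟩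

theorem join_sameVertex_inr {d e : D₂} : (M₁.join M₂).rot.SameCycle (.inr d) (.inr e) ↔
    M₂.rot.SameCycle d e := by
  rw [join_rot, sameCycle_swap_mul_iff (not_sameCycle_sumCongr _ _)]
  simp only [sameCycle_sumCongr_inr, not_sameCycle_sumCongr', false_or]
  exact ⟨fun h => h.elim id fun h => h.1.trans h.2.symm, .inl⟩

theorem join_sameVertex_inl_inr {d : D₁} {e : D₂} :
    (M₁.join M₂).rot.SameCycle (.inl d) (.inr e) ↔
      M₁.rot.SameCycle d M₁.root ∧ M₂.rot.SameCycle e (M₂.face M₂.root) := by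
  rw [join_rot, sameCycle_swap_mul_iff (not_sameCycle_sumCongr _ _)]
  simp only [sameCycle_sumCongr_inr, not_sameCycle_sumCongr', not_sameCycle_sumCongr,
    sameCycle_sumCongr_inl, false_or, or_false]

theorem join_sameVertex_inr_inl {d : D₁} {e : D₂} :
    (M₁.join M₂).rot.SameCycle (.inr e) (.inl d) ↔
      M₁.rot.SameCycle d M₁.root ∧ M₂.rot.SameCycle e (M₂.face M₂.root) := by
  rw [sameCycle_comm, join_sameVertex_inl_inr]

theorem join_isOuter_inl {d : D₁} : (M₁.join M₂).IsOuter (.inl d) ↔ M₁.IsOuter d := by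
  rw [IsOuter, IsOuter, join_face, sameCycle_swap_mul_iff (not_sameCycle_sumCongr _ _)]
  simp only [sameCycle_sumCongr_inr, not_sameCycle_sumCongr', not_sameCycle_sumCongr,
    sameCycle_sumCongr_inl, false_or, or_false, join_root, sameCycle_apply, true_and]
  exact sameCycle_comm

theorem join_isOuter_inr {d : D₂} : (M₁.join M₂).IsOuter (.inr d) ↔ M₂.IsOuter d := by
  rw [IsOuter, IsOuter, join_face, sameCycle_swap_mul_iff (not_sameCycle_sumCongr _ _)]
  simp only [sameCycle_sumCongr_inr, not_sameCycle_sumCongr',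
    false_or, join_root, sameCycle_apply, true_and,
    sameCycle_apply_right]
  rw [sameCycle_comm (x := d), or_self]

theorem join_outerLength :
    (M₁.join M₂).outerLength = M₁.outerLength + M₂.outerLength := by
  rw [outerLength, outerLength, outerLength, ← Nat.card_sum]
  refine Nat.card_congr (Equiv.trans (Equiv.subtypeSum) (Equiv.sumCongr ?_ ?_))
  · exact Equiv.subtypeEquivRight fun d => join_isOuter_inl
  · exact Equiv.subtypeEquivRight fun d => join_isOuter_inr

theorem join_numCycles_rot :
    (M₁.join M₂).rot.numCycles + 1 = M₁.rot.numCycles + M₂.rot.numCycles := by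
  rw [join_rot, numCycles_swap_mul_of_not (not_sameCycle_sumCongr _ _), numCycles_sumCongr]

theorem join_numCycles_face :
    (M₁.join M₂).face.numCycles + 1 = M₁.face.numCycles + M₂.face.numCycles := by
  rw [join_face, numCycles_swap_mul_of_not (not_sameCycle_sumCongr _ _), numCycles_sumCongr]

/-- The boundary walk of a join repeats precisely the vertex at which the two disks are joined. This
is the terminal vertex of the root, which is cut off when an edge is added. -/
theorem IsDisk.join_closable (h₁ : M₁.IsDisk) (h₂ : M₂.IsDisk) : (M₁.join M₂).Closable := by
  have hl : ∀ d, ¬ M₁.rot.SameCycle (M₁.face d) d := fun d hd =>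
    h₁.no_loop d ((M₁.sameVertex_face d).trans hd)
  have hl₂ : ∀ d, ¬ M₂.rot.SameCycle (M₂.face d) d := fun d hd =>
    h₂.no_loop d ((M₂.sameVertex_face d).trans hd)
  have hf : (M₁.join M₂).face ((M₁.join M₂).face (M₁.join M₂).root) = .inl (M₁.face M₁.root) := by
    rw [join_root, join_face_root, join_face_inl, if_neg (h₁.face_ne _)]
  refine { inv_inv := ?_, inv_ne := ?_, connected := ?_, planar := ?_, no_loop := ?_,
           no_multiple_edge := ?_, bounded_triangle := ?_, not_sameVertex := ?_, not_adj := ?_,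
           outer_almost_cycle := ?_ }
  · rintro (d | d) <;> simp [h₁.inv_inv, h₂.inv_inv]
  · rintro (d | d) <;> simp [h₁.inv_ne, h₂.inv_ne]
  · intro G hG1 hG2
    have hv : ∀ {x y}, (M₁.join M₂).rot.SameCycle x y → (G x ↔ G y) := fun {x y} h =>
      (SameCycle.eq_of_invariant G (fun d => propext (hG1 d)) h).to_iff
    have c1 := h₁.connected (fun d => G (.inl d))
      (fun d => hv (join_sameVertex_inl.2 (sameCycle_apply _ _).symm)) (fun d => hG2 (.inl d))
    have c2 := h₂.connected (fun d => G (.inr d))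
      (fun d => hv (join_sameVertex_inr.2 (sameCycle_apply _ _).symm)) (fun d => hG2 (.inr d))
    have c3 : G (.inl M₁.root) ↔ G (.inr (M₂.face M₂.root)) :=
      hv (join_sameVertex_inl_inr.2 ⟨SameCycle.refl _ _, SameCycle.refl _ _⟩)
    rintro (d | d) (e | e) hd
    · exact c1 _ _ hd
    · exact c2 _ _ (c3.1 (c1 _ _ hd))
    · exact c1 _ _ (c3.2 (c2 _ _ hd))
    · exact c2 _ _ hd
  · have h1 := join_numCycles_rot (M₁ := M₁) (M₂ := M₂)
    have h2 := join_numCycles_face (M₁ := M₁) (M₂ := M₂)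
    have h3 := h₁.planar
    have h4 := h₂.planar
    rw [Nat.card_sum]
    omega
  · rintro (d | d)
    · rw [join_inv_inl, join_sameVertex_inl]
      exact h₁.no_loop d
    · rw [join_inv_inr, join_sameVertex_inr]
      exact h₂.no_loop d
  · rintro (d | d) (e | e)
    · simp only [join_inv_inl, join_sameVertex_inl]
      intro a b
      rw [h₁.no_multiple_edge d e a b]
    · simp only [join_inv_inl, join_inv_inr, join_sameVertex_inl_inr]
      intro a b
      exact (h₁.no_loop d (b.1.trans a.1.symm)).elim
    · simp only [join_inv_inl, join_inv_inr, join_sameVertex_inr_inl]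
      intro a b
      exact (h₁.no_loop e (b.1.trans a.1.symm)).elim
    · simp only [join_inv_inr, join_sameVertex_inr]
      intro a b
      rw [h₂.no_multiple_edge d e a b]
  · rintro (d | d) hd
    · rw [join_isOuter_inl] at hd
      have key : ∀ d, ¬ M₁.IsOuter d → (M₁.join M₂).face (.inl d) = .inl (M₁.face d) := by
        intro d hd
        rw [join_face_inl, if_neg]
        exact fun e => hd (M₁.isOuter_face.1 (e ▸ M₁.isOuter_root))
      rw [key _ hd, key _ (by rwa [isOuter_face]), key _ (by rwa [isOuter_face, isOuter_face]),
        h₁.bounded_triangle d hd]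
    · rw [join_isOuter_inr] at hd
      have key : ∀ d, ¬ M₂.IsOuter d → (M₁.join M₂).face (.inr d) = .inr (M₂.face d) := by
        intro d hd
        rw [join_face_inr, if_neg]
        exact fun e => hd (e ▸ M₂.isOuter_root)
      rw [key _ hd, key _ (by rwa [isOuter_face]), key _ (by rwa [isOuter_face, isOuter_face]),
        h₂.bounded_triangle d hd]
  · rw [hf, join_root, join_sameVertex_inr_inl]
    exact fun e => hl _ e.1
  · rw [hf, join_root]
    rintro (d | d)
    · rw [join_sameVertex_inr_inl]
      exact fun a => (hl₂ _ a.2.symm).elim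
    · intro _
      rw [join_inv_inr, join_sameVertex_inl_inr]
      exact fun a => hl _ a.1
  · rw [join_root, join_face_root]
    rintro (d | d) (e | e) hd he hd' he' <;>
      simp only [join_isOuter_inl, join_isOuter_inr] at hd he <;>
      simp only [join_sameVertex_inl, join_sameVertex_inr, join_sameVertex_inl_inr,
        join_sameVertex_inr_inl]
    · intro a
      rw [h₁.outer_cycle d e hd he a]
    · intro a
      exact (hd' (by rw [h₁.outer_cycle d _ hd M₁.isOuter_root a.1])).elim
    · intro a
      exact (he' (by rw [h₁.outer_cycle e _ he M₁.isOuter_root a.1])).elim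
    · intro a
      rw [h₂.outer_cycle d e hd he a]

end

end DartMap

/-! ### Removing the root edge, and splitting a map at a repeated boundary vertex -/

namespace DartMap

variable {D D' D₁ D₂ : Type}

theorem Iso.closable {M : DartMap D} {N : DartMap D'} (h : M.Iso N) (hM : M.Closable) :
    N.Closable := by
  refine { h.isTriangulated hM.toIsTriangulated with
           not_sameVertex := ?_, not_adj := ?_, outer_almost_cycle := ?_ }
  all_goals obtain ⟨e, h1, h2, h3⟩ := h.symm
  all_goals have hv := fun x y => RootedMap.sameCycle_of_intertwine e N.rot M.rot h1 x y
  all_goals have hf := face_intertwine h1 h2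
  · rw [hv, hf, hf, h3]
    exact hM.not_sameVertex
  · intro d
    rw [hv, hv, hf, hf, h2, h3]
    exact hM.not_adj _
  · intro x y hx hy hx' hy' hxy
    refine e.injective (hM.outer_almost_cycle _ _ ((isOuter_iff h1 h2 h3 x).1 hx)
      ((isOuter_iff h1 h2 h3 y).1 hy) ?_ ?_ ((hv _ _).1 hxy))
    · rw [← h3, ← hf]
      exact fun h => hx' (e.injective h)
    · rw [← h3, ← hf]
      exact fun h => hy' (e.injective h)

/-- In a disk triangulation whose root edge has the outer face on both sides, there is no other
edge. -/
theorem IsDisk.eq_root_or_of_isOuter_inv {M : DartMap D} (hM : M.IsDisk)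
    (h : M.IsOuter (M.inv M.root)) (d : D) : d = M.root ∨ d = M.inv M.root := by
  have h1 : M.face M.root = M.inv M.root :=
    hM.outer_cycle _ _ (M.isOuter_face.2 M.isOuter_root) h (M.sameVertex_face _).symm
  have h2 : M.face (M.inv M.root) = M.root := by
    refine hM.outer_cycle _ _ (M.isOuter_face.2 h) M.isOuter_root ?_
    have := (M.sameVertex_face (M.inv M.root)).symm
    rwa [hM.inv_inv] at this
  have h3 : M.rot (M.inv M.root) = M.inv M.root := h1
  have h4 : M.rot M.root = M.root := by
    rwa [face_apply, hM.inv_inv] at h2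
  refine hM.connected (fun d => d = M.root ∨ d = M.inv M.root) (fun d => ?_) (fun d => ?_)
    M.root d (.inl rfl)
  · have a1 : M.rot d = M.root ↔ d = M.root :=
      ⟨fun e => M.rot.injective (e.trans h4.symm), fun e => by rw [e, h4]⟩
    have a2 : M.rot d = M.inv M.root ↔ d = M.inv M.root :=
      ⟨fun e => M.rot.injective (e.trans h3.symm), fun e => by rw [e, h3]⟩
    rw [a1, a2]
  · have a1 : M.inv d = M.root ↔ d = M.inv M.root :=
      ⟨fun e => by rw [← e, hM.inv_inv], fun e => by rw [e, hM.inv_inv]⟩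
    have a2 : M.inv d = M.inv M.root ↔ d = M.root := M.inv.injective.eq_iff
    rw [a1, a2, or_comm]

/-- The restriction of a map to an invariant set of darts. -/
def restrict (M : DartMap D) (P : D → Prop) (h1 : ∀ d, P (M.rot d) ↔ P d)
    (h2 : ∀ d, P (M.inv d) ↔ P d) (r : D) (hr : P r) : DartMap {d // P d} where
  rot := M.rot.subtypePerm h1
  inv := M.inv.subtypePerm h2
  root := ⟨r, hr⟩

/-- The root edge of a disk triangulation other than a single edge can be removed: the triangle at
its inner side becomes a corner of the boundary. -/
theorem IsDisk.exists_addEdge [Finite D] {M : DartMap D} (hM : M.IsDisk)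
    (h : ¬ M.IsOuter (M.inv M.root)) :
    ∃ (E : Type) (_ : Finite E) (N : DartMap E), M.Iso N.addEdge ∧ N.Closable := by
  set a := M.root with ha
  set a' := M.inv a with ha'
  have haa : a' ≠ a := hM.inv_ne a
  have hia : M.inv a' = a := hM.inv_inv a
  set r := M.rot a with hr
  set r'' := M.rot a' with hr''
  -- the triangle at the root edge
  have f1 : M.face a' = r := by rw [face_apply, hia]
  have f2 : M.face (M.face r) = a' := by rw [← f1]; exact hM.bounded_triangle a' h
  have f3 : M.face a = r'' := rfl
  have hrout : ¬ M.IsOuter r := by rwa [← f1, isOuter_face]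
  have hrout' : ¬ M.IsOuter (M.face r) := by rwa [isOuter_face]
  have h1 : r ≠ a := fun e => hrout (e ▸ M.isOuter_root)
  have h2 : r ≠ a' := fun e => hM.face_ne a' (by rw [f1, e])
  have h3 : r'' ≠ a' := fun e => h (by rw [← e, ← f3, isOuter_face]; exact M.isOuter_root)
  have h4 : r'' ≠ a := fun e => hM.face_ne a (by rw [f3, e])
  have h5 : M.face r ≠ a := fun e => hrout' (e ▸ M.isOuter_root)
  have h6 : M.face r ≠ a' := fun e => hM.face_ne (M.face r) (by rw [f2, e])
  have h7 : r ≠ r'' := fun e => haa (M.rot.injective e).symm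
  let P : D → Prop := fun d => d ≠ a ∧ d ≠ a'
  let σ : Perm D := swap a' r'' * (swap a r * M.rot)
  have hσ : ∀ d, P d → σ d = if M.rot d = a then r else if M.rot d = a' then r'' else M.rot d := by
    intro d hd
    have e1 : M.rot d ≠ r := fun e => hd.1 (M.rot.injective e)
    have e2 : M.rot d ≠ r'' := fun e => hd.2 (M.rot.injective e)
    simp only [σ, mul_apply, swap_apply_def]
    split_ifs <;> simp_all
  have hσa : σ a = a := by simp [σ, ← hr, swap_apply_of_ne_of_ne haa.symm h4.symm]
  have hσa' : σ a' = a' := by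
    simp [σ, ← hr'', swap_apply_of_ne_of_ne h4 h7.symm]
  have hPσ : ∀ d, P (σ d) ↔ P d := by
    intro d
    have e1 : σ d = a ↔ d = a := by rw [← hσa, σ.injective.eq_iff, hσa]
    have e2 : σ d = a' ↔ d = a' := by rw [← hσa', σ.injective.eq_iff, hσa']
    simp only [P, ne_eq, e1, e2]
  have hPi : ∀ d, P (M.inv d) ↔ P d := by
    intro d
    have a1 : M.inv d = a ↔ d = a' :=
      ⟨fun e => by rw [ha', ← e, hM.inv_inv], fun e => by rw [e, hia]⟩
    have a2 : M.inv d = a' ↔ d = a := M.inv.injective.eq_iff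
    simp only [P, ne_eq, a1, a2, and_comm]
  let N : DartMap {d // P d} :=
    { rot := σ.subtypePerm hPσ, inv := M.inv.subtypePerm hPi, root := ⟨r, h1, h2⟩ }
  have hNr : ∀ d : {d // P d}, ((N.rot d : {d // P d}) : D) =
      if M.rot d = a then r else if M.rot d = a' then r'' else M.rot d := fun d => hσ d.1 d.2
  have hNi : ∀ d : {d // P d}, ((N.inv d : {d // P d}) : D) = M.inv d := fun d => rfl
  have g1 : N.face N.root = ⟨M.face r, h5, h6⟩ := by
    apply Subtype.ext
    rw [face_apply, hNr, hNi, ← face_apply, if_neg h5, if_neg h6]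
  have g2 : N.face (N.face N.root) = ⟨r'', h4, h3⟩ := by
    apply Subtype.ext
    rw [g1, face_apply, hNr, hNi, ← face_apply, f2, if_neg haa, if_pos rfl]
  have hne : N.root ≠ N.face (N.face N.root) := by
    rw [g2]
    exact fun e => h7 (congrArg Subtype.val e)
  have hne' : N.face N.root ≠ N.root := by
    rw [g1]
    exact fun e => hM.face_ne r (congrArg Subtype.val e)
  -- putting the removed edge back
  let f : {d // P d} ⊕ Bool → D := Sum.elim Subtype.val fun b => cond b a a'
  have hf : Function.Bijective f := by
    constructor
    · rintro (x | (_ | _)) (y | (_ | _)) hxy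
      · exact congrArg Sum.inl (Subtype.ext hxy)
      · exact (x.2.2 hxy).elim
      · exact (x.2.1 hxy).elim
      · exact (y.2.2 hxy.symm).elim
      · rfl
      · exact (haa hxy).elim
      · exact (y.2.1 hxy.symm).elim
      · exact (haa hxy.symm).elim
      · rfl
    · intro d
      by_cases e1 : d = a
      · exact ⟨.inr true, e1.symm⟩
      by_cases e2 : d = a'
      · exact ⟨.inr false, e2.symm⟩
      exact ⟨.inl ⟨d, e1, e2⟩, rfl⟩
  have hiso : N.addEdge.Iso M := by
    refine ⟨Equiv.ofBijective f hf, ?_, ?_, rfl⟩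
    · rintro (d | (_ | _)) <;> rw [ofBijective_apply, ofBijective_apply]
      · have k1 : N.rot d = N.face (N.face N.root) ↔ M.rot d = a' := by
          rw [g2, Subtype.ext_iff, hNr]
          have e1 : M.rot d ≠ r'' := fun e => d.2.2 (M.rot.injective e)
          split_ifs <;> simp_all
        have k2 : N.rot d = N.root ↔ M.rot d = a := by
          rw [Subtype.ext_iff, hNr]
          have e1 : M.rot d ≠ r := fun e => d.2.1 (M.rot.injective e)
          change _ = r ↔ _
          split_ifs <;> simp_all
        rw [addEdge_rot_inl]
        split_ifs with c1 c2
        · exact (k1.1 c1).symm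
        · exact (k2.1 c2).symm
        · change ((N.rot d : {d // P d}) : D) = M.rot d
          rw [hNr, if_neg (fun e => c2 (k2.2 e)), if_neg (fun e => c1 (k1.2 e))]
      · rw [addEdge_rot_false hne, g2]
        rfl
      · rw [addEdge_rot_true]
        rfl
    · rintro (d | (_ | _)) <;> rw [ofBijective_apply, ofBijective_apply]
      · rfl
      · rw [addEdge_inv_false]
        exact hia.symm
      · rw [addEdge_inv_true]
        rfl
  exact ⟨_, inferInstance, N, hiso.symm,
    closable_of_isDisk_addEdge hne hne' (hiso.symm.isDisk hM)⟩

/-- If a join of two connected maps can be closed to a disk triangulation, then both parts are disk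
triangulations.  Planarity is the point: the Euler characteristics of the parts are at most `2`, and
their sum is determined by that of the join. -/
theorem isDisk_of_join_closable [Finite D₁] [Finite D₂] {M₁ : DartMap D₁} {M₂ : DartMap D₂}
    (h : (M₁.join M₂).Closable) (h₁ : M₁.Connected) (h₂ : M₂.Connected) :
    M₁.IsDisk ∧ M₂.IsDisk := by
  have i₁ : ∀ d, M₁.inv (M₁.inv d) = d := fun d => Sum.inl_injective (h.inv_inv (.inl d))
  have i₂ : ∀ d, M₂.inv (M₂.inv d) = d := fun d => Sum.inr_injective (h.inv_inv (.inr d))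
  have n₁ : ∀ d, M₁.inv d ≠ d := fun d e => h.inv_ne (.inl d) (congrArg Sum.inl e)
  have n₂ : ∀ d, M₂.inv d ≠ d := fun d e => h.inv_ne (.inr d) (congrArg Sum.inr e)
  have l₁ : ∀ d, ¬ M₁.rot.SameCycle (M₁.inv d) d := fun d e =>
    h.no_loop (.inl d) (join_sameVertex_inl.2 e)
  have l₂ : ∀ d, ¬ M₂.rot.SameCycle (M₂.inv d) d := fun d e =>
    h.no_loop (.inr d) (join_sameVertex_inr.2 e)
  -- both parts satisfy Euler's inequality, and the sum of the two is an equality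
  have e1 := two_mul_numCycles_le i₁ n₁ h₁
  have e2 := two_mul_numCycles_le i₂ n₂ h₂
  have e3 := join_numCycles_rot (M₁ := M₁) (M₂ := M₂)
  have e4 := join_numCycles_face (M₁ := M₁) (M₂ := M₂)
  have e5 := h.planar
  rw [Nat.card_sum] at e5
  have hroot : (M₁.join M₂).face (M₁.join M₂).root = .inl M₁.root := join_face_root _ _
  have f₁ : ∀ d, M₁.face d ≠ d := fun d e => l₁ d (by
    have := M₁.sameVertex_face d; rwa [e] at this)
  constructor
  · refine ⟨⟨i₁, n₁, h₁, by omega, l₁, fun d e a b => ?_, fun d hd => ?_⟩, fun d e hd he hde => ?_⟩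
    · exact Sum.inl_injective (h.no_multiple_edge (.inl d) (.inl e) (join_sameVertex_inl.2 a)
        (join_sameVertex_inl.2 b))
    · have := h.bounded_triangle (.inl d) (fun e => hd (join_isOuter_inl.1 e))
      have key : ∀ d, ¬ M₁.IsOuter d → (M₁.join M₂).face (.inl d) = .inl (M₁.face d) := by
        intro d hd
        rw [join_face_inl, if_neg]
        exact fun e => hd (M₁.isOuter_face.1 (e ▸ M₁.isOuter_root))
      rw [key _ hd, key _ (by rwa [isOuter_face]), key _ (by rwa [isOuter_face, isOuter_face])]
        at this
      exact Sum.inl_injective this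
    · have key : ∀ e, M₁.IsOuter e → M₁.rot.SameCycle M₁.root e → e = M₁.root := by
        intro e he hc
        by_contra hne
        have := h.outer_almost_cycle (.inl e) (.inr (M₂.face M₂.root)) (join_isOuter_inl.2 he)
          (join_isOuter_inr.2 (M₂.isOuter_face.2 M₂.isOuter_root))
          (by rw [hroot]; exact fun e => hne (Sum.inl_injective e)) (by rw [hroot]; simp)
          (join_sameVertex_inl_inr.2 ⟨hc.symm, SameCycle.refl _ _⟩)
        simp at this
      by_cases c1 : d = M₁.root
      · subst c1
        exact (key e he hde).symm
      by_cases c2 : e = M₁.root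
      · subst c2
        exact key d hd hde.symm
      refine Sum.inl_injective (h.outer_almost_cycle (.inl d) (.inl e) (join_isOuter_inl.2 hd)
        (join_isOuter_inl.2 he) ?_ ?_ (join_sameVertex_inl.2 hde)) <;> rw [hroot]
      · exact fun e => c1 (Sum.inl_injective e)
      · exact fun e => c2 (Sum.inl_injective e)
  · refine ⟨⟨i₂, n₂, h₂, by omega, l₂, fun d e a b => ?_, fun d hd => ?_⟩, fun d e hd he hde => ?_⟩
    · exact Sum.inr_injective (h.no_multiple_edge (.inr d) (.inr e) (join_sameVertex_inr.2 a)
        (join_sameVertex_inr.2 b))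
    · have := h.bounded_triangle (.inr d) (fun e => hd (join_isOuter_inr.1 e))
      have key : ∀ d, ¬ M₂.IsOuter d → (M₁.join M₂).face (.inr d) = .inr (M₂.face d) := by
        intro d hd
        rw [join_face_inr, if_neg]
        exact fun e => hd (e ▸ M₂.isOuter_root)
      rw [key _ hd, key _ (by rwa [isOuter_face]), key _ (by rwa [isOuter_face, isOuter_face])]
        at this
      exact Sum.inr_injective this
    · exact Sum.inr_injective (h.outer_almost_cycle (.inr d) (.inr e) (join_isOuter_inr.2 hd)
        (join_isOuter_inr.2 he) (by rw [hroot]; simp) (by rw [hroot]; simp)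
        (join_sameVertex_inr.2 hde))

theorem map_swap_apply {i : DecidableEq D} [DecidableEq D'] (e : D ≃ D') (a b z : D) :
    e (swap a b z) = swap (e a) (e b) (e z) :=
  (e.injective.swap_apply a b z).symm

/-- If the vertex of `r'` is split into two, and the darts then fall into two invariant sets, the
original map is the join of the restrictions to these sets. -/
theorem join_restrict_iso {S N : DartMap D} (P : D → Prop) (h1 : ∀ d, P (S.rot d) ↔ P d)
    (h2 : ∀ d, P (S.inv d) ↔ P d) {r' : D} (hr' : P r') (hr : ¬ P N.root)
    (hrot : N.rot = swap r' (S.face N.root) * S.rot) (hinv : N.inv = S.inv) :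
    ((S.restrict P h1 h2 r' hr').join (S.restrict (fun d => ¬ P d) (fun d => not_congr (h1 d))
      (fun d => not_congr (h2 d)) N.root hr)).Iso N := by
  refine ⟨sumCompl P, fun x => ?_, ?_, rfl⟩
  · rw [join_rot, hrot, mul_apply, mul_apply, map_swap_apply (sumCompl P)]
    rcases x with d | d <;> rfl
  · rw [hinv]
    rintro (d | d) <;> rfl

/-- A map that is not a disk triangulation although its boundary walk repeats at most one vertex is
a join.  Splitting the repeated vertex creates a vertex and a face, and the Euler characteristic
becomes too large for a connected map. -/
theorem Closable.exists_join [Finite D] {N : DartMap D} (hN : N.Closable) (h : ¬ N.IsDisk) :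
    ∃ (D₁ D₂ : Type) (_ : Finite D₁) (_ : Finite D₂) (M₁ : DartMap D₁) (M₂ : DartMap D₂),
      N.Iso (M₁.join M₂) ∧ M₁.IsDisk ∧ M₂.IsDisk := by
  set r' := N.face N.root with hr'
  obtain ⟨s, hs, hsr, hsv⟩ : ∃ s, N.IsOuter s ∧ r' ≠ s ∧ N.rot.SameCycle r' s := by
    by_contra hcon
    push Not at hcon
    refine h ⟨hN.toIsTriangulated, fun d e hd he hde => ?_⟩
    by_cases c1 : d = r'
    · subst c1
      by_contra c
      exact hcon e he c hde
    by_cases c2 : e = r'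
    · subst c2
      by_contra c
      exact hcon d hd (Ne.symm c) hde.symm
    exact hN.outer_almost_cycle d e hd he c1 c2 hde
  have hr'o : N.IsOuter r' := N.isOuter_face.2 N.isOuter_root
  obtain ⟨S, hSr, hSi⟩ : ∃ S : DartMap D, S.rot = swap r' s * N.rot ∧ S.inv = N.inv :=
    ⟨⟨_, _, N.root⟩, rfl, rfl⟩
  have hSf : S.face = swap r' s * N.face := by
    rw [face, hSr, hSi, mul_assoc]; rfl
  have hNS : ∀ d, N.rot d = swap r' s (S.rot d) := fun d => by simp [hSr]
  have c1 : S.rot.numCycles = N.rot.numCycles + 1 := by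
    rw [hSr]; exact numCycles_swap_mul hsr hsv
  have c2 : S.face.numCycles = N.face.numCycles + 1 := by
    rw [hSf]; exact numCycles_swap_mul hsr (hr'o.symm.trans hs)
  -- `S` is `N` with the repeated vertex split; its Euler characteristic would be `4`
  have hSc : ¬ S.Connected := by
    intro hc
    have e1 := two_mul_numCycles_le (M := S) (hSi ▸ hN.inv_inv) (hSi ▸ hN.inv_ne) hc
    have e2 := hN.planar
    omega
  have hglue : ∀ G : D → Prop, (∀ d, G (S.rot d) ↔ G d) → (∀ d, G (S.inv d) ↔ G d) →
      (G r' ↔ G s) → ∀ d e, G d → G e := by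
    intro G h1 h2 h3
    refine hN.connected G (fun d => ?_) (hSi ▸ h2)
    rw [hNS, ← h1 d, swap_apply_def]
    split_ifs with k1 k2
    · rw [k1, h3]
    · rw [k2, h3]
    · rfl
  -- the connected component of `r'` in `S`
  obtain ⟨P, hP⟩ : ∃ P : D → Prop, ∀ d, P d ↔ ∀ G : D → Prop, (∀ d, G (S.rot d) ↔ G d) →
    (∀ d, G (S.inv d) ↔ G d) → (G r' ↔ G d) := ⟨_, fun _ => Iff.rfl⟩
  have hPr : P r' := (hP _).2 fun G _ _ => Iff.rfl
  have hProt : ∀ d, P (S.rot d) ↔ P d := by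
    intro d
    rw [hP, hP]
    refine forall_congr' fun G => forall_congr' fun h1 => forall_congr' fun h2 => ?_
    rw [h1]
  have hPinv : ∀ d, P (S.inv d) ↔ P d := by
    intro d
    rw [hP, hP]
    refine forall_congr' fun G => forall_congr' fun h1 => forall_congr' fun h2 => ?_
    rw [h2]
  have hPs : ¬ P s := fun hPs => hSc fun G h1 h2 => hglue G h1 h2 ((hP _).1 hPs G h1 h2)
  have hSroot : S.face N.root = s := by
    rw [hSf, mul_apply, ← hr', swap_apply_left]
  have hProot : ¬ P N.root := by
    rwa [← hPinv, ← hProt, ← face_apply, hSroot]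
  let M₁ : DartMap {d // P d} := S.restrict P hProt hPinv r' hPr
  let M₂ : DartMap {d // ¬ P d} := S.restrict (fun d => ¬ P d) (fun d => not_congr (hProt d))
    (fun d => not_congr (hPinv d)) N.root hProot
  have hiso : (M₁.join M₂).Iso N := by
    refine join_restrict_iso P hProt hPinv hPr hProot ?_ hSi.symm
    rw [hSroot]
    exact Equiv.ext hNS
  refine ⟨_, _, inferInstance, inferInstance, M₁, M₂, hiso.symm,
    isDisk_of_join_closable (hiso.symm.closable hN) ?_ ?_⟩
  · intro G h1 h2
    have key : ∀ d : {d // P d}, G ⟨r', hPr⟩ ↔ G d := by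
      intro d
      have := (hP _).1 d.2 (fun d => ∃ h : P d, G ⟨d, h⟩) (fun d => ?_) (fun d => ?_)
      · exact ⟨fun h => (this.1 ⟨hPr, h⟩).2, fun h => (this.2 ⟨d.2, h⟩).2⟩
      · constructor
        · rintro ⟨h, hG⟩
          exact ⟨(hProt d).1 h, (h1 ⟨d, _⟩).1 hG⟩
        · rintro ⟨h, hG⟩
          exact ⟨(hProt d).2 h, (h1 ⟨d, _⟩).2 hG⟩
      · constructor
        · rintro ⟨h, hG⟩
          exact ⟨(hPinv d).1 h, (h2 ⟨d, _⟩).1 hG⟩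
        · rintro ⟨h, hG⟩
          exact ⟨(hPinv d).2 h, (h2 ⟨d, _⟩).2 hG⟩
    intro d e hd
    exact (key e).1 ((key d).2 hd)
  · intro G h1 h2
    let H : D → Prop := fun d => if h : P d then G ⟨s, hPs⟩ else G ⟨d, h⟩
    have hH : ∀ d (h : ¬ P d), H d ↔ G ⟨d, h⟩ := fun d h => by simp only [H, dif_neg h]
    have hH' : ∀ d, P d → (H d ↔ G ⟨s, hPs⟩) := fun d h => by simp only [H, dif_pos h]
    have := hglue H (fun d => ?_) (fun d => ?_) ((hH' r' hPr).trans (hH s hPs).symm)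
    · intro d e hd
      exact (hH e e.2).1 (this d e ((hH d d.2).2 hd))
    · by_cases hd : P d
      · rw [hH' d hd, hH' _ ((hProt d).2 hd)]
      · rw [hH d hd, hH _ (fun h => hd ((hProt d).1 h))]
        exact h1 ⟨d, hd⟩
    · by_cases hd : P d
      · rw [hH' d hd, hH' _ ((hPinv d).2 hd)]
      · rw [hH d hd, hH _ (fun h => hd ((hPinv d).1 h))]
        exact h2 ⟨d, hd⟩

end DartMap

/-! ### The two operations on isomorphism classes -/

theorem Equiv.exists_sumCongr_eq {A B A' B' : Type*} (e : A ⊕ B ≃ A' ⊕ B')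
    (h₁ : ∀ a, ∃ a', e (.inl a) = .inl a') (h₂ : ∀ b, ∃ b', e (.inr b) = .inr b') :
    ∃ (f : A ≃ A') (g : B ≃ B'), (∀ a, e (.inl a) = .inl (f a)) ∧ ∀ b, e (.inr b) = .inr (g b) := by
  choose f hf using h₁
  choose g hg using h₂
  refine ⟨Equiv.ofBijective f ⟨fun a b h => ?_, fun a' => ?_⟩,
    Equiv.ofBijective g ⟨fun a b h => ?_, fun b' => ?_⟩, hf, hg⟩
  · exact Sum.inl_injective (e.injective (by rw [hf, hf, h]))
  · obtain ⟨x | x, hx⟩ := e.surjective (.inl a')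
    · exact ⟨x, Sum.inl_injective (by rw [← hf, hx])⟩
    · simp [hg] at hx
  · exact Sum.inr_injective (e.injective (by rw [hg, hg, h]))
  · obtain ⟨x | x, hx⟩ := e.surjective (.inr b')
    · simp [hf] at hx
    · exact ⟨x, Sum.inr_injective (by rw [← hg, hx])⟩

namespace DartMap

variable {D D' D₁ D₂ D₁' D₂' : Type}

theorem Iso.addEdge {M : DartMap D} {N : DartMap D'} (h : M.Iso N) : M.addEdge.Iso N.addEdge := by
  obtain ⟨e, h1, h2, h3⟩ := h
  have hf := face_intertwine h1 h2
  refine ⟨Equiv.sumCongr e (Equiv.refl Bool), fun x => ?_, ?_, rfl⟩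
  · simp only [DartMap.addEdge, mul_apply]
    rw [map_swap_apply, map_swap_apply]
    simp only [Equiv.sumCongr_apply, Sum.map_inl, Sum.map_inr, hf, h3, Equiv.refl_apply]
    rcases x with d | b
    · simp [h1]
    · simp
  · rintro (d | (_ | _))
    · simp [h2]
    · simp
    · simp

/-- An isomorphism preserves the root edge, hence it also preserves what remains after its removal.
-/
theorem Iso.of_addEdge {M : DartMap D} {N : DartMap D'} (hM : M.root ≠ M.face (M.face M.root))
    (hN : N.root ≠ N.face (N.face N.root)) (h : M.addEdge.Iso N.addEdge) : M.Iso N := by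
  obtain ⟨e, h1, h2, h3⟩ := h
  have ht : e (.inr true) = .inr true := h3
  have hf : e (.inr false) = .inr false := by
    rw [← addEdge_inv_true M, h2, ht, addEdge_inv_true]
  obtain ⟨f, g, hf', hg'⟩ := e.exists_sumCongr_eq (fun a => by
      rcases ha : e (.inl a) with x | (_ | _)
      · exact ⟨x, rfl⟩
      · simpa using e.injective (ha.trans hf.symm)
      · simpa using e.injective (ha.trans ht.symm)) (fun b => by
      rcases b with _ | _
      · exact ⟨_, hf⟩
      · exact ⟨_, ht⟩)
  have hroot : f M.root = N.root := by
    have := h1 (.inr true)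
    rw [addEdge_rot_true, hf', ht, addEdge_rot_true] at this
    exact Sum.inl_injective this
  have hroot' : f (M.face (M.face M.root)) = N.face (N.face N.root) := by
    have := h1 (.inr false)
    rw [addEdge_rot_false hM, hf', hf, addEdge_rot_false hN] at this
    exact Sum.inl_injective this
  refine ⟨f, fun d => ?_, fun d => ?_, hroot⟩
  · have := h1 (.inl d)
    rw [addEdge_rot_inl, hf', addEdge_rot_inl] at this
    split_ifs at this with c1 c2 c3 c4 c5 c6
    · rw [c1, hroot', c2]
    · simp [hf] at this
    · simp [hf] at this
    · simp [ht] at this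
    · rw [c4, hroot, c6]
    · simp [ht] at this
    · simp [hf'] at this
    · simp [hf'] at this
    · rw [hf'] at this
      exact Sum.inl_injective this
  · have := h2 (.inl d)
    rw [addEdge_inv_inl, hf', hf', addEdge_inv_inl] at this
    exact Sum.inl_injective this

theorem Iso.join {M₁ : DartMap D₁} {N₁ : DartMap D₁'} {M₂ : DartMap D₂} {N₂ : DartMap D₂'}
    (h : M₁.Iso N₁) (h' : M₂.Iso N₂) : (M₁.join M₂).Iso (N₁.join N₂) := by
  obtain ⟨e, h1, h2, h3⟩ := h
  obtain ⟨e', h1', h2', h3'⟩ := h'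
  refine ⟨Equiv.sumCongr e e', fun x => ?_, ?_, ?_⟩
  · rw [join_rot, join_rot, mul_apply, map_swap_apply]
    simp only [Equiv.sumCongr_apply, Sum.map_inl, Sum.map_inr, face_intertwine h1' h2', h3, h3',
      mul_apply]
    rcases x with d | d
    · simp [h1]
    · simp [h1']
  · rintro (d | d)
    · simp [h2]
    · simp [h2']
  · simp [h3']

/-- An isomorphism of joins preserves the vertex that occurs twice on the boundary, hence it also
preserves the two parts. -/
theorem Iso.of_join [Finite D₁] [Finite D₂] [Finite D₁'] [Finite D₂'] {M₁ : DartMap D₁}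
    {N₁ : DartMap D₁'} {M₂ : DartMap D₂} {N₂ : DartMap D₂'} (hM₁ : M₁.IsDisk) (hM₂ : M₂.IsDisk)
    (hN₁ : N₁.IsDisk) (hN₂ : N₂.IsDisk) (h : (M₁.join M₂).Iso (N₁.join N₂)) :
    M₁.Iso N₁ ∧ M₂.Iso N₂ := by
  have cM := hM₁.join_closable hM₂
  have cN := hN₁.join_closable hN₂
  obtain ⟨e, h1, h2, h3⟩ := h
  have hf := face_intertwine h1 h2
  have e1 : e (.inr M₂.root) = .inr N₂.root := h3
  have e2 : e (.inl M₁.root) = .inl N₁.root := by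
    rw [← join_face_root M₁ M₂, hf, e1, join_face_root]
  -- the other boundary dart at the vertex where the parts are joined
  have e3 : e (.inr (M₂.face M₂.root)) = .inr (N₂.face N₂.root) := by
    refine cN.outer_almost_cycle _ _ ?_ ?_ ?_ ?_ ?_
    · exact (isOuter_iff h1 h2 h3 _).1 (join_isOuter_inr.2 (M₂.isOuter_face.2 M₂.isOuter_root))
    · exact join_isOuter_inr.2 (N₂.isOuter_face.2 N₂.isOuter_root)
    · rw [join_root, join_face_root, ← e2]
      exact fun h => by simpa using e.injective h
    · rw [join_root, join_face_root]
      simp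
    · have : (M₁.join M₂).rot.SameCycle (.inl M₁.root) (.inr (M₂.face M₂.root)) :=
        join_sameVertex_inl_inr.2 ⟨SameCycle.refl _ _, SameCycle.refl _ _⟩
      have := (RootedMap.sameCycle_of_intertwine e _ _ h1 _ _).1 this
      rw [e2] at this
      exact this.symm.trans (join_sameVertex_inl_inr.2 ⟨SameCycle.refl _ _, SameCycle.refl _ _⟩)
  have hr : ∀ x, e (Perm.sumCongr M₁.rot M₂.rot x) = Perm.sumCongr N₁.rot N₂.rot (e x) := by
    intro x
    have := h1 x
    rw [join_rot, join_rot, mul_apply, mul_apply, map_swap_apply, e2, e3] at this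
    exact (swap _ _).injective this
  have hi : ∀ x, e (Perm.sumCongr M₁.inv M₂.inv x) = Perm.sumCongr N₁.inv N₂.inv (e x) := h2
  have hl : ∀ a, ∃ a', e (.inl a) = .inl a' := by
    intro a
    refine hM₁.connected (fun a => ∃ a', e (.inl a) = .inl a') (fun d => ?_) (fun d => ?_)
      M₁.root a ⟨_, e2⟩
    · have := hr (.inl d)
      rw [Perm.sumCongr_apply, Sum.map_inl] at this
      rw [this]
      rcases e (.inl d) with y | y <;> simp
    · have := hi (.inl d)
      rw [Perm.sumCongr_apply, Sum.map_inl] at this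
      rw [this]
      rcases e (.inl d) with y | y <;> simp
  have hl' : ∀ a, ∃ a', e (.inr a) = .inr a' := by
    intro a
    refine hM₂.connected (fun a => ∃ a', e (.inr a) = .inr a') (fun d => ?_) (fun d => ?_)
      M₂.root a ⟨_, e1⟩
    · have := hr (.inr d)
      rw [Perm.sumCongr_apply, Sum.map_inr] at this
      rw [this]
      rcases e (.inr d) with y | y <;> simp
    · have := hi (.inr d)
      rw [Perm.sumCongr_apply, Sum.map_inr] at this
      rw [this]
      rcases e (.inr d) with y | y <;> simp
  obtain ⟨f, g, hf, hg⟩ := e.exists_sumCongr_eq hl hl'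
  refine ⟨⟨f, fun d => ?_, fun d => ?_, ?_⟩, ⟨g, fun d => ?_, fun d => ?_, ?_⟩⟩
  · have := hr (.inl d)
    rw [hf, Perm.sumCongr_apply, Sum.map_inl, hf] at this
    exact Sum.inl_injective this
  · have := hi (.inl d)
    rw [hf, Perm.sumCongr_apply, Sum.map_inl, hf] at this
    exact Sum.inl_injective this
  · rw [hf] at e2
    exact Sum.inl_injective e2
  · have := hr (.inr d)
    rw [hg, Perm.sumCongr_apply, Sum.map_inr, hg] at this
    exact Sum.inr_injective this
  · have := hi (.inr d)
    rw [hg, Perm.sumCongr_apply, Sum.map_inr, hg] at this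
    exact Sum.inr_injective this
  · rw [hg] at e1
    exact Sum.inr_injective e1

/-! ### The boundary walk -/

theorem isOuter_face_pow (M : DartMap D) (k : ℕ) : M.IsOuter ((M.face ^ k) M.root) :=
  sameCycle_pow_right.2 (SameCycle.refl _ _)

section boundary

variable [Finite D] {M : DartMap D}

theorem outerLength_pos (M : DartMap D) : 0 < M.outerLength :=
  Nat.card_pos_iff.2 ⟨⟨⟨_, M.isOuter_root⟩⟩, inferInstance⟩

/-- A closed walk along the boundary passes all outer darts. -/
theorem outerLength_le_of_pow_eq {k : ℕ} (hk : 0 < k) (h : (M.face ^ k) M.root = M.root) :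
    M.outerLength ≤ k := by
  have hs : Function.Surjective (fun i : Fin k => (⟨(M.face ^ (i : ℕ)) M.root,
      M.isOuter_face_pow i⟩ : {d // M.IsOuter d})) := by
    rintro ⟨d, hd⟩
    obtain ⟨n, -, rfl⟩ := SameCycle.exists_pow_eq' hd
    refine ⟨⟨n % k, Nat.mod_lt _ hk⟩, Subtype.ext ?_⟩
    have h2 : ∀ m : ℕ, ((M.face ^ k) ^ m) M.root = M.root := by
      intro m
      induction m with
      | zero => rfl
      | succ m ih => rw [pow_succ, mul_apply, h, ih]
    change (M.face ^ (n % k)) M.root = (M.face ^ n) M.root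
    conv_rhs => rw [← Nat.mod_add_div n k, pow_add, mul_apply, pow_mul, h2]
  have := Nat.card_le_card_of_surjective _ hs
  rwa [Nat.card_fin] at this

theorem face_pow_ne {k l : ℕ} (h1 : k < l) (h2 : l < k + M.outerLength) :
    (M.face ^ k) M.root ≠ (M.face ^ l) M.root := by
  intro h
  have : (M.face ^ (l - k)) M.root = M.root := by
    apply (M.face ^ k).injective
    rw [← mul_apply, ← pow_add, h]
    congr 2
    omega
  have := outerLength_le_of_pow_eq (by omega) this
  omega

theorem face_pow_outerLength (M : DartMap D) : (M.face ^ M.outerLength) M.root = M.root := by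
  have hex : ∃ k, 0 < k ∧ (M.face ^ k) M.root = M.root :=
    ⟨orderOf M.face, orderOf_pos _, by rw [pow_orderOf_eq_one]; rfl⟩
  obtain ⟨h1, h2⟩ := Nat.find_spec hex
  have h3 : ∀ k, 0 < k → k < Nat.find hex → (M.face ^ k) M.root ≠ M.root :=
    fun k hk hlt h => Nat.find_min hex hlt ⟨hk, h⟩
  have h4 := outerLength_le_of_pow_eq h1 h2
  have h5 : Nat.find hex ≤ M.outerLength := by
    have hi : Function.Injective (fun i : Fin (Nat.find hex) =>
        (⟨(M.face ^ (i : ℕ)) M.root, M.isOuter_face_pow i⟩ : {d // M.IsOuter d})) := by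
      have key : ∀ i j : Fin (Nat.find hex), i < j →
          (M.face ^ (i : ℕ)) M.root ≠ (M.face ^ (j : ℕ)) M.root := by
        intro i j hij h
        refine h3 (j - i) (by have := Fin.lt_def.1 hij; omega) (by omega) ?_
        apply (M.face ^ (i : ℕ)).injective
        rw [← mul_apply, ← pow_add, h]
        congr 2
        have := Fin.lt_def.1 hij
        omega
      intro i j hij
      have hij' := congrArg Subtype.val hij
      rcases lt_trichotomy i j with h | h | h
      · exact (key i j h hij').elim
      · exact h
      · exact (key j i h hij'.symm).elim
    have := Nat.card_le_card_of_injective _ hi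
    rwa [Nat.card_fin] at this
  rw [le_antisymm h4 h5]
  exact h2

theorem IsDisk.not_sameVertex_face_pow (hM : M.IsDisk) {k l : ℕ} (h1 : k < l)
    (h2 : l < k + M.outerLength) :
    ¬ M.rot.SameCycle ((M.face ^ k) M.root) ((M.face ^ l) M.root) := fun h =>
  face_pow_ne h1 h2 (hM.outer_cycle _ _ (M.isOuter_face_pow k) (M.isOuter_face_pow l) h)

theorem IsDisk.two_le_outerLength (hM : M.IsDisk) : 2 ≤ M.outerLength := by
  by_contra h
  have h1 := M.outerLength_pos
  have h2 := M.face_pow_outerLength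
  rw [show M.outerLength = 1 by omega, pow_one] at h2
  exact hM.face_ne _ h2

theorem addEdge_face_pow (h : M.Closable) {k : ℕ} (h1 : 1 ≤ k) (h2 : k + 2 ≤ M.outerLength) :
    (M.addEdge.face ^ k) M.addEdge.root = .inl ((M.face ^ (k + 1)) M.root) := by
  induction k, h1 using Nat.le_induction with
  | base =>
    rw [pow_one, addEdge_root, addEdge_face_true h.root_ne]
    rfl
  | succ k hk ih =>
    rw [pow_succ', mul_apply, ih (by omega), addEdge_face_inl, if_neg, if_neg, pow_succ' _ (k + 1)]
    · rfl
    · rw [← mul_apply, ← pow_succ']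
      exact (face_pow_ne (k := 0) (by omega) (by omega)).symm
    · exact (face_pow_ne (k := 1) (by omega) (by omega)).symm

end boundary

theorem join_face_pow_left [Finite D₁] [Finite D₂] (M₁ : DartMap D₁) (M₂ : DartMap D₂) {k : ℕ}
    (h : k < M₁.outerLength) :
    ((M₁.join M₂).face ^ (k + 1)) (M₁.join M₂).root = .inl ((M₁.face ^ k) M₁.root) := by
  induction k with
  | zero => rw [zero_add, pow_one, join_root, join_face_root]; rfl
  | succ k ih =>
    rw [pow_succ', mul_apply, ih (by omega), join_face_inl, if_neg, pow_succ', mul_apply]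
    rw [← mul_apply, ← pow_succ']
    exact (face_pow_ne (k := 0) (by omega) (by omega)).symm

theorem join_face_pow_right [Finite D₁] [Finite D₂] (M₁ : DartMap D₁) (M₂ : DartMap D₂) {k : ℕ}
    (h1 : 1 ≤ k) (h2 : k ≤ M₂.outerLength) :
    ((M₁.join M₂).face ^ (M₁.outerLength + k)) (M₁.join M₂).root =
      .inr ((M₂.face ^ k) M₂.root) := by
  induction k, h1 using Nat.le_induction with
  | base =>
    have h0 := M₁.outerLength_pos
    have h3 := join_face_pow_left M₁ M₂ (k := M₁.outerLength - 1) (by omega)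
    rw [show M₁.outerLength - 1 + 1 = M₁.outerLength by omega] at h3
    rw [pow_succ', mul_apply, h3, join_face_inl, if_pos]
    · rfl
    · rw [← mul_apply, ← pow_succ', show M₁.outerLength - 1 + 1 = M₁.outerLength by omega,
        face_pow_outerLength]
  | succ k hk ih =>
    rw [← add_assoc, pow_succ', mul_apply, ih (by omega), join_face_inr, if_neg, pow_succ',
      mul_apply]
    exact (face_pow_ne (k := 0) (by omega) (by omega)).symm

end DartMap

/-! ### Composition of triangulations -/

namespace DartMap

variable {D D' D₁ D₂ D₁' D₂' : Type}

/-- The map `M` rooted at the dart that precedes the root on the boundary walk. -/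
def retreat (M : DartMap D) : DartMap D where
  rot := M.rot
  inv := M.inv
  root := M.face.symm M.root

/-- The map `M` rooted at the dart that follows the root on the boundary walk. -/
def advance (M : DartMap D) : DartMap D where
  rot := M.rot
  inv := M.inv
  root := M.face M.root

theorem retreat_isOuter {M : DartMap D} {d : D} : M.retreat.IsOuter d ↔ M.IsOuter d :=
  sameCycle_symm_apply_left

theorem advance_isOuter {M : DartMap D} {d : D} : M.advance.IsOuter d ↔ M.IsOuter d :=
  sameCycle_apply_left

theorem advance_retreat (M : DartMap D) : M.retreat.advance = M := by
  change DartMap.mk M.rot M.inv (M.face (M.face.symm M.root)) = M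
  rw [apply_symm_apply]

theorem retreat_advance (M : DartMap D) : M.advance.retreat = M := by
  change DartMap.mk M.rot M.inv (M.face.symm (M.face M.root)) = M
  rw [symm_apply_apply]

theorem IsDisk.retreat {M : DartMap D} (h : M.IsDisk) : M.retreat.IsDisk := by
  refine ⟨⟨h.inv_inv, h.inv_ne, h.connected, h.planar, h.no_loop, h.no_multiple_edge, ?_⟩, ?_⟩
  · exact fun d hd => h.bounded_triangle d fun h' => hd (retreat_isOuter.2 h')
  · exact fun d e hd he => h.outer_cycle d e (retreat_isOuter.1 hd) (retreat_isOuter.1 he)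

theorem IsDisk.advance {M : DartMap D} (h : M.IsDisk) : M.advance.IsDisk := by
  refine ⟨⟨h.inv_inv, h.inv_ne, h.connected, h.planar, h.no_loop, h.no_multiple_edge, ?_⟩, ?_⟩
  · exact fun d hd => h.bounded_triangle d fun h' => hd (advance_isOuter.2 h')
  · exact fun d e hd he => h.outer_cycle d e (advance_isOuter.1 hd) (advance_isOuter.1 he)

theorem retreat_outerLength (M : DartMap D) : M.retreat.outerLength = M.outerLength :=
  Nat.card_congr (Equiv.subtypeEquivRight fun _ => retreat_isOuter)

theorem advance_outerLength (M : DartMap D) : M.advance.outerLength = M.outerLength :=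
  Nat.card_congr (Equiv.subtypeEquivRight fun _ => advance_isOuter)

theorem Iso.retreat {M : DartMap D} {N : DartMap D'} (h : M.Iso N) : M.retreat.Iso N.retreat := by
  obtain ⟨e, h1, h2, h3⟩ := h
  refine ⟨e, h1, h2, ?_⟩
  have := face_intertwine h1 h2 (M.face.symm M.root)
  rw [apply_symm_apply, h3] at this
  exact (N.face.symm_apply_eq.2 this).symm

theorem Iso.advance {M : DartMap D} {N : DartMap D'} (h : M.Iso N) : M.advance.Iso N.advance := by
  obtain ⟨e, h1, h2, h3⟩ := h
  refine ⟨e, h1, h2, ?_⟩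
  have := face_intertwine h1 h2 M.root
  rwa [h3] at this

/-- The darts of a composition of two maps with `j + 1` additional edges. -/
def CompDart (D₁ D₂ : Type) : ℕ → Type
  | 0 => (D₁ ⊕ D₂) ⊕ Bool
  | j + 1 => CompDart D₁ D₂ j ⊕ Bool

instance finite_compDart [Finite D₁] [Finite D₂] (j : ℕ) : Finite (CompDart D₁ D₂ j) := by
  induction j with
  | zero => exact inferInstanceAs (Finite ((D₁ ⊕ D₂) ⊕ Bool))
  | succ j ih => exact inferInstanceAs (Finite (CompDart D₁ D₂ j ⊕ Bool))

/-- The composition of two rooted maps. Let the initial vertex of the root of `M₂` be `v`, let its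
terminal vertex be `w`, and let the boundary of `M₁`, starting at the terminal vertex of its root,
be `v₀, v₁, …, v_l`. The map `comp j M₁ M₂` is obtained by identifying `v_{l-j}` with `w` and
joining `v` to `v_{l-j+1}, …, v_l` and to `v₀`, in this order, by `j + 1` edges that close
triangles. The last of these edges is the new root edge, directed from `v` to `v₀`. Exactly the
first `M₁.outerLength - 1 - j` boundary edges of `M₁` after its root remain on the boundary. In the
recursion, moving the root of `M₁` back by one renumbers the vertices. -/
noncomputable def comp : (j : ℕ) → DartMap D₁ → DartMap D₂ → DartMap (CompDart D₁ D₂ j)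
  | 0, M₁, M₂ => (M₁.join M₂).addEdge
  | j + 1, M₁, M₂ => (comp j M₁.retreat M₂).addEdge

theorem Iso.comp {j : ℕ} {M₁ : DartMap D₁} {N₁ : DartMap D₁'} {M₂ : DartMap D₂} {N₂ : DartMap D₂'}
    (h : M₁.Iso N₁) (h' : M₂.Iso N₂) :
    (DartMap.comp j M₁ M₂).Iso (DartMap.comp j N₁ N₂) := by
  induction j generalizing M₁ N₁ with
  | zero => exact (h.join h').addEdge
  | succ j ih => exact (ih h.retreat).addEdge

/-- The properties of a composition that are needed to continue it: the initial vertex `v` of the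
root is adjacent to no boundary vertex strictly between the first one after the root and the vertex
where the two maps are joined, but it is adjacent to the latter. -/
structure CompSpec (j : ℕ) (M₁ : DartMap D₁) (M₂ : DartMap D₂) (M : DartMap D) : Prop where
  isDisk : M.IsDisk
  outerLength_eq : M.outerLength + j + 1 = M₁.outerLength + M₂.outerLength
  numCycles_rot_eq : M.rot.numCycles + 1 = M₁.rot.numCycles + M₂.rot.numCycles
  not_adj : ∀ m, 1 ≤ m → m + j + 1 < M₁.outerLength → ∀ d, M.rot.SameCycle M.root d →
    ¬ M.rot.SameCycle ((M.face ^ (m + 1)) M.root) (M.inv d)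
  adj : ∃ d, M.rot.SameCycle M.root d ∧
    M.rot.SameCycle ((M.face ^ (M₁.outerLength - j)) M.root) (M.inv d)

/-- A further edge may be added as long as a boundary edge of `M₁` after its root remains uncovered.
-/
theorem CompSpec.closable [Finite D] {j : ℕ} {M₁ : DartMap D₁} {M₂ : DartMap D₂} {M : DartMap D}
    (h : CompSpec j M₁ M₂ M) (hj : j + 3 ≤ M₁.outerLength) (h₂ : 2 ≤ M₂.outerLength) :
    M.Closable := by
  have h1 := h.outerLength_eq
  refine { h.isDisk.toIsTriangulated with
           not_sameVertex := ?_, not_adj := ?_, outer_almost_cycle := ?_ }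
  · exact h.isDisk.not_sameVertex_face_pow (k := 0) (l := 2) (by omega) (by omega)
  · exact h.not_adj 1 le_rfl (by omega)
  · exact fun d e hd he _ _ => h.isDisk.outer_cycle d e hd he

theorem compSpec_zero [Finite D₁] [Finite D₂] {M₁ : DartMap D₁} {M₂ : DartMap D₂}
    (h₁ : M₁.IsDisk) (h₂ : M₂.IsDisk) : CompSpec 0 M₁ M₂ (M₁.join M₂).addEdge := by
  have hc := h₁.join_closable h₂
  have l₁ := h₁.two_le_outerLength
  have l₂ := h₂.two_le_outerLength
  have hL := join_outerLength (M₁ := M₁) (M₂ := M₂)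
  have hv := addEdge_sameVertex hc.root_ne
  have hl₂ : ∀ d, ¬ M₂.rot.SameCycle (M₂.face d) d := fun d hd =>
    h₂.no_loop d ((M₂.sameVertex_face d).trans hd)
  have hap : ((M₁.join M₂).face ((M₁.join M₂).face (M₁.join M₂).root)) =
      .inl ((M₁.face ^ 1) M₁.root) := join_face_pow_left M₁ M₂ (k := 1) (by omega)
  refine ⟨hc.isDisk_addEdge, ?_, ?_, ?_, ?_⟩
  · have := addEdge_outerLength hc.root_ne (hc.face_ne _)
    omega
  · rw [addEdge_numCycles_rot hc.root_ne, join_numCycles_rot]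
  · intro m hm1 hm2 d hd hd'
    rw [addEdge_face_pow hc (by omega) (by omega), join_face_pow_left M₁ M₂ (by omega), hv] at hd'
    rw [addEdge_root, hv, base_true, join_root] at hd
    have hr : ¬ M₁.rot.SameCycle ((M₁.face ^ (m + 1)) M₁.root) M₁.root := fun h =>
      h₁.not_sameVertex_face_pow (k := 0) (l := m + 1) (by omega) (by omega) h.symm
    rcases d with (d | d) | (_ | _)
    · rw [base_inl, join_sameVertex_inr_inl] at hd
      exact hl₂ _ hd.2.symm
    · rw [addEdge_inv_inl, base_inl, join_inv_inr, base_inl, join_sameVertex_inl_inr] at hd'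
      exact hr hd'.1
    · rw [base_false, hap, join_sameVertex_inr_inl] at hd
      exact hl₂ _ hd.2.symm
    · rw [addEdge_inv_true, base_false, hap, base_inl, join_sameVertex_inl] at hd'
      exact h₁.not_sameVertex_face_pow (k := 1) (l := m + 1) (by omega) (by omega) hd'.symm
  · refine ⟨.inl (.inr M₂.root), ?_, ?_⟩
    · rw [addEdge_root, hv]
      exact SameCycle.refl _ _
    · rw [Nat.sub_zero, addEdge_face_pow hc (by omega) (by omega),
        join_face_pow_right M₁ M₂ le_rfl (by omega), hv, addEdge_inv_inl, base_inl, base_inl,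
        join_inv_inr, join_sameVertex_inr]
      exact (M₂.sameVertex_face _).symm

theorem CompSpec.succ [Finite D] {j : ℕ} {M₁ : DartMap D₁} {M₂ : DartMap D₂} {M : DartMap D}
    (h : CompSpec j M₁.retreat M₂ M) (hj : j + 3 ≤ M₁.outerLength) (h₂ : 2 ≤ M₂.outerLength) :
    CompSpec (j + 1) M₁ M₂ M.addEdge := by
  have hc := h.closable (by rwa [retreat_outerLength]) h₂
  have hL := h.outerLength_eq
  have hna := h.not_adj
  have ha := h.adj
  have hV := h.numCycles_rot_eq
  rw [retreat_outerLength] at hL hna ha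
  have hv := addEdge_sameVertex hc.root_ne
  refine ⟨hc.isDisk_addEdge, ?_, ?_, ?_, ?_⟩
  · have := addEdge_outerLength hc.root_ne (hc.face_ne _)
    omega
  · rw [addEdge_numCycles_rot hc.root_ne]
    exact hV
  · intro m hm1 hm2 d hd hd'
    rw [addEdge_face_pow hc (by omega) (by omega), hv, base_inl] at hd'
    rw [addEdge_root, hv, base_true] at hd
    rcases d with d | (_ | _)
    · exact hna (m + 1) (by omega) (by omega) d hd hd'
    · exact hc.not_sameVertex hd
    · rw [addEdge_inv_true, base_false] at hd'
      exact h.isDisk.not_sameVertex_face_pow (k := 2) (l := m + 1 + 1) (by omega) (by omega)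
        hd'.symm
  · obtain ⟨d, hd1, hd2⟩ := ha
    refine ⟨.inl d, ?_, ?_⟩
    · rwa [addEdge_root, hv]
    · rw [addEdge_face_pow hc (by omega) (by omega), hv, addEdge_inv_inl, base_inl, base_inl,
        show M₁.outerLength - (j + 1) + 1 = M₁.outerLength - j by omega]
      exact hd2

theorem compSpec [Finite D₁] [Finite D₂] {j : ℕ} {M₁ : DartMap D₁} {M₂ : DartMap D₂}
    (h₁ : M₁.IsDisk) (h₂ : M₂.IsDisk) (hj : j + 2 ≤ M₁.outerLength) :
    CompSpec j M₁ M₂ (comp j M₁ M₂) := by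
  induction j generalizing M₁ with
  | zero => exact compSpec_zero h₁ h₂
  | succ j ih =>
    exact (ih h₁.retreat (by rw [retreat_outerLength]; omega)).succ hj h₂.two_le_outerLength

/-- Every disk triangulation other than a single edge is a composition: edges at the initial vertex
of the root are removed until the map is no longer a disk triangulation, and then it is a join. -/
theorem IsDisk.exists_comp {D : Type} [Finite D] {M : DartMap D} (hM : M.IsDisk)
    (h : ¬ M.IsOuter (M.inv M.root)) :
    ∃ (D₁ D₂ : Type) (_ : Finite D₁) (_ : Finite D₂) (M₁ : DartMap D₁) (M₂ : DartMap D₂) (j : ℕ),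
      M₁.IsDisk ∧ M₂.IsDisk ∧ j + 2 ≤ M₁.outerLength ∧ M.Iso (comp j M₁ M₂) := by
  induction hn : Nat.card D using Nat.strong_induction_on generalizing D with
  | _ n ih =>
    subst hn
    obtain ⟨E, hE, N, hMN, hN⟩ := hM.exists_addEdge h
    by_cases hNd : N.IsDisk
    · have hcard : Nat.card E < Nat.card D := by
        obtain ⟨e, -⟩ := hMN
        rw [Nat.card_congr e, Nat.card_sum]
        simp
      have hNo : ¬ N.IsOuter (N.inv N.root) := by
        intro ho
        have := hNd.outer_cycle _ _ (N.isOuter_face.2 N.isOuter_root) ho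
          (N.sameVertex_face _).symm
        refine hN.not_sameVertex ?_
        have h2 := N.sameVertex_face (N.face N.root)
        rw [this, hN.inv_inv] at h2
        rwa [this]
      obtain ⟨D₁, D₂, i₁, i₂, M₁, M₂, j, h₁, h₂, hj, hiso⟩ := ih _ hcard hNd hNo rfl
      have hs := compSpec h₁ h₂ hj
      refine ⟨D₁, D₂, i₁, i₂, M₁.advance, M₂, j + 1, h₁.advance, h₂, ?_, hMN.trans ?_⟩
      · rw [advance_outerLength]
        by_contra hcon
        -- otherwise the removed edge would have joined `v` to a neighbor of `v`
        obtain ⟨d, hd1, hd2⟩ := hs.adj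
        rw [show M₁.outerLength - j = 2 by omega] at hd2
        exact (hiso.closable hN).not_adj d hd1 hd2
      · have : N.addEdge.Iso (comp j M₁.advance.retreat M₂).addEdge := by
          rw [retreat_advance]
          exact hiso.addEdge
        exact this
    · obtain ⟨D₁, D₂, i₁, i₂, M₁, M₂, hiso, h₁, h₂⟩ := hN.exists_join hNd
      exact ⟨D₁, D₂, i₁, i₂, M₁, M₂, 0, h₁, h₂, h₁.two_le_outerLength, hMN.trans hiso.addEdge⟩

theorem join_not_isDisk [Finite D₁] [Finite D₂] (M₁ : DartMap D₁) (M₂ : DartMap D₂) :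
    ¬ (M₁.join M₂).IsDisk := by
  intro h
  have := h.outer_cycle (.inl M₁.root) (.inr (M₂.face M₂.root))
    (join_isOuter_inl.2 M₁.isOuter_root) (join_isOuter_inr.2 (M₂.isOuter_face.2 M₂.isOuter_root))
    (join_sameVertex_inl_inr.2 ⟨SameCycle.refl _ _, SameCycle.refl _ _⟩)
  simp at this

/-- The parts of a composition are determined by it: the edges are removed one at a time, and the
number of edges is found since a join is not a disk triangulation, whereas the intermediate maps
are. -/
theorem comp_injective [Finite D₁] [Finite D₂] [Finite D₁'] [Finite D₂'] {M₁ : DartMap D₁}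
    {N₁ : DartMap D₁'} {M₂ : DartMap D₂} {N₂ : DartMap D₂'} {j j' : ℕ} (hM₁ : M₁.IsDisk)
    (hM₂ : M₂.IsDisk) (hN₁ : N₁.IsDisk) (hN₂ : N₂.IsDisk) (hj : j + 2 ≤ M₁.outerLength)
    (hj' : j' + 2 ≤ N₁.outerLength) (h : (comp j M₁ M₂).Iso (comp j' N₁ N₂)) :
    j = j' ∧ M₁.Iso N₁ ∧ M₂.Iso N₂ := by
  have e₁ := hM₂.two_le_outerLength
  have e₂ := hN₂.two_le_outerLength
  induction j generalizing M₁ N₁ j' with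
  | zero =>
    cases j' with
    | zero =>
      exact ⟨rfl, Iso.of_join hM₁ hM₂ hN₁ hN₂ (Iso.of_addEdge (hM₁.join_closable hM₂).root_ne
        (hN₁.join_closable hN₂).root_ne h)⟩
    | succ j' =>
      have hs := compSpec (j := j') hN₁.retreat hN₂ (by rw [retreat_outerLength]; omega)
      have hc := hs.closable (by rwa [retreat_outerLength]) e₂
      have := Iso.of_addEdge (hM₁.join_closable hM₂).root_ne hc.root_ne h
      exact (join_not_isDisk M₁ M₂ (this.symm.isDisk hs.isDisk)).elim
  | succ j ih =>
    have hs := compSpec (j := j) hM₁.retreat hM₂ (by rw [retreat_outerLength]; omega)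
    have hc := hs.closable (by rwa [retreat_outerLength]) e₁
    cases j' with
    | zero =>
      have := Iso.of_addEdge hc.root_ne (hN₁.join_closable hN₂).root_ne h
      exact (join_not_isDisk N₁ N₂ (this.isDisk hs.isDisk)).elim
    | succ j' =>
      have hs' := compSpec (j := j') hN₁.retreat hN₂ (by rw [retreat_outerLength]; omega)
      have hc' := hs'.closable (by rwa [retreat_outerLength]) e₂
      obtain ⟨a1, a2, a3⟩ := ih hM₁.retreat hN₁.retreat (by rw [retreat_outerLength]; omega)
        (by rw [retreat_outerLength]; omega) (Iso.of_addEdge hc.root_ne hc'.root_ne h)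
      refine ⟨by omega, ?_, a3⟩
      have := a2.advance
      rwa [advance_retreat, advance_retreat] at this

end DartMap

/-! ### The decomposition of a composition of triangulations -/

/-- The permutation `σ` is the first return map of `τ` to the range of `f`. -/
def IsReturn {D E : Type*} (τ : Perm D) (f : E → D) (σ : Perm E) : Prop :=
  ∀ d, ∃ m : ℕ, 1 ≤ m ∧ f (σ d) = (τ ^ m) (f d) ∧
    ∀ m', 1 ≤ m' → m' < m → (τ ^ m') (f d) ∉ Set.range f

theorem IsReturn.comp {D E F : Type*} {τ : Perm D} {g : E → D} {σ : Perm E} {f : F → E}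
    {ρ : Perm F} (h : IsReturn τ g σ) (hg : Function.Injective g) (h' : IsReturn σ f ρ) :
    IsReturn τ (g ∘ f) ρ := by
  have key : ∀ (m : ℕ) (x : E), 1 ≤ m → ∃ n : ℕ, 1 ≤ n ∧ g ((σ ^ m) x) = (τ ^ n) (g x) ∧
      ∀ n', 1 ≤ n' → n' < n → ∀ y, (τ ^ n') (g x) = g y → ∃ m', 1 ≤ m' ∧ m' < m ∧
        y = (σ ^ m') x := by
    intro m x hm
    induction m, hm using Nat.le_induction with
    | base =>
      obtain ⟨n, h1, h2, h3⟩ := h x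
      exact ⟨n, h1, by simpa using h2, fun n' h4 h5 y hy => (h3 n' h4 h5 ⟨y, hy.symm⟩).elim⟩
    | succ m hm ih =>
      obtain ⟨n, h1, h2, h3⟩ := ih
      obtain ⟨p, h4, h5, h6⟩ := h ((σ ^ m) x)
      refine ⟨p + n, by omega, ?_, ?_⟩
      · rw [pow_succ', mul_apply, h5, h2, pow_add, mul_apply]
      · intro n' h7 h8 y hy
        rcases lt_trichotomy n' n with h9 | rfl | h9
        · obtain ⟨m', q1, q2, q3⟩ := h3 n' h7 h9 y hy
          exact ⟨m', q1, by omega, q3⟩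
        · exact ⟨m, hm, by omega, hg (by rw [← hy, h2])⟩
        · obtain ⟨q, rfl⟩ := Nat.exists_eq_add_of_lt h9
          refine (h6 (q + 1) (by omega) (by omega) ⟨y, ?_⟩).elim
          rw [← hy, h2, ← mul_apply, ← pow_add]
          congr 2
          omega
  intro d
  obtain ⟨m, h1, h2, h3⟩ := h' d
  obtain ⟨n, q1, q2, q3⟩ := key m (f d) h1
  refine ⟨n, q1, by rw [Function.comp_apply, h2, q2]; rfl, ?_⟩
  rintro n' h4 h5 ⟨y, hy⟩
  obtain ⟨m', h6, h7, h8⟩ := q3 n' h4 h5 (f y) hy.symm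
  exact h3 m' h6 h7 ⟨y, h8⟩

/-- A criterion for first return maps to a set that the permutation leaves and enters at only one
place. -/
theorem isReturn_of_unique_exit {D E : Type*} [Finite D] {τ : Perm D} {f : E → D} {σ : Perm E}
    (e : E) (h1 : ∀ d y, τ (f d) = f y → y = σ d) (h2 : ∀ d, τ (f d) ∉ Set.range f → σ d = e)
    (h3 : ∀ z y, z ∉ Set.range f → τ z = f y → y = e) : IsReturn τ f σ := by
  intro d
  have hex : ∃ m, 1 ≤ m ∧ (τ ^ m) (f d) ∈ Set.range f :=
    ⟨orderOf τ, orderOf_pos τ, by rw [pow_orderOf_eq_one]; exact ⟨d, rfl⟩⟩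
  obtain ⟨hm, y, hy⟩ := Nat.find_spec hex
  have hmin : ∀ m', 1 ≤ m' → m' < Nat.find hex → (τ ^ m') (f d) ∉ Set.range f :=
    fun m' q1 q2 q3 => Nat.find_min hex q2 ⟨q1, q3⟩
  refine ⟨Nat.find hex, hm, ?_, hmin⟩
  rw [← hy]
  congr 1
  symm
  generalize Nat.find hex = m at hm hy hmin
  obtain ⟨m, rfl⟩ := Nat.exists_eq_add_of_le' hm
  rcases Nat.eq_zero_or_pos m with rfl | hm0
  · exact h1 d y (by simpa using hy.symm)
  · rw [h2 d (by simpa using hmin 1 le_rfl (by omega))]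
    exact h3 ((τ ^ m) (f d)) y (hmin m hm0 (by omega)) (by rw [hy, pow_succ', mul_apply])

namespace DartMap

variable {D D' D₁ D₂ : Type}

theorem isReturn_addEdge [Finite D] {M : DartMap D} (h : M.root ≠ M.face (M.face M.root)) :
    IsReturn M.addEdge.rot (Sum.inl : D → D ⊕ Bool) M.rot := by
  intro d
  by_cases h1 : M.rot d = M.face (M.face M.root)
  · have h2 : M.addEdge.rot (.inl d) = .inr false := by rw [addEdge_rot_inl, if_pos h1]
    refine ⟨2, by omega, ?_, fun m' q1 q2 => ?_⟩
    · rw [pow_two, mul_apply, h2, addEdge_rot_false h, h1]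
    · obtain rfl : m' = 1 := by omega
      rw [pow_one, h2]
      simp
  by_cases h1' : M.rot d = M.root
  · have h2 : M.addEdge.rot (.inl d) = .inr true := by
      rw [addEdge_rot_inl, if_neg h1, if_pos h1']
    refine ⟨2, by omega, ?_, fun m' q1 q2 => ?_⟩
    · rw [pow_two, mul_apply, h2, addEdge_rot_true, h1']
    · obtain rfl : m' = 1 := by omega
      rw [pow_one, h2]
      simp
  · exact ⟨1, le_rfl, by rw [pow_one, addEdge_rot_inl, if_neg h1, if_neg h1'], by omega⟩

theorem isReturn_join_inl [Finite D₁] [Finite D₂] (M₁ : DartMap D₁) (M₂ : DartMap D₂) :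
    IsReturn (M₁.join M₂).rot (Sum.inl : D₁ → D₁ ⊕ D₂) M₁.rot := by
  refine isReturn_of_unique_exit M₁.root (fun d y => ?_) (fun d => ?_) fun z y hz => ?_
  · rw [join_rot_inl]
    split_ifs
    · simp
    · simpa using Eq.symm
  · rw [join_rot_inl]
    split_ifs with h
    · exact fun _ => h
    · simp
  · rcases z with z | z
    · simp at hz
    · rw [join_rot_inr]
      split_ifs
      · simpa using Eq.symm
      · simp

theorem isReturn_join_inr [Finite D₁] [Finite D₂] (M₁ : DartMap D₁) (M₂ : DartMap D₂) :
    IsReturn (M₁.join M₂).rot (Sum.inr : D₂ → D₁ ⊕ D₂) M₂.rot := by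
  refine isReturn_of_unique_exit (M₂.face M₂.root) (fun d y => ?_) (fun d => ?_) fun z y hz => ?_
  · rw [join_rot_inr]
    split_ifs
    · simp
    · simpa using Eq.symm
  · rw [join_rot_inr]
    split_ifs with h
    · exact fun _ => h
    · simp
  · rcases z with z | z
    · rw [join_rot_inl]
      split_ifs
      · simpa using Eq.symm
      · simp
    · simp at hz

/-- The decomposition of a disk triangulation at the initial vertex of its root, for maps on
arbitrary types of darts; see `RootedMap.IsDecomposition`. -/
def IsDecomposition (M : DartMap D) {k : ℕ} {E : Fin k → Type} (Ms : ∀ l, DartMap (E l))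
    (is : Fin k → ℕ) : Prop :=
  ∃ f : ∀ l, E l → D,
    (∀ l, Function.Injective (f l)) ∧
    (∀ d, ¬ M.rot.SameCycle M.root d → ¬ M.rot.SameCycle M.root (M.inv d) →
      ∃! l, d ∈ Set.range (f l)) ∧
    (∀ l d, ¬ M.rot.SameCycle M.root (f l d)) ∧
    (∀ l d, f l ((Ms l).inv d) = M.inv (f l d)) ∧
    (∀ l, IsReturn M.rot (f l) (Ms l).rot) ∧
    (∀ l, 1 ≤ is l) ∧ (∑ l, is l) + 2 = M.outerLength ∧
    ∀ l j, 1 ≤ j → j ≤ is l →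
      f l (((Ms l).face ^ j) (Ms l).root) =
        (M.face ^ ((∑ l' ∈ Finset.univ.filter (· < l), is l') + j)) M.root

theorem Iso.isDecomposition {M : DartMap D} {N : DartMap D'} (h : M.Iso N) {k : ℕ}
    {E : Fin k → Type} {Ms : ∀ l, DartMap (E l)} {is : Fin k → ℕ}
    (hM : M.IsDecomposition Ms is) : N.IsDecomposition Ms is := by
  have hL := h.outerLength_eq
  obtain ⟨e, h1, h2, h3⟩ := h
  have hv := fun x y => RootedMap.sameCycle_of_intertwine e M.rot N.rot h1 x y
  have pow : ∀ (σ : Perm D) (τ : Perm D'), (∀ d, e (σ d) = τ (e d)) → ∀ (m : ℕ) d,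
      e ((σ ^ m) d) = (τ ^ m) (e d) := by
    intro σ τ hst m
    induction m with
    | zero => exact fun d => rfl
    | succ m ih => intro d; rw [pow_succ, pow_succ, mul_apply, mul_apply, ih, hst]
  obtain ⟨f, f1, f2, f3, f4, f5, f6, f7, f8⟩ := hM
  refine ⟨fun l => e ∘ f l, fun l => e.injective.comp (f1 l), ?_, ?_, ?_, ?_, f6, by rw [f7, hL],
    ?_⟩
  · intro d q1 q2
    obtain ⟨d, rfl⟩ := e.surjective d
    rw [← h3, ← hv] at q1
    rw [← h3, ← h2, ← hv] at q2
    simpa [Set.mem_range] using f2 d q1 q2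
  · intro l d
    rw [← h3]
    exact fun h => f3 l d ((hv _ _).2 h)
  · intro l d
    exact (congrArg e (f4 l d)).trans (h2 _)
  · intro l d
    obtain ⟨m, q1, q2, q3⟩ := f5 l d
    refine ⟨m, q1, (congrArg e q2).trans (pow _ _ h1 _ _), fun m' q4 q5 q6 => ?_⟩
    apply q3 m' q4 q5
    obtain ⟨y, hy⟩ := q6
    exact ⟨y, e.injective (hy.trans (pow _ _ h1 _ _).symm)⟩
  · intro l j q1 q2
    rw [← h3, ← pow _ _ (face_intertwine h1 h2)]
    exact congrArg e (f8 l j q1 q2)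

theorem sum_filter_lt_zero {k : ℕ} (is : Fin (k + 1) → ℕ) :
    ∑ l' ∈ Finset.univ.filter (· < (0 : Fin (k + 1))), is l' = 0 := by
  rw [Finset.filter_eq_empty_iff.2 fun x _ => not_lt_of_ge (Fin.zero_le x), Finset.sum_empty]

theorem sum_filter_lt_succ {k : ℕ} (is : Fin (k + 1) → ℕ) (l : Fin k) :
    ∑ l' ∈ Finset.univ.filter (· < l.succ), is l' =
      is 0 + ∑ l' ∈ Finset.univ.filter (· < l), is l'.succ := by
  rw [Finset.sum_filter, Finset.sum_filter, Fin.sum_univ_succ, if_pos (Fin.succ_pos l)]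
  simp

theorem sum_filter_lt_add_le {k : ℕ} (is : Fin k → ℕ) (l : Fin k) :
    ∑ l' ∈ Finset.univ.filter (· < l), is l' + is l ≤ ∑ l, is l := by
  rw [add_comm, ← Finset.sum_insert (a := l) (by simp)]
  exact Finset.sum_le_sum_of_subset (Finset.subset_univ _)

/-- The case of a single additional edge.  The part `Ms 0` is disjoint from the vertex at which the
decomposition takes place, and the boundary walk passes it first. -/
theorem isDecomposition_comp_zero [Finite D₂] {k : ℕ} {E : Fin (k + 1) → Type} [∀ l, Finite (E l)]
    {Ms : ∀ l, DartMap (E l)} {is : Fin (k + 1) → ℕ} {M₂ : DartMap D₂} (h₁ : (Ms 0).IsDisk)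
    (h₂ : M₂.IsDisk) (hi : is 0 + 1 = (Ms 0).outerLength)
    (h : M₂.IsDecomposition (fun l => Ms l.succ) fun l => is l.succ) :
    ((Ms 0).join M₂).addEdge.IsDecomposition Ms is := by
  obtain ⟨f, f1, f2, f3, f4, f5, f6, f7, f8⟩ := h
  have hc := h₁.join_closable h₂
  have l₁ := h₁.two_le_outerLength
  have l₂ := h₂.two_le_outerLength
  have hL := join_outerLength (M₁ := Ms 0) (M₂ := M₂)
  have hL' := addEdge_outerLength hc.root_ne (hc.face_ne _)
  have hv := addEdge_sameVertex hc.root_ne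
  have hl₂ : ¬ M₂.rot.SameCycle M₂.root (M₂.face M₂.root) := fun hd =>
    h₂.no_loop _ ((M₂.sameVertex_face _).trans hd.symm)
  have r0 : ∀ d, ¬ ((Ms 0).join M₂).addEdge.rot.SameCycle (.inr true) (.inl (.inl d)) := by
    intro d
    rw [hv, base_true, base_inl, join_root, join_sameVertex_inr_inl]
    exact fun h => hl₂ (by tauto)
  have r1 : ∀ d, ((Ms 0).join M₂).addEdge.rot.SameCycle (.inr true) (.inl (.inr d)) ↔
      M₂.rot.SameCycle M₂.root d := by
    intro d
    rw [hv, base_true, base_inl, join_root, join_sameVertex_inr]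
  have hret := isReturn_addEdge hc.root_ne
  have hinl : Function.Injective (Sum.inl : E 0 ⊕ D₂ → _ ⊕ Bool) := Sum.inl_injective
  have f7' : ∑ l : Fin k, is l.succ + 2 = _ := f7
  refine ⟨Fin.cases (fun d => .inl (.inl d)) fun l d => .inl (.inr (f l d)), ?_, ?_, ?_, ?_, ?_,
    ?_, ?_, ?_⟩
  · refine Fin.cases ?_ fun l => ?_
    · exact Sum.inl_injective.comp Sum.inl_injective
    · exact Sum.inl_injective.comp (Sum.inr_injective.comp (f1 l))
  · rintro ((d | d) | (_ | _)) q1 q2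
    · refine ⟨0, ⟨d, rfl⟩, Fin.cases (fun _ => rfl) fun l => ?_⟩
      rintro ⟨y, hy⟩
      simp at hy
    · rw [addEdge_root, r1] at q1
      rw [addEdge_root, addEdge_inv_inl, join_inv_inr, r1] at q2
      obtain ⟨l, ⟨y, hy⟩, hl⟩ := f2 d q1 q2
      refine ⟨l.succ, ⟨y, congrArg (fun d => Sum.inl (Sum.inr d)) hy⟩, Fin.cases ?_ fun l' => ?_⟩
      · rintro ⟨y, hy⟩
        simp at hy
      · rintro ⟨y', hy'⟩
        rw [hl l' ⟨y', by simpa using hy'⟩]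
    · rw [addEdge_inv_false] at q2
      exact (q2 (SameCycle.refl _ _)).elim
    · exact (q1 (SameCycle.refl _ _)).elim
  · refine Fin.cases (fun d => r0 d) fun l d => ?_
    rw [addEdge_root]
    exact fun h => f3 l d ((r1 _).1 h)
  · refine Fin.cases (fun d => rfl) fun l d => ?_
    exact congrArg (fun d => Sum.inl (Sum.inr d)) (f4 l d)
  · refine Fin.cases ?_ fun l => ?_
    · exact hret.comp hinl (isReturn_join_inl _ _)
    · exact hret.comp hinl ((isReturn_join_inr _ _).comp Sum.inr_injective (f5 l))
  · exact Fin.cases (by omega) f6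
  · rw [Fin.sum_univ_succ]
    omega
  · refine Fin.cases (fun j q1 q2 => ?_) fun l j q1 q2 => ?_
    · rw [sum_filter_lt_zero, zero_add, addEdge_face_pow hc q1 (by omega),
        join_face_pow_left _ _ (by omega)]
      rfl
    · have := sum_filter_lt_add_le (fun l : Fin k => is l.succ) l
      rw [sum_filter_lt_succ, addEdge_face_pow hc (by omega) (by omega),
        show is 0 + ∑ l' ∈ Finset.univ.filter (· < l), is l'.succ + j + 1 =
          (Ms 0).outerLength + (∑ l' ∈ Finset.univ.filter (· < l), is l'.succ + j) by omega,
        join_face_pow_right _ _ (by omega) (by omega), ← f8 l j q1 q2]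
      rfl

/-- A further edge from the vertex at which the map is decomposed changes the first part only by its
root, and it hides one boundary edge of the first part. -/
theorem IsDecomposition.addEdge [Finite D] {k : ℕ} {E : Fin (k + 1) → Type}
    {Ms : ∀ l, DartMap (E l)} {is : Fin (k + 1) → ℕ} {M : DartMap D} (hc : M.Closable)
    (h0 : 1 ≤ is 0)
    (h : M.IsDecomposition (Fin.cons (α := fun l => DartMap (E l)) (Ms 0).retreat
      fun l => Ms l.succ) (Fin.cons (α := fun _ => ℕ) (is 0 + 1) fun l => is l.succ)) :
    M.addEdge.IsDecomposition Ms is := by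
  obtain ⟨f, f1, f2, f3, f4, f5, f6, f7, f8⟩ := h
  have hL' := addEdge_outerLength hc.root_ne (hc.face_ne _)
  have hv := addEdge_sameVertex hc.root_ne
  have hinl : Function.Injective (Sum.inl : D → _ ⊕ Bool) := Sum.inl_injective
  rw [Fin.sum_univ_succ, Fin.cons_zero] at f7
  simp only [Fin.cons_succ] at f7
  refine ⟨fun l => Sum.inl ∘ f l, fun l => hinl.comp (f1 l), ?_, ?_, ?_, ?_, ?_, ?_, ?_⟩
  · rintro (d | (_ | _)) q1 q2
    · rw [addEdge_root, hv] at q1 q2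
      simpa [Set.mem_range] using f2 d q1 q2
    · rw [addEdge_inv_false] at q2
      exact (q2 (SameCycle.refl _ _)).elim
    · exact (q1 (SameCycle.refl _ _)).elim
  · intro l d
    rw [addEdge_root, hv]
    exact f3 l d
  · refine Fin.cases (fun d => ?_) fun l d => ?_
    · exact congrArg Sum.inl (f4 0 d)
    · exact congrArg Sum.inl (f4 l.succ d)
  · refine Fin.cases ?_ fun l => ?_
    · exact (isReturn_addEdge hc.root_ne).comp hinl (f5 0)
    · exact (isReturn_addEdge hc.root_ne).comp hinl (f5 l.succ)
  · exact Fin.cases h0 fun l => f6 l.succ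
  · rw [Fin.sum_univ_succ]
    omega
  · refine Fin.cases (fun j q1 q2 => ?_) fun l j q1 q2 => ?_
    · rw [sum_filter_lt_zero, zero_add, addEdge_face_pow hc q1 (by omega)]
      have := f8 0 (j + 1) (by omega) (by rw [Fin.cons_zero]; omega)
      rw [sum_filter_lt_zero, zero_add] at this
      rw [← this]
      have e : ((Ms 0).face ^ (j + 1)) ((Ms 0).face.symm (Ms 0).root) =
          ((Ms 0).face ^ j) (Ms 0).root := by
        rw [pow_succ, mul_apply, apply_symm_apply]
      exact congrArg (Sum.inl ∘ f 0) e.symm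
    · have := f8 l.succ j q1 q2
      have h9 := sum_filter_lt_add_le (fun l : Fin k => is l.succ) l
      rw [sum_filter_lt_succ, Fin.cons_zero] at this
      simp only [Fin.cons_succ] at this
      rw [sum_filter_lt_succ, addEdge_face_pow hc (by omega) (by omega)]
      refine (congrArg Sum.inl this).trans ?_
      congr 3
      ring

/-- The decomposition of a composition of two triangulations consists of the first one and the
decomposition of the second one. -/
theorem isDecomposition_comp [Finite D₂] {k : ℕ} {E : Fin (k + 1) → Type} [∀ l, Finite (E l)]
    {Ms : ∀ l, DartMap (E l)} {is : Fin (k + 1) → ℕ} {M₂ : DartMap D₂} {j : ℕ}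
    (h₁ : (Ms 0).IsDisk) (h₂ : M₂.IsDisk) (hi : is 0 + j + 1 = (Ms 0).outerLength)
    (h0 : 1 ≤ is 0) (h : M₂.IsDecomposition (fun l => Ms l.succ) fun l => is l.succ) :
    (comp j (Ms 0) M₂).IsDecomposition Ms is := by
  induction j generalizing Ms is with
  | zero => exact isDecomposition_comp_zero h₁ h₂ hi h
  | succ j ih =>
    have hs := compSpec (j := j) h₁.retreat h₂ (by rw [retreat_outerLength]; omega)
    have hc := hs.closable (by rw [retreat_outerLength]; omega) h₂.two_le_outerLength
    refine IsDecomposition.addEdge hc h0 ?_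
    exact ih (Ms := Fin.cons (α := fun l => DartMap (E l)) (Ms 0).retreat fun l => Ms l.succ)
      (is := Fin.cons (α := fun _ => ℕ) (is 0 + 1) fun l => is l.succ) h₁.retreat
      (by rw [Fin.cons_zero, Fin.cons_zero, retreat_outerLength]; omega) (by simp) h

end DartMap

/-! ### The composition system of rooted triangulations -/

namespace RootedMap

/-- The combinatorial map of a rooted map. -/
def toDartMap (M : RootedMap) : DartMap (Fin M.card) where
  rot := M.rot
  inv := M.inv
  root := M.root

variable {M : RootedMap}

theorem vertex_eq_iff {d e : Fin M.card} : M.vertex d = M.vertex e ↔ M.rot.SameCycle d e :=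
  Quotient.eq (r := SameCycle.setoid M.rot)

theorem connected_toDartMap :
    M.toDartMap.Connected ↔ ∀ d d', ∃ g ∈ Subgroup.closure {M.rot, M.inv}, g d = d' := by
  constructor
  · intro h d d'
    have key : ∀ g ∈ Subgroup.closure {M.rot, M.inv}, ∀ x,
        (∃ a ∈ Subgroup.closure {M.rot, M.inv}, a d = g x) ↔
          ∃ a ∈ Subgroup.closure {M.rot, M.inv}, a d = x := by
      intro g hg x
      constructor
      · rintro ⟨a, ha, hx⟩
        exact ⟨g⁻¹ * a, mul_mem (inv_mem hg) ha, by simp [mul_apply, hx]⟩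
      · rintro ⟨a, ha, hx⟩
        exact ⟨g * a, mul_mem hg ha, by rw [mul_apply, hx]⟩
    exact h (fun x => ∃ a ∈ Subgroup.closure {M.rot, M.inv}, a d = x)
      (key M.rot (Subgroup.subset_closure (by simp)))
      (key M.inv (Subgroup.subset_closure (by simp))) d d' ⟨1, one_mem _, rfl⟩
  · intro h G h1 h2 d d' hd
    obtain ⟨g, hg, rfl⟩ := h d d'
    suffices ∀ x, G (g x) ↔ G x from (this d).2 hd
    induction hg using Subgroup.closure_induction with
    | mem g hg =>
      rcases hg with rfl | rfl
      · exact h1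
      · exact h2
    | one => exact fun x => Iff.rfl
    | mul a b _ _ ha hb => exact fun x => (ha _).trans (hb x)
    | inv a _ ha => exact fun x => by rw [← ha (a⁻¹ x)]; simp

end RootedMap

namespace DartMap

/-- A face without fixed point has three darts if and only if its third power fixes one. -/
theorem card_face_eq_three_iff {D : Type} [Finite D] (M : DartMap D) {d : D} (hd : M.face d ≠ d) :
    Nat.card {d' // M.face.SameCycle d d'} = 3 ↔ M.face (M.face (M.face d)) = d := by
  obtain ⟨N, rfl, hN⟩ : ∃ N : DartMap D, N.root = d ∧ N.face = M.face :=
    ⟨⟨M.rot, M.inv, d⟩, rfl, rfl⟩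
  rw [← hN] at hd ⊢
  change N.outerLength = 3 ↔ _
  have h1 := N.face_pow_outerLength
  constructor
  · intro h
    rwa [h] at h1
  · intro h
    have h2 := N.outerLength_le_of_pow_eq (k := 3) (by omega) h
    have h3 := N.outerLength_pos
    interval_cases h4 : N.outerLength
    · exact (hd h1).elim
    · have h5 : N.face (N.face N.root) = N.root := h1
      rw [h5] at h
      exact (hd h).elim
    · rfl

end DartMap

namespace RootedMap

variable {M : RootedMap}

/-- The two encodings of disk triangulations agree: edges are pairs of darts, so that Euler's
formula needs no count of edges. -/
theorem isDisk_toDartMap : M.toDartMap.IsDisk ↔ M.IsDiskTriangulation := by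
  have hE : (∀ d, M.inv (M.inv d) = d) → (∀ d, M.inv d ≠ d) →
      (2 * (M.rot.numCycles + M.face.numCycles) = Nat.card (Fin M.card) + 4 ↔
        Nat.card M.Vertex + Nat.card M.Face = Nat.card M.Edge + 2) := by
    intro h1 h2
    have := two_mul_numCycles_involutive h1 h2
    change _ ↔ M.rot.numCycles + M.face.numCycles = M.inv.numCycles + 2
    omega
  constructor
  · intro h
    refine ⟨h.inv_inv, h.inv_ne, connected_toDartMap.1 h.connected,
      (hE h.inv_inv h.inv_ne).1 h.planar, fun d hd => h.no_loop d (vertex_eq_iff.1 hd),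
      fun d e h1 h2 => h.no_multiple_edge d e (vertex_eq_iff.1 h1) (vertex_eq_iff.1 h2),
      fun d e h1 h2 h3 => h.outer_cycle d e h1 h2 (vertex_eq_iff.1 h3), fun d hd => ?_⟩
    exact (M.toDartMap.card_face_eq_three_iff (h.face_ne d)).2 (h.bounded_triangle d hd)
  · intro h
    have hl : ∀ d, ¬ M.rot.SameCycle (M.inv d) d := fun d hd => h.no_loop d (vertex_eq_iff.2 hd)
    refine ⟨⟨h.inv_inv, h.inv_ne, connected_toDartMap.2 h.connected,
      (hE h.inv_inv h.inv_ne).2 h.planar, hl,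
      fun d e h1 h2 => h.no_multiple_edge d e (vertex_eq_iff.2 h1) (vertex_eq_iff.2 h2),
      fun d hd => ?_⟩, fun d e h1 h2 h3 => h.outer_cycle d e h1 h2 (vertex_eq_iff.2 h3)⟩
    refine (M.toDartMap.card_face_eq_three_iff fun hd => hl d ?_).1 (h.bounded_triangle d hd)
    have := sameCycle_apply M.rot (M.inv d)
    rwa [show M.rot (M.inv d) = d from hd] at this

theorem IsDiskTriangulation.numExterior_eq (h : M.IsDiskTriangulation) :
    M.numExterior = M.toDartMap.outerLength := by
  symm
  refine Nat.card_congr (Equiv.ofBijective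
    (fun d => ⟨M.vertex d.1, d.1, d.2, rfl⟩ : {d // M.IsOuter d} → {v // M.IsExterior v}) ⟨?_, ?_⟩)
  · rintro ⟨d, hd⟩ ⟨e, he⟩ hde
    exact Subtype.ext (h.outer_cycle d e hd he (congrArg Subtype.val hde))
  · rintro ⟨v, d, hd, rfl⟩
    exact ⟨⟨d, hd⟩, rfl⟩

theorem numExterior_add_numInterior : M.numExterior + M.numInterior = M.rot.numCycles := by
  rw [numExterior, numInterior, ← Nat.card_sum]
  exact Nat.card_congr (Equiv.sumCompl _)

theorem isDecomposition_toDartMap (h : M.IsDiskTriangulation) {k : ℕ} {Ms : Fin k → RootedMap}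
    {is : Fin k → ℕ} : M.toDartMap.IsDecomposition (fun l => (Ms l).toDartMap) is ↔
      M.IsDecomposition Ms is := by
  have hv : ∀ d, M.vertex d ≠ M.vertex M.root ↔ ¬ M.rot.SameCycle M.root d := fun d => by
    rw [Ne, vertex_eq_iff, sameCycle_comm]
  constructor
  · rintro ⟨f, f1, f2, f3, f4, f5, f6, f7, f8⟩
    refine ⟨fun l => ⟨f l, f1 l⟩, fun d hd => f2 d ((hv _).1 hd.1) ((hv _).1 hd.2),
      fun l d => (hv _).2 (f3 l d), f4, f5, f6, by rw [h.numExterior_eq, f7], f8⟩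
  · rintro ⟨f, f2, f3, f4, f5, f6, f7, f8⟩
    refine ⟨fun l => f l, fun l => (f l).injective, fun d h1 h2 => f2 d ⟨(hv _).2 h1, (hv _).2 h2⟩,
      fun l d => (hv _).1 (f3 l d), f4, f5, f6, by rw [← h.numExterior_eq, f7], f8⟩

theorem swap_zero_one_apply : ∀ d : Fin 2, swap 0 1 (swap 0 1 d) = d := by decide

/-- The single edge. -/
def singleEdge : RootedMap where
  card := 2
  rot := 1
  inv := swap 0 1
  root := 0

theorem iso_singleEdge (h : M.IsDiskTriangulation) (h' : M.IsOuter (M.inv M.root)) :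
    M.Iso singleEdge := by
  have hd := isDisk_toDartMap.2 h
  have hall := hd.eq_root_or_of_isOuter_inv h'
  have hne := h.inv_ne M.root
  have hrot : ∀ d, M.rot d = d := by
    intro d
    have h1 := sameCycle_apply M.rot d
    have h2 : ∀ d', M.rot.SameCycle d d' → d' ≠ M.inv d := fun d' q1 q2 =>
      hd.no_loop d (q2 ▸ q1.symm)
    have h3 := h2 _ h1
    rcases hall d with q | q <;> rcases hall (M.rot d) with q' | q'
    · exact q'.trans q.symm
    · exact (h3 (q'.trans (congrArg M.inv q.symm))).elim
    · exact (h3 (q'.trans ((h.inv_inv _).symm.trans (congrArg M.inv q.symm)))).elim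
    · exact q'.trans q.symm
  have hbij : Function.Bijective (![M.root, M.inv M.root] : Fin 2 → Fin M.card) := by
    constructor
    · intro i j hij
      fin_cases i <;> fin_cases j
      · rfl
      · exact (hne hij.symm).elim
      · exact (hne hij).elim
      · rfl
    · intro d
      rcases hall d with q | q
      · exact ⟨0, q.symm⟩
      · exact ⟨1, q.symm⟩
  have : M.toDartMap.Iso singleEdge.toDartMap := by
    refine DartMap.Iso.symm ⟨Equiv.ofBijective _ hbij, fun d => ?_, fun d => ?_, rfl⟩
    · exact (hrot _).symm
    · have : ∀ d : Fin 2, ![M.root, M.inv M.root] (swap 0 1 d) =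
          M.inv (![M.root, M.inv M.root] d) := by
        intro d
        fin_cases d
        · simp
        · simp [h.inv_inv]
      exact this d
  exact this

theorem isDisk_singleEdge : singleEdge.toDartMap.IsDisk := by
  have hf : singleEdge.toDartMap.face = swap (0 : Fin 2) 1 := one_mul _
  have ho : ∀ d : Fin 2, singleEdge.toDartMap.IsOuter d := by
    intro d
    change singleEdge.toDartMap.face.SameCycle (0 : Fin 2) d
    rw [hf]
    fin_cases d
    · exact SameCycle.refl _ _
    · exact ⟨1, swap_apply_left (0 : Fin 2) 1⟩
  have hs : ∀ d e : Fin 2, singleEdge.toDartMap.rot.SameCycle d e ↔ d = e := by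
    intro d e
    exact sameCycle_one
  refine ⟨⟨?_, ?_, ?_, ?_, ?_, ?_, ?_⟩, ?_⟩
  · exact fun d => swap_zero_one_apply d
  · intro (d : Fin 2)
    change swap (0 : Fin 2) 1 d ≠ d
    fin_cases d <;> simp
  · intro G h1 h2 d e hd
    have := h2 d
    change G (swap (0 : Fin 2) 1 d) ↔ _ at this
    change Fin 2 at d
    change Fin 2 at e
    fin_cases d <;> fin_cases e <;> simp_all
  · have h1 : (1 : Perm (Fin 2)).numCycles = 2 := by
      rw [numCycles_eq_card id Function.surjective_id fun x y => sameCycle_one]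
      simp
    have h2 : singleEdge.toDartMap.face.numCycles = 1 := by
      rw [numCycles_eq_card (fun _ => ()) (fun _ => ⟨singleEdge.toDartMap.root, rfl⟩)
        fun x y => ?_]
      · simp
      · exact ⟨fun _ => rfl, fun _ => (ho x).symm.trans (ho y)⟩
    rw [h2]
    change 2 * ((1 : Perm (Fin 2)).numCycles + 1) = Nat.card (Fin 2) + 4
    rw [h1]
    simp
  · intro (d : Fin 2) h
    have := (hs _ _).1 h
    change swap (0 : Fin 2) 1 d = d at this
    fin_cases d <;> simp at this
  · exact fun d e h _ => (hs d e).1 h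
  · exact fun d hd => (hd (ho d)).elim
  · exact fun d e _ _ h => (hs d e).1 h

end RootedMap

theorem DartMap.exists_iso_toDartMap {D : Type} [Finite D] (M : DartMap D) :
    ∃ N : RootedMap, M.Iso N.toDartMap := by
  obtain ⟨n, ⟨e⟩⟩ := Finite.exists_equiv_fin D
  exact ⟨⟨n, e.permCongr M.rot, e.permCongr M.inv, e M.root⟩, e,
    fun d => by simp [RootedMap.toDartMap],
    fun d => by simp [RootedMap.toDartMap], rfl⟩

namespace RootedTriangulation

/-- The isomorphism class of a triangulation. -/
def mk (M : PreTriangulation) : RootedTriangulation := Quotient.mk _ M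

theorem exists_mk (T : RootedTriangulation) : ∃ M, mk M = T := Quotient.exists_rep T

/-- The number of vertices of a triangulation other than the initial vertex of its root. -/
noncomputable def size (T : RootedTriangulation) : ℕ := T.numExterior + T.numInterior - 1

/-- The single edge. -/
def singleEdge : RootedTriangulation :=
  mk ⟨RootedMap.singleEdge, RootedMap.isDisk_toDartMap.1 RootedMap.isDisk_singleEdge⟩

/-- The triangulation `T` is the composition of `T₁` and `T₂` that leaves the first `i` boundary
edges of `T₁` after its root on the boundary. -/
def IsComp (T₁ : RootedTriangulation) (i : ℕ) (T₂ T : RootedTriangulation) : Prop :=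
  ∃ (M₁ M₂ M : PreTriangulation) (j : ℕ), T₁ = mk M₁ ∧ T₂ = mk M₂ ∧
    T = mk M ∧ 1 ≤ i ∧ i + j + 1 = M₁.1.toDartMap.outerLength ∧
    (DartMap.comp j M₁.1.toDartMap M₂.1.toDartMap).Iso M.1.toDartMap

theorem mk_eq_iff {M N : PreTriangulation} :
    mk M = mk N ↔
      M.1.toDartMap.Iso N.1.toDartMap :=
  Quotient.eq (r := PreTriangulation.setoid)

theorem numExterior_mk (M : PreTriangulation) :
    numExterior (mk M) = M.1.toDartMap.outerLength :=
  M.2.numExterior_eq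

theorem two_le_numExterior (T : RootedTriangulation) : 2 ≤ T.numExterior := by
  obtain ⟨M, rfl⟩ := exists_mk T
  rw [numExterior_mk]
  exact (RootedMap.isDisk_toDartMap.2 M.2).two_le_outerLength

theorem size_mk (M : PreTriangulation) :
    size (mk M) + 1 = M.1.toDartMap.rot.numCycles := by
  have h1 : numExterior (mk M) + numInterior (mk M) =
      M.1.toDartMap.rot.numCycles := M.1.numExterior_add_numInterior
  have h2 := two_le_numExterior (mk M)
  unfold size
  omega

theorem exists_mk_iso {D : Type} [Finite D] {M : DartMap D} (h : M.IsDisk) :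
    ∃ N : PreTriangulation, M.Iso N.1.toDartMap := by
  obtain ⟨N, hN⟩ := M.exists_iso_toDartMap
  exact ⟨⟨N, RootedMap.isDisk_toDartMap.1 (hN.isDisk h)⟩, hN⟩

theorem outerLength_singleEdge : RootedMap.singleEdge.toDartMap.outerLength = 2 := by
  refine le_antisymm (DartMap.outerLength_le_of_pow_eq (by omega) ?_)
    RootedMap.isDisk_singleEdge.two_le_outerLength
  exact RootedMap.swap_zero_one_apply 0

theorem isCompositionSystem :
    IsCompositionSystem size (fun T => T.numExterior - 1) singleEdge IsComp where
  size_atom := by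
    have h1 := size_mk ⟨RootedMap.singleEdge,
      RootedMap.isDisk_toDartMap.1 RootedMap.isDisk_singleEdge⟩
    have h2 : (1 : Perm (Fin 2)).numCycles = 2 := by
      rw [numCycles_eq_card id Function.surjective_id fun x y => sameCycle_one]
      simp
    exact Nat.succ_injective (h1.trans h2)
  t_atom := by
    rw [singleEdge, numExterior_mk, outerLength_singleEdge]
  size_pos T := by
    have := T.two_le_numExterior
    unfold size
    omega
  bounds := by
    rintro _ i _ _ ⟨M₁, M₂, M, j, rfl, rfl, rfl, hi, hj, h⟩
    rw [numExterior_mk]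
    omega
  size_comp := by
    rintro _ i _ _ ⟨M₁, M₂, M, j, rfl, rfl, rfl, hi, hj, h⟩
    have h1 := size_mk M₁
    have h2 := size_mk M₂
    have h3 := size_mk M
    have h4 := (DartMap.compSpec (j := j) (RootedMap.isDisk_toDartMap.2 M₁.2)
      (RootedMap.isDisk_toDartMap.2 M₂.2) (by omega)).numCycles_rot_eq
    rw [h.numCycles_rot_eq] at h4
    omega
  t_comp := by
    rintro _ i _ _ ⟨M₁, M₂, M, j, rfl, rfl, rfl, hi, hj, h⟩
    have h2 := two_le_numExterior (mk M₂)
    have h4 := (DartMap.compSpec (j := j) (RootedMap.isDisk_toDartMap.2 M₁.2)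
      (RootedMap.isDisk_toDartMap.2 M₂.2) (by omega)).outerLength_eq
    rw [h.outerLength_eq] at h4
    rw [numExterior_mk] at h2
    rw [numExterior_mk, numExterior_mk]
    omega
  exists_comp := by
    intro T₁ i T₂ h1 h2
    obtain ⟨M₁, rfl⟩ := exists_mk T₁
    obtain ⟨M₂, rfl⟩ := exists_mk T₂
    rw [numExterior_mk] at h2
    obtain ⟨j, hj⟩ := Nat.exists_eq_add_of_le (show i + 1 ≤ M₁.1.toDartMap.outerLength by omega)
    obtain ⟨M, hM⟩ := exists_mk_iso (DartMap.compSpec (j := j) (RootedMap.isDisk_toDartMap.2 M₁.2)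
      (RootedMap.isDisk_toDartMap.2 M₂.2) (by omega)).isDisk
    exact ⟨mk M, M₁, M₂, M, j, rfl, rfl, rfl, h1, by omega, hM⟩
  comp_unique := by
    rintro _ i _ _ _ ⟨M₁, M₂, M, j, rfl, rfl, rfl, hi, hj, h⟩
      ⟨N₁, N₂, N, j', e1, e2, rfl, -, hj', h'⟩
    rw [mk_eq_iff] at e1 e2 ⊢
    have := e1.outerLength_eq
    obtain rfl : j = j' := by omega
    exact h.symm.trans ((e1.comp e2).trans h')
  decomp := by
    intro T
    obtain ⟨M, rfl⟩ := exists_mk T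
    by_cases h : M.1.IsOuter (M.1.inv M.1.root)
    · exact .inl (mk_eq_iff.2 (RootedMap.iso_singleEdge M.2 h))
    · obtain ⟨D₁, D₂, _, _, M₁, M₂, j, h₁, h₂, hj, hM⟩ :=
        (RootedMap.isDisk_toDartMap.2 M.2).exists_comp h
      obtain ⟨N₁, e₁⟩ := exists_mk_iso h₁
      obtain ⟨N₂, e₂⟩ := exists_mk_iso h₂
      have := e₁.outerLength_eq
      exact .inr ⟨mk N₁, M₁.outerLength - 1 - j, mk N₂, N₁, N₂, M, j, rfl,
        rfl, rfl, by omega, by omega, ((e₁.comp e₂).symm.trans hM.symm)⟩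
  decomp_unique := by
    rintro _ i _ _ i' _ _ ⟨M₁, M₂, M, j, rfl, rfl, rfl, hi, hj, h⟩
      ⟨N₁, N₂, N, j', rfl, rfl, e, hi', hj', h'⟩
    rw [mk_eq_iff] at e
    obtain ⟨rfl, h1, h2⟩ := DartMap.comp_injective (RootedMap.isDisk_toDartMap.2 M₁.2)
      (RootedMap.isDisk_toDartMap.2 M₂.2) (RootedMap.isDisk_toDartMap.2 N₁.2)
      (RootedMap.isDisk_toDartMap.2 N₂.2) (by omega) (by omega) (h.trans (e.trans h'.symm))
    have := h1.outerLength_eq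
    exact ⟨mk_eq_iff.2 h1, by omega, mk_eq_iff.2 h2⟩

theorem isDecomposition_singleEdge (Ts : Fin 0 → RootedTriangulation) (is : Fin 0 → ℕ) :
    singleEdge.IsDecomposition Ts is := by
  have hd := RootedMap.isDisk_toDartMap.1 RootedMap.isDisk_singleEdge
  refine ⟨⟨_, hd⟩, fun l => l.elim0, rfl, fun l => l.elim0,
    (RootedMap.isDecomposition_toDartMap hd).1 ?_⟩
  refine ⟨fun l => l.elim0, fun l => l.elim0, ?_, fun l => l.elim0, fun l => l.elim0,
    fun l => l.elim0, fun l => l.elim0, ?_, fun l => l.elim0⟩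
  · intro (d : Fin 2) h1 h2
    exfalso
    change ¬ (1 : Perm (Fin 2)).SameCycle 0 d at h1
    change ¬ (1 : Perm (Fin 2)).SameCycle 0 (swap (0 : Fin 2) 1 d) at h2
    rw [sameCycle_one] at h1 h2
    fin_cases d <;> simp at h1 h2
  · rw [outerLength_singleEdge]
    rfl

theorem IsComp.isDecomposition {k : ℕ} {Ts : Fin (k + 1) → RootedTriangulation}
    {is : Fin (k + 1) → ℕ} {T₂ T : RootedTriangulation} (h : IsComp (Ts 0) (is 0) T₂ T)
    (h₂ : T₂.IsDecomposition (fun l => Ts l.succ) fun l => is l.succ) :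
    T.IsDecomposition Ts is := by
  obtain ⟨M₁, M₂, M, j, e1, rfl, rfl, hi, hj, hM⟩ := h
  obtain ⟨N₂, Ms, e2, e3, hN⟩ := h₂
  replace e2 : mk M₂ = mk N₂ := e2
  rw [mk_eq_iff] at e2
  have hMs : ∀ l, Ts l = mk (Fin.cons (α := fun _ => PreTriangulation) M₁ Ms l) :=
    Fin.cases e1 e3
  refine ⟨M, Fin.cons (α := fun _ => PreTriangulation) M₁ Ms, rfl, hMs,
    (RootedMap.isDecomposition_toDartMap M.2).1 ?_⟩
  refine (((DartMap.Iso.refl _).comp e2.symm).trans hM).isDecomposition ?_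
  exact DartMap.isDecomposition_comp (E := fun l => Fin (Fin.cons (α := fun _ => PreTriangulation)
      M₁ Ms l).1.card) (Ms := fun l => (Fin.cons (α := fun _ => PreTriangulation)
      M₁ Ms l).1.toDartMap) (RootedMap.isDisk_toDartMap.2 M₁.2)
    (RootedMap.isDisk_toDartMap.2 N₂.2) hj hi ((RootedMap.isDecomposition_toDartMap N₂.2).2 hN)

end RootedTriangulation

/-! ### Matchings of initial segments of the natural numbers -/

/-- The involution `m` of `ℕ` is a chord diagram on the points `0, …, 2 * n - 1`; it fixes all other
numbers.  Its chords are the numbers `c` with `c < m c`. -/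
structure IsMatching (n : ℕ) (m : ℕ → ℕ) : Prop where
  invol : ∀ x, m (m x) = x
  eq_self_iff : ∀ x, m x = x ↔ 2 * n ≤ x

namespace Matching

/-- The chord `d` is a right neighbor of the chord `c`. -/
def Nbr (m : ℕ → ℕ) (c d : ℕ) : Prop := c < d ∧ d < m c ∧ m c < m d

/-- The chords `c` and `d` cross. -/
def Cross (m : ℕ → ℕ) (c d : ℕ) : Prop := Nbr m c d ∨ Nbr m d c

/-- The chord `c` lies under the chord `k`. -/
def Under (m : ℕ → ℕ) (c k : ℕ) : Prop := k < c ∧ m c < m k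

/-- The chord `c` spans the gap between the points `u - 1` and `u`. -/
def Spans (m : ℕ → ℕ) (c u : ℕ) : Prop := c < u ∧ u ≤ m c

/-- There is a path in the intersection graph from `c` to `d` all of whose chords, with the possible
exception of `c`, satisfy `P`. -/
def Reach (m : ℕ → ℕ) (P : ℕ → Prop) : ℕ → ℕ → Prop :=
  Relation.ReflTransGen fun a b => P b ∧ Cross m a b

variable {m : ℕ → ℕ} {n : ℕ} {P Q : ℕ → Prop} {c d e k u x y : ℕ}

theorem Cross.symm (h : Cross m c d) : Cross m d c := Or.symm h

theorem Cross.left (h : Cross m c d) : c < m c := by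
  rcases h with ⟨h1, h2, h3⟩ | ⟨h1, h2, h3⟩ <;> omega

theorem Cross.right (h : Cross m c d) : d < m d := h.symm.left

namespace Reach

theorem refl (m : ℕ → ℕ) (P : ℕ → Prop) (c : ℕ) : Reach m P c c := Relation.ReflTransGen.refl

theorem single (h : Cross m c d) (hd : P d) : Reach m P c d := Relation.ReflTransGen.single ⟨hd, h⟩

theorem tail (h : Reach m P c d) (he : Cross m d e) (hP : P e) : Reach m P c e :=
  Relation.ReflTransGen.tail h ⟨hP, he⟩

theorem trans (h : Reach m P c d) (h' : Reach m P d e) : Reach m P c e :=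
  Relation.ReflTransGen.trans h h'

theorem prop (h : Reach m P c d) (hc : P c) : P d := by
  induction h with
  | refl => exact hc
  | tail _ h _ => exact h.1

theorem symm (h : Reach m P c d) (hc : P c) : Reach m P d c := by
  induction h with
  | refl => exact refl _ _ _
  | tail h h' ih => exact (single h'.2.symm (prop h hc)).trans ih

theorem mono (h : Reach m P c d) (hPQ : ∀ x, P x → Q x) : Reach m Q c d :=
  Relation.ReflTransGen.mono (fun _ _ h' => ⟨hPQ _ h'.1, h'.2⟩) _ _ h

theorem isChord (h : Reach m P c d) (hc : c < m c) : d < m d := by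
  induction h with
  | refl => exact hc
  | tail _ h _ => exact h.2.right

/-- The condition may be strengthened to hold only on chords that are themselves reached. -/
theorem strengthen (h : Reach m P c d) : Reach m (fun x => P x ∧ Reach m P c x) c d := by
  induction h with
  | refl => exact refl _ _ _
  | tail h h' ih => exact ih.tail h'.2 ⟨h'.1, Reach.tail h h'.2 h'.1⟩

/-- A connected set of chords with points on both sides of a gap contains a chord that spans it. -/
theorem exists_spans (h : Reach m P c d) (hu : c < u) (hd : u ≤ m d) :
    ∃ e, Reach m P c e ∧ Spans m e u := by
  by_contra! hcon
  have key : ∀ e, Reach m P c e → m e < u := by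
    intro e he
    induction he with
    | refl =>
      by_contra h
      exact hcon c (refl _ _ _) ⟨hu, by omega⟩
    | tail h h' ih =>
      by_contra h2
      refine hcon _ (Reach.tail h h'.2 h'.1) ⟨?_, by omega⟩
      rcases h'.2 with ⟨h1, h2, h3⟩ | ⟨h1, h2, h3⟩ <;> omega
  have := key d h
  omega

end Reach

end Matching

namespace IsMatching

open Matching

variable {n : ℕ} {m : ℕ → ℕ} {P Q : ℕ → Prop} {c d e k u x y : ℕ}

theorem injective (h : IsMatching n m) (hxy : m x = m y) : x = y := by
  rw [← h.invol x, hxy, h.invol]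

theorem lt_iff (h : IsMatching n m) : m x < 2 * n ↔ x < 2 * n := by
  have h1 := h.eq_self_iff x
  have h2 := h.eq_self_iff (m x)
  have h3 := h.invol x
  constructor
  · intro h4
    by_contra h5
    have := h1.2 (by omega)
    omega
  · intro h4
    by_contra h5
    have := h2.2 (by omega)
    rw [h3] at this
    have := h1.1 this.symm
    omega

theorem sink_lt (h : IsMatching n m) (hc : c < m c) : m c < 2 * n := by
  by_contra h1
  have := (h.eq_self_iff (m c)).2 (by omega)
  rw [h.invol] at this
  omega

theorem ne (h : IsMatching n m) (hx : x < 2 * n) : m x ≠ x := fun h1 => by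
  have := (h.eq_self_iff x).1 h1
  omega

/-- The endpoints of different chords are different. -/
theorem endpoints_ne (h : IsMatching n m) (hc : c < m c) (hd : d < m d) (hne : c ≠ d) :
    m c ≠ m d ∧ c ≠ m d ∧ m c ≠ d := by
  refine ⟨fun h1 => hne (h.injective h1), ?_, ?_⟩
  · rintro h1
    have := h.invol d
    rw [← h1] at this
    omega
  · rintro h1
    have := h.invol c
    rw [h1] at this
    omega

theorem under_of_cross (h : IsMatching n m) (hk : k < m k) (hx : Under m x k) (hxy : Cross m x y)
    (hy : ¬ Cross m k y) : Under m y k := by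
  have hne : y ≠ k := by
    rintro rfl
    obtain ⟨h1, h2⟩ := hx
    rcases hxy with ⟨h3, h4, h5⟩ | ⟨h3, h4, h5⟩ <;> omega
  obtain ⟨e1, e2, e3⟩ := h.endpoints_ne hxy.right hk hne
  have h1 := hxy.right
  simp only [Cross, Nbr, Under] at *
  omega

/-- If a path leads out of the region under the chord `k`, then it crosses `k`. -/
theorem exists_cross (h : IsMatching n m) (hk : k < m k) (hxy : Reach m P x y) (hx : Under m x k)
    (hy : ¬ Under m y k) : ∃ e, Reach m P x e ∧ Cross m k e := by
  by_contra! hcon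
  have key : ∀ e, Reach m P x e → Under m e k := by
    intro e he
    induction he with
    | refl => exact hx
    | tail h1 h2 ih => exact h.under_of_cross hk ih h2.2 (hcon _ (Reach.tail h1 h2.2 h2.1))
  exact hy (key y hxy)

/-- If a path leads into the region under the chord `k`, then it crosses `k`. -/
theorem exists_cross' (h : IsMatching n m) (hk : k < m k) (hxy : Reach m P x y) (hx : ¬ Under m x k)
    (hy : Under m y k) : ∃ e, Reach m P x e ∧ Cross m k e := by
  by_contra! hcon
  have key : ∀ e, Reach m P x e → ¬ Under m e k := by
    intro e he
    induction he with
    | refl => exact hx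
    | tail h1 h2 ih => exact fun h3 => ih (h.under_of_cross hk h3 h2.2.symm (hcon _ h1))
  exact key y hxy hy

/-- Two connected sets of chords meet or cross if they have points that alternate: the first one has
a point before `κ` and the point `α`, the second one has the points `κ` and `κ'`, and
`κ < α < κ'`. -/
theorem exists_eq_or_cross (h : IsMatching n m) {a₁ a₂ k₁ k₂ κ α κ' : ℕ} (ha : Reach m P a₁ a₂)
    (hk : Reach m Q k₁ k₂) (ha₁ : a₁ < m a₁) (hk₁ : k₁ < m k₁) (hα : α = a₂ ∨ α = m a₂)
    (hκ : κ = k₁ ∨ κ = m k₁) (hκ' : κ' = k₂ ∨ κ' = m k₂) (h1 : a₁ < κ) (h2 : κ < α) (h3 : α < κ') :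
    ∃ a k, Reach m P a₁ a ∧ Reach m Q k₁ k ∧ (a = k ∨ Cross m a k) := by
  by_contra! hcon
  have ha₂ := ha.isChord ha₁
  have hk₂ := hk.isChord hk₁
  obtain ⟨p, hp, hp1, hp2⟩ := ha.exists_spans (u := κ) h1 (by omega)
  obtain ⟨q, hq, hq1, hq2⟩ := hk.exists_spans (u := α) (by omega) (by omega)
  have hpc := hp.isChord ha₁
  have hqc := hq.isChord hk₁
  have under : ∀ a b x, a < m a → b < m b → a ≠ b → ¬ Cross m a b → (x = b ∨ x = m b) → a < x →
      x ≤ m a → Under m b a := by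
    intro a b x q1 q2 q3 q4 q5 q6 q7
    obtain ⟨e1, e2, e3⟩ := h.endpoints_ne q1 q2 q3
    simp only [Cross, Nbr, Under] at *
    omega
  have hkp : Under m k₁ p := under p k₁ κ hpc hk₁ (hcon _ _ hp (.refl _ _ _)).1
    (hcon _ _ hp (.refl _ _ _)).2 hκ hp1 hp2
  have haq : Under m a₂ q := under q a₂ α hqc ha₂ (hcon _ _ ha hq).1.symm
    (fun hc => (hcon _ _ ha hq).2 hc.symm) hα hq1 hq2
  have hqp : Under m q p := by
    by_contra hn
    obtain ⟨e, he, hc⟩ := h.exists_cross hpc hq hkp hn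
    exact (hcon _ _ hp he).2 hc
  have hpq : ¬ Under m p q := by
    simp only [Under] at *
    omega
  by_cases ha₁q : Under m a₁ q
  · obtain ⟨e, he, hc⟩ := h.exists_cross hqc hp ha₁q hpq
    exact (hcon _ _ he hq).2 hc.symm
  · obtain ⟨e, he, hc⟩ := h.exists_cross' hqc ha ha₁q haq
    exact (hcon _ _ he hq).2 hc.symm

end IsMatching

/-! ### The spine of a connected diagram and the gaps at which diagrams may be inserted -/

namespace Matching

variable {m : ℕ → ℕ} {n : ℕ} {P Q : ℕ → Prop} {c d e k u x y : ℕ}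

/-- A path leaves its initial chord for a last time. -/
theorem Reach.exists_last (h : Reach m P x y) (hne : x ≠ y) :
    ∃ e, Cross m x e ∧ P e ∧ Reach m (fun z => P z ∧ z ≠ x) e y := by
  induction h with
  | refl => exact (hne rfl).elim
  | @tail b c h1 h2 ih =>
    by_cases hb : x = b
    · subst hb
      exact ⟨c, h2.2, h2.1, .refl _ _ _⟩
    · obtain ⟨e, h3, h4, h5⟩ := ih hb
      exact ⟨e, h3, h4, h5.tail h2.2 ⟨h2.1, hne.symm⟩⟩

/-- A path that does not stay in `P` has a first chord outside of `P`. -/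
theorem Reach.exists_exit (h : Reach m Q x y) (h' : ¬ Reach m P x y) :
    ∃ a b, Reach m P x a ∧ Cross m a b ∧ Q b ∧ ¬ P b := by
  induction h with
  | refl => exact (h' (.refl _ _ _)).elim
  | @tail b c h1 h2 ih =>
    by_cases hb : Reach m P x b
    · exact ⟨b, c, hb, h2.2, h2.1, fun hP => h' (hb.tail h2.2 hP)⟩
    · exact ih hb

/-- The diagram is connected. -/
def Conn (n : ℕ) (m : ℕ → ℕ) : Prop :=
  1 ≤ n ∧ ∀ c d, c < m c → d < m d → Reach m (fun _ => True) c d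

/-- The chord with the last sink.  In a connected diagram, this is the first terminal chord of the
intersection order. -/
def last (n : ℕ) (m : ℕ → ℕ) : ℕ := m (2 * n - 1)

/-- The spine consists of the chords `d` that are connected to the chord with the last sink through
chords that do not precede `d`. -/
def Spine (n : ℕ) (m : ℕ → ℕ) (d : ℕ) : Prop := d < m d ∧ Reach m (d ≤ ·) d (last n m)

/-- A local form of top-cycle-freeness: for `p → q → r`, the chords under `q` do not span all gaps
between the sink of `p` and the source of `r`.  In particular, the sink of `p` precedes the source
of `r`. -/
def TopFree (m : ℕ → ℕ) : Prop :=
  ∀ p q r, Nbr m p q → Nbr m q r → ∃ u, m p < u ∧ u ≤ r ∧ ∀ c, Under m c q → ¬ Spans m c u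

/-- The condition of `TopFree` for a chord `r` whose source is inserted at the gap `g` and whose
sink is added at the end. -/
def Good (m : ℕ → ℕ) (g : ℕ) : Prop :=
  ∀ p q, Nbr m p q → Spans m q g → ∃ u, m p < u ∧ u ≤ g ∧ ∀ c, Under m c q → ¬ Spans m c u

end Matching

namespace IsMatching

open Matching

variable {n : ℕ} {m : ℕ → ℕ} {c d e g k u x y : ℕ}

theorem sink_last (h : IsMatching n m) : m (last n m) = 2 * n - 1 := h.invol _

theorem sink_le_last (h : IsMatching n m) (hd : d < m d) : m d ≤ m (last n m) := by
  have := h.sink_lt hd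
  rw [h.sink_last]
  omega

theorem last_isChord (h : IsMatching n m) (hn : 1 ≤ n) : last n m < m (last n m) := by
  rw [h.sink_last, last]
  have h1 := (h.lt_iff (x := 2 * n - 1)).2 (by omega)
  have h2 := h.ne (x := 2 * n - 1) (by omega)
  omega

theorem eq_last_iff (h : IsMatching n m) : d = last n m ↔ m d = 2 * n - 1 := by
  rw [last]
  constructor
  · rintro rfl
    exact h.invol _
  · intro h1
    rw [← h1, h.invol]

theorem root_isChord (h : IsMatching n m) (hn : 1 ≤ n) : 0 < m 0 := by
  have := h.ne (x := 0) (by omega)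
  omega

theorem spine_zero (h : IsMatching n m) (hc : Conn n m) : Spine n m 0 :=
  ⟨h.root_isChord hc.1, (hc.2 _ _ (h.root_isChord hc.1) (h.last_isChord hc.1)).mono
    fun _ _ => Nat.zero_le _⟩

theorem spine_last (h : IsMatching n m) (hc : Conn n m) : Spine n m (last n m) :=
  ⟨h.last_isChord hc.1, .refl _ _ _⟩

theorem not_nbr_last (h : IsMatching n m) : ¬ Nbr m (last n m) d := by
  intro h1
  have h2 := h.sink_last
  have h3 := h.sink_lt (c := d) (by simp only [Nbr] at h1; omega)
  simp only [Nbr] at h1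
  omega

/-- The gap before the source `g` of a chord of the spine is good. Suppose that `q` spans the gap.
The path from `g` to the last chord must leave the region under `q`, at a right neighbor `f` of `q`,
and up to there its chords span all gaps after `g`. So the gap that top-cycle-freeness provides for
`p → q → f` is not after `g`. -/
theorem good_of_spine (h : IsMatching n m) (ht : TopFree m) (hg : Spine n m g) : Good m g := by
  intro p q hpq hq
  obtain ⟨hgc, hgt⟩ := hg
  have hn : 1 ≤ n := by
    have := h.sink_lt hgc
    omega
  have hqc : q < m q := by simp only [Spans] at hq; omega
  obtain ⟨e1, e2, e3⟩ := h.endpoints_ne hgc hqc (by simp only [Spans] at hq; omega)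
  -- a first chord on the path from `g` that is not under `q` is a right neighbor of `q`
  have hex : ∃ f, g ≤ f ∧ Nbr m q f ∧ ∀ v, g < v → v ≤ f → ∃ c, Under m c q ∧ Spans m c v := by
    by_cases hu : Under m g q
    · have hlast : ¬ Under m (last n m) q := by
        intro h1
        have h2 := h.sink_last
        have h3 := h.sink_lt hqc
        simp only [Under] at h1
        omega
      obtain ⟨a, f, h1, h2, h3, h4⟩ := hgt.exists_exit (P := fun x => g ≤ x ∧ Under m x q)
        fun h1 => hlast (h1.prop ⟨le_rfl, hu⟩).2
      have h5 := (h1.prop ⟨le_rfl, hu⟩).2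
      have h6 : ¬ Under m f q := fun h6 => h4 ⟨h3, h6⟩
      have h7 : q ≠ f := by
        rintro rfl
        simp only [Spans] at hq
        omega
      obtain ⟨e4, e5, e6⟩ := h.endpoints_ne hqc h2.right h7
      have h8 : f < m a ∧ Nbr m q f := by
        simp only [Cross, Nbr, Under, Spans] at *
        omega
      refine ⟨f, h3, h8.2, fun v hv1 hv2 => ?_⟩
      obtain ⟨c, hc1, hc2⟩ := h1.exists_spans (u := v) hv1 (by omega)
      exact ⟨c, (hc1.prop ⟨le_rfl, hu⟩).2, hc2⟩
    · exact ⟨g, le_rfl, by simp only [Nbr, Under, Spans] at *; omega, fun v hv1 hv2 => by omega⟩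
  obtain ⟨f, hf1, hf2, hf3⟩ := hex
  obtain ⟨u, hu1, hu2, hu3⟩ := ht p q f hpq hf2
  refine ⟨u, hu1, ?_, hu3⟩
  by_contra hgu
  obtain ⟨c, hc1, hc2⟩ := hf3 u (by omega) hu2
  exact hu3 c hc1 hc2

theorem good_end (h : IsMatching n m) : Good m (2 * n - 1) := by
  intro p q hpq hq
  have hqc : q < m q := by simp only [Spans] at hq; omega
  have := h.sink_lt hqc
  simp only [Nbr, Under, Spans] at *
  exact ⟨2 * n - 1, by omega, le_rfl, fun c hc => by omega⟩

/-- Conversely, a good gap other than the one at the end is just before the source of a chord of the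
spine.  Otherwise, let `d` be the last chord of the spine that starts before the gap `g`.  Goodness,
used for `d` and the left neighbor of `d` with the last sink, provides a gap `u` between the source
of `d` and `g` that is spanned by `d` and by chords around `d` only; then the chord that starts at
`u` belongs to the spine, which is a contradiction. -/
theorem spine_of_good (h : IsMatching n m) (hc : Conn n m) (hg1 : 1 ≤ g) (hg2 : g < 2 * n - 1)
    (hg : Good m g) : Spine n m g := by
  by_contra hns
  have hsl := h.sink_last
  -- the last chord of the spine with source before `g`
  obtain ⟨d, hd, hmax'⟩ := ((Finset.range g).filter (Spine n m)).exists_max_image id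
    ⟨0, by simpa using ⟨by omega, h.spine_zero hc⟩⟩
  obtain ⟨hdg, hds⟩ : d < g ∧ Spine n m d := by simpa using hd
  have hmax : ∀ x, Spine n m x → x ≤ d ∨ g < x := by
    intro x hx
    by_contra! hcon
    have : x ≠ g := by rintro rfl; exact hns hx
    have := hmax' x (by simpa using ⟨by omega, hx⟩)
    simp only [id] at this
    omega
  clear hmax' hd
  have hdc := hds.1
  -- chords after `d` that are linked to the last chord by chords after `d` start after `g`, since
  -- the first one of them belongs to the spine
  have hA : ∀ x, d < x → x < m x → Reach m (d < ·) x (last n m) → g < x := by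
    intro x hx1 hx2 hx3
    have hex : ∃ k, d < k ∧ k < m k ∧ Reach m (d < ·) k (last n m) := ⟨x, hx1, hx2, hx3⟩
    have hk := Nat.find_spec hex
    have hmin : ∀ y, d < y → y < m y → Reach m (d < ·) y (last n m) → Nat.find hex ≤ y :=
      fun y q1 q2 q3 => Nat.find_min' hex ⟨q1, q2, q3⟩
    have hkx := hmin x hx1 hx2 hx3
    generalize Nat.find hex = k at hk hmin hkx
    have hks : Spine n m k := by
      refine ⟨hk.2.1, hk.2.2.strengthen.mono fun y hy => ?_⟩
      exact hmin y hy.1 (hy.2.isChord hk.2.1) ((hy.2.symm hk.1).trans hk.2.2)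
    have := hmax k hks
    omega
  -- a path from `d` to the last chord that does not return to `d` continues after `g`
  have hE : d ≠ last n m → ∃ e, g < e ∧ Nbr m d e ∧ Reach m (g < ·) e (last n m) := by
    intro hne
    obtain ⟨e, h1, h2, h3⟩ := hds.2.exists_last hne
    have h4 : d < e := by
      simp only [Cross, Nbr] at h1
      omega
    have h5 : Reach m (d < ·) e (last n m) := h3.mono fun z hz => by omega
    refine ⟨e, hA e h4 h1.right h5, ?_, h5.strengthen.mono fun y hy => ?_⟩
    · simp only [Cross, Nbr] at h1 ⊢
      omega
    · exact hA y hy.1 (hy.2.isChord h1.right) ((hy.2.symm h4).trans h5)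
  have hmd : g < m d := by
    by_cases hne : d = last n m
    · rw [hne, hsl]
      exact hg2
    · obtain ⟨e, h1, h2, -⟩ := hE hne
      simp only [Nbr] at h2
      omega
  -- if `d` has no left neighbor, the gap after the source of `d` has the required properties
  have hU : ∃ u, d < u ∧ u ≤ g ∧ (∀ p, Nbr m p d → m p < u) ∧
      ∀ c, Under m c d → ¬ Spans m c u := by
    by_cases hp : ∃ p, Nbr m p d
    · obtain ⟨p, hp, hpmax⟩ := ((Finset.range d).filter (Nbr m · d)).exists_max_image m
        (by obtain ⟨p, hp⟩ := hp; exact ⟨p, by simpa using ⟨hp.1, hp⟩⟩)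
      have hp : Nbr m p d := by
        simp only [Finset.mem_filter] at hp
        exact hp.2
      obtain ⟨u, hu1, hu2, hu3⟩ := hg p d hp ⟨hdg, hmd.le⟩
      refine ⟨u, lt_trans hp.2.1 hu1, hu2, fun p' hp' => ?_, hu3⟩
      exact lt_of_le_of_lt (hpmax p' (by simpa using ⟨hp'.1, hp'⟩)) hu1
    · refine ⟨d + 1, by omega, by omega, fun p h1 => (hp ⟨p, h1⟩).elim, fun c h1 h2 => ?_⟩
      simp only [Under, Spans] at h1 h2
      omega
  obtain ⟨u, hdu, hug, hup, hund⟩ := hU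
  -- a chord with source after `d` that spans `u` would be linked to the last chord after `d`
  have hB : ∀ c, Spans m c u → c = d ∨ c < d ∧ m d < m c := by
    intro c hcs
    have hcc : c < m c := by simp only [Spans] at hcs; omega
    by_cases hcd : c = d
    · exact .inl hcd
    obtain ⟨e1, e2, e3⟩ := h.endpoints_ne hcc hdc hcd
    rcases lt_or_gt_of_ne hcd with hlt | hgt
    · refine .inr ⟨hlt, ?_⟩
      by_contra hn
      have := hup c (by simp only [Nbr, Spans] at *; omega)
      simp only [Spans] at hcs
      omega
    · exfalso
      have h1 : m d < m c := by
        by_contra hn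
        exact hund c ⟨hgt, by omega⟩ hcs
      have hne : d ≠ last n m := by
        rintro rfl
        exact absurd (h.sink_le_last hcc) (not_le.2 h1)
      obtain ⟨e, he1, he2, he3⟩ := hE hne
      have hcg : c < g := by simp only [Spans] at hcs; omega
      have hce : c < e := by omega
      have he3' : Reach m (d < ·) e (last n m) := he3.mono fun z hz => by omega
      have hde : d < e := he2.1
      suffices Reach m (d < ·) c (last n m) by
        have := hA c hgt hcc this
        omega
      by_cases hct : c = last n m
      · rw [hct]
        exact .refl _ _ _
      have hlu : ¬ Under m (last n m) c := fun h2 =>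
        absurd (h.sink_le_last hcc) (not_le.2 h2.2)
      have heu : Cross m c e ∨ Under m e c := by
        obtain ⟨q1, q2, q3⟩ := h.endpoints_ne hcc (by simp only [Nbr] at he2; omega : e < m e)
          (by omega)
        simp only [Cross, Nbr, Under] at *
        omega
      rcases heu with heu | heu
      · exact (Reach.single heu hde).trans he3'
      · obtain ⟨z, hz1, hz2⟩ := h.exists_cross hcc he3' heu hlu
        exact ((Reach.single hz2 (hz1.prop hde)).trans (hz1.symm hde)).trans he3'
  -- the point `u` is a source, since a chord that ends there would span the gap `u`
  have hu2 : m u ≠ u := h.ne (by omega)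
  rcases lt_or_gt_of_ne hu2 with hlt | huc
  · have h1 := h.invol u
    rcases hB (m u) ⟨hlt, by omega⟩ with h2 | h2
    · rw [← h2] at hmd
      omega
    · omega
  suffices Spine n m u by
    have := hmax u this
    omega
  refine ⟨huc, ?_⟩
  by_contra hnr
  -- the chords reached from `u` after `u` have a neighbor `c` that starts before `u`, and so they
  -- have a chord `y` that is a right neighbor of `d`, like the chord `e` that is linked to the last
  -- chord
  obtain ⟨x, c, hx, hxc, -, hcu⟩ := (hc.2 u _ huc (h.last_isChord hc.1)).exists_exit hnr
  have hxu : u ≤ x := hx.prop (le_refl u)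
  have hcs : Spans m c u ∧ m c < m x := by
    simp only [Cross, Nbr, Spans] at *
    omega
  have hY : ∃ y, Reach m (u ≤ ·) u y ∧ Nbr m d y := by
    rcases hB c hcs.1 with rfl | ⟨h1, h2⟩
    · refine ⟨x, hx, ?_⟩
      simp only [Cross, Nbr] at *
      omega
    · obtain ⟨e1, e2, e3⟩ := h.endpoints_ne huc hdc (by omega)
      by_cases h3 : m d < m u
      · exact ⟨u, .refl _ _ _, hdu, by omega, h3⟩
      · obtain ⟨y, hy1, hy2⟩ := h.exists_cross hdc hx ⟨hdu, by omega⟩ fun h4 => by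
          simp only [Under] at h4
          omega
        refine ⟨y, hy1, ?_⟩
        have : u ≤ y := hy1.prop (le_refl u)
        simp only [Cross, Nbr] at *
        omega
  obtain ⟨y, hy, hdy⟩ := hY
  have hyc : y < m y := hy.isChord huc
  have hyu : u ≤ y := hy.prop (le_refl u)
  obtain ⟨e, he1, he2, he3⟩ := hE (by rintro rfl; exact h.not_nbr_last hdy)
  have he3' : Reach m (u ≤ ·) e (last n m) := he3.mono fun z hz => by omega
  have heu : u ≤ e := by omega
  have hec : e < m e := by simp only [Nbr] at he2; omega
  by_cases hye : y = e
  · exact hnr (hy.trans (hye ▸ he3'))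
  obtain ⟨q1, q2, q3⟩ := h.endpoints_ne hyc hec hye
  have h3 : Cross m y e ∨ Under m e y ∨ Under m y e := by
    simp only [Cross, Nbr, Under] at *
    omega
  rcases h3 with h3 | h3 | h3
  · exact hnr ((hy.tail h3 heu).trans he3')
  · by_cases hyl : Under m (last n m) y
    · exact absurd (h.sink_le_last hyc) (not_le.2 hyl.2)
    · obtain ⟨z, hz1, hz2⟩ := h.exists_cross hyc he3' h3 hyl
      exact hnr (((hy.tail hz2 (hz1.prop heu)).trans (hz1.symm heu)).trans he3')
  · obtain ⟨z, hz1, hz2⟩ := h.exists_cross' hec hy (fun h4 => by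
      simp only [Under] at h4
      omega) h3
    exact hnr ((hz1.tail hz2.symm heu).trans he3')

end IsMatching

/-! ### Inserting a diagram into a gap of another one -/

namespace Matching

/-- The strictly increasing map `e` carries the chords of `A` to chords of `C`. -/
structure Emb (a : ℕ) (A C : ℕ → ℕ) (e : ℕ → ℕ) : Prop where
  mono : ∀ x y, x < y → y < 2 * a → e x < e y
  map : ∀ x, x < 2 * a → C (e x) = e (A x)

namespace Emb

variable {a : ℕ} {A C e : ℕ → ℕ} {P Q : ℕ → Prop} {c p q u x y z : ℕ}

theorem lt_iff (h : Emb a A C e) (hx : x < 2 * a) (hy : y < 2 * a) : e x < e y ↔ x < y := by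
  constructor
  · intro h1
    by_contra h2
    rcases eq_or_lt_of_le (not_lt.1 h2) with rfl | h3
    · omega
    · have := h.mono _ _ h3 hx
      omega
  · exact fun h1 => h.mono _ _ h1 hy

theorem eq_iff (h : Emb a A C e) (hx : x < 2 * a) (hy : y < 2 * a) : e x = e y ↔ x = y := by
  have h1 := h.lt_iff hx hy
  have h2 := h.lt_iff hy hx
  constructor
  · intro h3
    omega
  · rintro rfl
    rfl

theorem isChord_iff (h : Emb a A C e) (hA : IsMatching a A) (hx : x < 2 * a) :
    e x < C (e x) ↔ x < A x := by
  rw [h.map x hx, h.lt_iff hx (hA.lt_iff.2 hx)]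

theorem nbr_iff (h : Emb a A C e) (hA : IsMatching a A) (hx : x < 2 * a) (hy : y < 2 * a) :
    Nbr C (e x) (e y) ↔ Nbr A x y := by
  have hx' := hA.lt_iff.2 hx
  have hy' := hA.lt_iff.2 hy
  rw [Nbr, Nbr, h.map x hx, h.map y hy, h.lt_iff hx hy, h.lt_iff hy hx', h.lt_iff hx' hy']

theorem cross_iff (h : Emb a A C e) (hA : IsMatching a A) (hx : x < 2 * a) (hy : y < 2 * a) :
    Cross C (e x) (e y) ↔ Cross A x y := by
  rw [Cross, Cross, h.nbr_iff hA hx hy, h.nbr_iff hA hy hx]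

theorem under_iff (h : Emb a A C e) (hA : IsMatching a A) (hx : x < 2 * a) (hy : y < 2 * a) :
    Under C (e x) (e y) ↔ Under A x y := by
  rw [Under, Under, h.map x hx, h.map y hy, h.lt_iff hy hx,
    h.lt_iff (hA.lt_iff.2 hx) (hA.lt_iff.2 hy)]

theorem reach (h : Emb a A C e) (hA : IsMatching a A) (hxy : Reach A P x y)
    (hPQ : ∀ z, P z → Q (e z)) : Reach C Q (e x) (e y) := by
  have hlt : ∀ z, z < A z → z < 2 * a := fun z hz => lt_trans hz (hA.sink_lt hz)
  induction hxy with
  | refl => exact .refl _ _ _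
  | tail h1 h2 ih =>
    exact ih.tail ((h.cross_iff hA (hlt _ h2.2.left) (hlt _ h2.2.right)).2 h2.2) (hPQ _ h2.1)

/-- Every gap of `C` corresponds to a gap of `A`. -/
theorem exists_gap (h : Emb a A C e) (y : ℕ) :
    ∃ u, u ≤ 2 * a ∧ ∀ x, x < 2 * a → (e x < y ↔ x < u) := by
  have hex : ∃ u, ∀ x, x < 2 * a → e x < y → x < u := ⟨2 * a, fun x hx _ => hx⟩
  refine ⟨Nat.find hex, Nat.find_min' hex fun x hx _ => hx, fun x hx => ⟨Nat.find_spec hex x hx,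
    fun hxu => ?_⟩⟩
  by_contra hy
  refine Nat.find_min hex hxu fun z hz hzy => ?_
  by_contra hxz
  rcases eq_or_lt_of_le (not_lt.1 hxz) with rfl | h1
  · exact hy hzy
  · have := h.mono _ _ h1 hz
    omega

theorem spans_iff (h : Emb a A C e) (hA : IsMatching a A)
    (hu : ∀ x, x < 2 * a → (e x < y ↔ x < u)) (hc : c < 2 * a) :
    Spans C (e c) y ↔ Spans A c u := by
  rw [Spans, Spans, h.map c hc, ← not_lt, ← not_lt, hu c hc, hu _ (hA.lt_iff.2 hc)]

theorem topFree (h : Emb a A C e) (hA : IsMatching a A) (hC : TopFree C) : TopFree A := by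
  intro p q r hpq hqr
  have hlt : ∀ z, z < A z → z < 2 * a := fun z hz => lt_trans hz (hA.sink_lt hz)
  have hp : p < 2 * a := hlt p (by simp only [Nbr] at hpq; omega)
  have hq : q < 2 * a := hlt q (by simp only [Nbr] at hpq; omega)
  have hr : r < 2 * a := hlt r (by simp only [Nbr] at hqr; omega)
  obtain ⟨y, h1, h2, h3⟩ := hC _ _ _ ((h.nbr_iff hA hp hq).2 hpq) ((h.nbr_iff hA hq hr).2 hqr)
  obtain ⟨u, -, hu⟩ := h.exists_gap y
  rw [h.map p hp, hu _ (hA.lt_iff.2 hp)] at h1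
  rw [← not_lt, hu _ hr, not_lt] at h2
  refine ⟨u, h1, h2, fun c hc1 hc2 => ?_⟩
  have hc : c < 2 * a := hlt c (by simp only [Spans] at hc2; omega)
  exact h3 (e c) ((h.under_iff hA hc hq).2 hc1) ((h.spans_iff hA hu hc).2 hc2)

end Emb

/-- The position of the points of `A` if `2 * b - 1` points are inserted at the gap `g`. -/
def embL (b g x : ℕ) : ℕ := if x < g then x else x + (2 * b - 1)

/-- The position of the points of `B` if all but the last one are inserted at the gap `g` of `A`,
and the last one is added at the end. -/
def embR (a b g x : ℕ) : ℕ := if x < 2 * b - 1 then g + x else 2 * (a + b) - 1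

/-- The diagram `C` arises by inserting all points of `B` but the last one at the gap `g` of `A`,
and adding the last point of `B` at the end. -/
structure IsGlue (a b g : ℕ) (A B C : ℕ → ℕ) : Prop where
  left : IsMatching a A
  right : IsMatching b B
  total : IsMatching (a + b) C
  one_le_right : 1 ≤ b
  one_le : 1 ≤ g
  lt : g < 2 * a
  mapL : ∀ x, x < 2 * a → C (embL b g x) = embL b g (A x)
  mapR : ∀ x, x < 2 * b → C (embR a b g x) = embR a b g (B x)

end Matching

namespace Matching.IsGlue

variable {a b g : ℕ} {A B C : ℕ → ℕ} {P Q : ℕ → Prop} {c d p q u x y z : ℕ}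

theorem embL_emb (h : IsGlue a b g A B C) : Emb a A C (embL b g) where
  mono x y hxy hy := by
    simp only [embL]
    split_ifs <;> omega
  map := h.mapL

theorem embR_emb (h : IsGlue a b g A B C) : Emb b B C (embR a b g) where
  mono x y hxy hy := by
    have := h.lt
    simp only [embR]
    split_ifs <;> omega
  map := h.mapR

theorem embL_lt (h : IsGlue a b g A B C) (hx : x < 2 * a) : embL b g x < 2 * (a + b) - 1 := by
  have := h.one_le_right
  simp only [embL]
  split_ifs <;> omega

theorem exists_emb (h : IsGlue a b g A B C) (hz : z < 2 * (a + b)) :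
    (∃ x, x < 2 * a ∧ embL b g x = z) ∨ ∃ x, x < 2 * b ∧ embR a b g x = z := by
  have h1 := h.one_le_right
  have h2 := h.lt
  by_cases h3 : z < g
  · exact .inl ⟨z, by omega, by simp [embL, h3]⟩
  by_cases h4 : z < g + (2 * b - 1)
  · refine .inr ⟨z - g, by omega, ?_⟩
    rw [embR, if_pos (by omega)]
    omega
  by_cases h5 : z < 2 * (a + b) - 1
  · refine .inl ⟨z - (2 * b - 1), by omega, ?_⟩
    rw [embL, if_neg (by omega)]
    omega
  · refine .inr ⟨2 * b - 1, by omega, ?_⟩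
    rw [embR, if_neg (by omega)]
    omega

theorem embL_ne_embR (h : IsGlue a b g A B C) (hx : x < 2 * a) (hy : y < 2 * b) :
    embL b g x ≠ embR a b g y := by
  have := h.one_le_right
  have := h.lt
  simp only [embL, embR]
  split_ifs <;> omega

theorem exists_chord (h : IsGlue a b g A B C) (hz : z < C z) :
    (∃ x, x < A x ∧ embL b g x = z) ∨ ∃ x, x < B x ∧ embR a b g x = z := by
  rcases h.exists_emb (lt_trans hz (h.total.sink_lt hz)) with ⟨x, hx, rfl⟩ | ⟨x, hx, rfl⟩
  · exact .inl ⟨x, (h.embL_emb.isChord_iff h.left hx).1 hz, rfl⟩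
  · exact .inr ⟨x, (h.embR_emb.isChord_iff h.right hx).1 hz, rfl⟩

theorem last_eq (h : IsGlue a b g A B C) : last (a + b) C = embR a b g (last b B) := by
  have h1 := h.mapR (2 * b - 1) (by have := h.one_le_right; omega)
  rwa [embR, if_neg (by omega)] at h1

theorem last_lt (h : IsGlue a b g A B C) : last b B < 2 * b - 1 := by
  have := h.right.last_isChord h.one_le_right
  rwa [h.right.sink_last] at this

theorem sink_lt_of_ne_last (h : IsGlue a b g A B C) (hy : y < B y) (hne : y ≠ last b B) :
    B y < 2 * b - 1 := by
  have h1 := h.right.sink_lt hy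
  have h2 : B y ≠ 2 * b - 1 := fun h3 => hne (h.right.eq_last_iff.2 h3)
  omega

/-- Only the last chord of `B` crosses chords of `A`, namely those that span the gap. -/
theorem cross_iff (h : IsGlue a b g A B C) (hx : x < A x) (hy : y < B y) :
    Cross C (embL b g x) (embR a b g y) ↔ y = last b B ∧ Spans A x g := by
  have hb := h.one_le_right
  have hg := h.lt
  have hAx := h.left.sink_lt hx
  have hBy := h.right.sink_lt hy
  have h1 := h.mapL x (by omega)
  have h2 := h.mapR y (by omega)
  rw [Cross, Nbr, Nbr, h1, h2, Spans]
  by_cases hyl : y = last b B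
  · have h3 : B y = 2 * b - 1 := by rw [hyl, h.right.sink_last]
    simp only [eq_true hyl, true_and, h3]
    simp only [embL, embR]
    split_ifs <;> omega
  · have h3 := h.sink_lt_of_ne_last hy hyl
    simp only [hyl, false_and, iff_false]
    simp only [embL, embR]
    split_ifs <;> omega

/-- A path from a chord of `B` to the last chord stays in `B` until it reaches the last chord. -/
theorem reach_right (h : IsGlue a b g A B C) (hx : x < B x)
    (hr : Reach C P (embR a b g x) (last (a + b) C)) (hPQ : ∀ z, P (embR a b g z) → Q z) :
    Reach B Q x (last b B) := by
  have key : ∀ z, Reach C P z (last (a + b) C) → ∀ x, x < B x → embR a b g x = z →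
      Reach B Q x (last b B) := by
    intro z hz
    induction hz using Relation.ReflTransGen.head_induction_on with
    | refl =>
      intro x hx hxz
      rw [h.last_eq, h.embR_emb.eq_iff (lt_trans hx (h.right.sink_lt hx))
        (by have := h.last_lt; omega)] at hxz
      exact hxz ▸ .refl _ _ _
    | @head z w hzw _ ih =>
      rintro x hx rfl
      rcases h.exists_chord hzw.2.right with ⟨y, hy, rfl⟩ | ⟨y, hy, rfl⟩
      · rw [((h.cross_iff hy hx).1 hzw.2.symm).1]
        exact .refl _ _ _
      · have := (h.embR_emb.cross_iff h.right (lt_trans hx (h.right.sink_lt hx))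
          (lt_trans hy (h.right.sink_lt hy))).1 hzw.2
        exact (Reach.single this (hPQ _ hzw.1)).trans (ih y hy rfl)
  exact key _ hr x hx rfl

/-- A path from a chord of `A` to the last chord leaves `A` at a chord that spans the gap. -/
theorem reach_left (h : IsGlue a b g A B C) (hx : x < A x)
    (hr : Reach C P (embL b g x) (last (a + b) C)) (hPQ : ∀ z, P (embL b g z) → Q z) :
    ∃ y, Reach A Q x y ∧ Spans A y g := by
  have key : ∀ z, Reach C P z (last (a + b) C) → ∀ x, x < A x → embL b g x = z →
      ∃ y, Reach A Q x y ∧ Spans A y g := by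
    intro z hz
    induction hz using Relation.ReflTransGen.head_induction_on with
    | refl =>
      intro x hx hxz
      rw [h.last_eq] at hxz
      exact (h.embL_ne_embR (lt_trans hx (h.left.sink_lt hx)) (by have := h.last_lt; omega)
        hxz).elim
    | @head z w hzw _ ih =>
      rintro x hx rfl
      rcases h.exists_chord hzw.2.right with ⟨y, hy, rfl⟩ | ⟨y, hy, rfl⟩
      · have := (h.embL_emb.cross_iff h.left (lt_trans hx (h.left.sink_lt hx))
          (lt_trans hy (h.left.sink_lt hy))).1 hzw.2
        obtain ⟨v, hv1, hv2⟩ := ih y hy rfl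
        exact ⟨v, (Reach.single this (hPQ _ hzw.1)).trans hv1, hv2⟩
      · exact ⟨x, .refl _ _ _, ((h.cross_iff hx hy).1 hzw.2).2⟩
  exact key _ hr x hx rfl

theorem embL_le_iff (h : IsGlue a b g A B C) (hx : x < 2 * a) (hy : y < 2 * a) :
    embL b g x ≤ embL b g y ↔ x ≤ y := by
  rw [← not_lt, ← not_lt, h.embL_emb.lt_iff hy hx]

theorem embR_le_iff (h : IsGlue a b g A B C) (hx : x < 2 * b) (hy : y < 2 * b) :
    embR a b g x ≤ embR a b g y ↔ x ≤ y := by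
  rw [← not_lt, ← not_lt, h.embR_emb.lt_iff hy hx]

theorem spine_right_iff (h : IsGlue a b g A B C) (hx : x < 2 * b) :
    Spine (a + b) C (embR a b g x) ↔ Spine b B x := by
  rw [Spine, Spine, h.embR_emb.isChord_iff h.right hx]
  refine and_congr_right fun hxc => ⟨fun hr => ?_, fun hr => ?_⟩
  · have h1 : Reach C (fun z => embR a b g x ≤ z ∧ z < C z) (embR a b g x) (last (a + b) C) := by
      refine hr.strengthen.mono fun z hz => ⟨hz.1, hz.2.isChord ?_⟩
      exact (h.embR_emb.isChord_iff h.right hx).2 hxc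
    refine h.reach_right hxc h1 fun z hz => ?_
    by_contra hzx
    have := h.embR_emb.mono z x (by omega) hx
    omega
  · rw [h.last_eq]
    have hr' : Reach B (fun z => x ≤ z ∧ z < B z) x (last b B) :=
      hr.strengthen.mono fun z hz => ⟨hz.1, hz.2.isChord hxc⟩
    refine h.embR_emb.reach h.right hr' fun z hz => ?_
    exact (h.embR_le_iff hx (lt_trans hz.2 (h.right.sink_lt hz.2))).2 hz.1

/-- The chords of `A` that belong to the spine of `C` are those of the spine of `A` that start
before the gap. A path in `A` to a chord that spans the gap is continued through `g` if the gap is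
before the source `g` of a chord of the spine of `A`. -/
theorem spine_left_iff (h : IsGlue a b g A B C) (hg : g = 2 * a - 1 ∨ Spine a A g)
    (hx : x < 2 * a) : Spine (a + b) C (embL b g x) ↔ Spine a A x ∧ x < g := by
  have ha : 1 ≤ a := by have := h.lt; omega
  have hsl := h.left.sink_last
  have hlc := h.left.last_isChord ha
  rw [Spine, Spine, h.embL_emb.isChord_iff h.left hx, and_assoc]
  refine and_congr_right fun hxc => ⟨fun hr => ?_, fun hr => ?_⟩
  · obtain ⟨p, hp1, hp2⟩ := h.reach_left (Q := (x ≤ ·)) hxc hr fun z hz => by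
      by_contra hzx
      have := h.embL_emb.mono z x (by omega) hx
      omega
    have hpc := hp1.isChord hxc
    have hxp : x ≤ p := hp1.prop (le_refl x)
    have hxg : x < g := by
      simp only [Spans] at hp2
      omega
    refine ⟨?_, hxg⟩
    by_cases hpl : p = last a A
    · rwa [← hpl]
    have hpA : A p < 2 * a - 1 := by
      have h1 := h.left.sink_lt hpc
      have h2 : A p ≠ 2 * a - 1 := fun h3 => hpl (h.left.eq_last_iff.2 h3)
      omega
    rcases hg with rfl | hg
    · simp only [Spans] at hp2
      omega
    · have hgr : Reach A (x ≤ ·) g (last a A) := hg.2.mono fun z hz => by omega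
      have hgc := hg.1
      have hpu : ¬ Under A (last a A) p := by
        simp only [Under]
        omega
      have hgp : Cross A p g ∨ Under A g p := by
        obtain ⟨e1, e2, e3⟩ := h.left.endpoints_ne hgc hpc (by simp only [Spans] at hp2; omega)
        simp only [Cross, Nbr, Under, Spans] at *
        omega
      rcases hgp with hgp | hgp
      · exact (hp1.tail hgp hxg.le).trans hgr
      · obtain ⟨z, hz1, hz2⟩ := h.left.exists_cross hpc hgr hgp hpu
        exact ((hp1.tail hz2 (hz1.prop hxg.le)).trans (hz1.symm hxg.le)).trans hgr
  · obtain ⟨hr, hxg⟩ := hr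
    obtain ⟨p, hp1, hp2⟩ := hr.exists_spans (u := g) hxg (by have := h.lt; omega)
    have hp1' : Reach A (fun z => x ≤ z ∧ z < A z) x p :=
      hp1.strengthen.mono fun z hz => ⟨hz.1, hz.2.isChord hxc⟩
    have h1 : Reach C (embL b g x ≤ ·) (embL b g x) (embL b g p) :=
      h.embL_emb.reach h.left hp1' fun z hz =>
        (h.embL_le_iff hx (lt_trans hz.2 (h.left.sink_lt hz.2))).2 hz.1
    rw [h.last_eq]
    refine h1.tail ((h.cross_iff (hp1.isChord hxc) (h.right.last_isChord h.one_le_right)).2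
      ⟨rfl, hp2⟩) ?_
    have := h.last_lt
    have := h.lt
    simp only [embL, embR]
    split_ifs
    omega

theorem conn (h : IsGlue a b g A B C) (hA : Conn a A) (hB : Conn b B) : Conn (a + b) C := by
  have hlc := h.right.last_isChord h.one_le_right
  have hrc := h.left.root_isChord hA.1
  obtain ⟨p, hp1, hp2⟩ := (hA.2 0 _ hrc (h.left.last_isChord hA.1)).exists_spans (u := g) h.one_le
    (by have := h.lt; rw [h.left.sink_last]; omega)
  have key : ∀ z, z < C z → Reach C (fun _ => True) (last (a + b) C) z := by
    intro z hz
    rcases h.exists_chord hz with ⟨x, hx, rfl⟩ | ⟨x, hx, rfl⟩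
    · have h1 : Reach C (fun _ => True) (last (a + b) C) (embL b g p) := by
        rw [h.last_eq]
        exact Reach.single ((h.cross_iff (hp1.isChord hrc) hlc).2 ⟨rfl, hp2⟩).symm trivial
      exact h1.trans (h.embL_emb.reach h.left (hA.2 _ _ (hp1.isChord hrc) hx)
        fun _ _ => trivial)
    · rw [h.last_eq]
      exact h.embR_emb.reach h.right (hB.2 _ _ hlc hx) fun _ _ => trivial
  exact ⟨by have := h.one_le_right; omega, fun c d hc hd =>
    ((key c hc).symm trivial).trans (key d hd)⟩

/-- The condition at the gap is that of `TopFree` at `p → q → r`, with `p` and `q` from `A`, for the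
last chord `r`. -/
theorem good_of_topFree (h : IsGlue a b g A B C) (hC : TopFree C) : Good A g := by
  intro p q hpq hq
  have hb := h.one_le_right
  have hg := h.lt
  have hpc : p < A p := by simp only [Nbr] at hpq; omega
  have hqc : q < A q := by simp only [Nbr] at hpq; omega
  have hpl := h.left.sink_lt hpc
  have hql := h.left.sink_lt hqc
  have hll := h.last_lt
  have h1 := (h.embL_emb.nbr_iff h.left (by omega) (by omega)).2 hpq
  have h2 : Nbr C (embL b g q) (embR a b g (last b B)) := by
    rcases (h.cross_iff hqc (h.right.last_isChord hb)).2 ⟨rfl, hq⟩ with h2 | h2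
    · exact h2
    · rw [← h.last_eq] at h2
      exact (h.total.not_nbr_last h2).elim
  obtain ⟨y, h3, h4, h5⟩ := hC _ _ _ h1 h2
  obtain ⟨u, hu1, hu2⟩ := h.embL_emb.exists_gap y
  rw [h.mapL p (by omega), hu2 _ hpl] at h3
  refine ⟨u, h3, ?_, fun c hc1 hc2 => ?_⟩
  · by_contra hgu
    have := (hu2 g hg).2 (by omega)
    simp only [embL, embR] at *
    split_ifs at * <;> omega
  · have hc : c < 2 * a := by
      have := h.left.sink_lt (c := c) (by simp only [Spans] at hc2; omega)
      simp only [Spans] at hc2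
      omega
    exact h5 _ ((h.embL_emb.under_iff h.left hc (by omega)).2 hc1)
      ((h.embL_emb.spans_iff h.left hu2 hc).2 hc2)

/-- A path `p → q → r` lies in `A` or in `B`, or `p` and `q` lie in `A` and `r` is the last chord.
-/
theorem topFree (h : IsGlue a b g A B C) (hA : TopFree A) (hB : TopFree B) (hG : Good A g) :
    TopFree C := by
  intro p q r hpq hqr
  have hb := h.one_le_right
  have hg := h.lt
  have hpc : p < C p := by simp only [Nbr] at hpq; omega
  have hqc : q < C q := by simp only [Nbr] at hpq; omega
  have hrc : r < C r := by simp only [Nbr] at hqr; omega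
  have hll := h.last_lt
  -- chords of `A` and `B` do not span gaps on the other side
  have hspR : ∀ v c, c < B c → c ≠ last b B → v ≤ 2 * a →
      ¬ Spans C (embR a b g c) (if v ≤ g then v else v + (2 * b - 1)) := by
    intro v c hc hcl hv hs
    have := h.sink_lt_of_ne_last hc hcl
    rw [Spans, h.mapR c (by omega)] at hs
    simp only [embR] at hs
    split_ifs at hs <;> omega
  have hgapL : ∀ v x, x < 2 * a →
      (embL b g x < (if v ≤ g then v else v + (2 * b - 1)) ↔ x < v) := by
    intro v x hx
    simp only [embL]
    split_ifs <;> omega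
  -- the condition for a gap of `A` that is regarded as a gap of `C`
  have hmainL : ∀ q' v, q' < A q' → (∀ c, Under A c q' → ¬ Spans A c v) → v ≤ 2 * a →
      ∀ c, Under C c (embL b g q') → ¬ Spans C c (if v ≤ g then v else v + (2 * b - 1)) := by
    intro q' v hq' hv hv2 c hc1 hc2
    have hql := h.left.sink_lt hq'
    rcases h.exists_chord (by simp only [Spans] at hc2; omega : c < C c) with
      ⟨x, hx, rfl⟩ | ⟨x, hx, rfl⟩
    · have := h.left.sink_lt hx
      exact hv x ((h.embL_emb.under_iff h.left (by omega) (by omega)).1 hc1)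
        ((h.embL_emb.spans_iff h.left (hgapL v) (by omega)).1 hc2)
    · refine hspR v x hx ?_ hv2 hc2
      rintro rfl
      rw [← h.last_eq, Under, h.total.sink_last, h.mapL _ (by omega)] at hc1
      have := h.embL_lt hql
      omega
  rcases h.exists_chord hqc with ⟨q', hq', rfl⟩ | ⟨q', hq', rfl⟩
  · have hql := h.left.sink_lt hq'
    rcases h.exists_chord hpc with ⟨p', hp', rfl⟩ | ⟨p', hp', rfl⟩
    swap
    · exfalso
      rw [((h.cross_iff hq' hp').1 (.inr hpq)).1, ← h.last_eq] at hpq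
      exact h.total.not_nbr_last hpq
    have hpl := h.left.sink_lt hp'
    rw [h.embL_emb.nbr_iff h.left (by omega) (by omega)] at hpq
    rcases h.exists_chord hrc with ⟨r', hr', rfl⟩ | ⟨r', hr', rfl⟩
    · have hrl := h.left.sink_lt hr'
      rw [h.embL_emb.nbr_iff h.left (by omega) (by omega)] at hqr
      obtain ⟨v, hv1, hv2, hv3⟩ := hA _ _ _ hpq hqr
      refine ⟨_, ?_, ?_, hmainL q' v hq' hv3 (by omega)⟩
      · rw [h.mapL _ (by omega), hgapL _ _ hpl]
        exact hv1
      · rw [← not_lt, hgapL _ _ (by omega)]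
        omega
    · have hcr := (h.cross_iff hq' hr').1 (.inl hqr)
      obtain ⟨v, hv1, hv2, hv3⟩ := hG _ _ hpq hcr.2
      refine ⟨_, ?_, ?_, hmainL q' v hq' hv3 (by omega)⟩
      · rw [h.mapL _ (by omega), hgapL _ _ hpl]
        exact hv1
      · rw [if_pos hv2, hcr.1, embR, if_pos hll]
        omega
  · have hql := h.right.sink_lt hq'
    have hqnl : q' ≠ last b B := by
      rintro rfl
      rw [← h.last_eq] at hqr
      exact h.total.not_nbr_last hqr
    have hq2 := h.sink_lt_of_ne_last hq' hqnl
    rcases h.exists_chord hpc with ⟨p', hp', rfl⟩ | ⟨p', hp', rfl⟩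
    · exact (hqnl ((h.cross_iff hp' hq').1 (.inl hpq)).1).elim
    rcases h.exists_chord hrc with ⟨r', hr', rfl⟩ | ⟨r', hr', rfl⟩
    · exact (hqnl ((h.cross_iff hr' hq').1 (.inr hqr)).1).elim
    have hpl := h.right.sink_lt hp'
    have hrl := h.right.sink_lt hr'
    rw [h.embR_emb.nbr_iff h.right (by omega) (by omega)] at hpq hqr
    obtain ⟨v, hv1, hv2, hv3⟩ := hB _ _ _ hpq hqr
    have hgap : ∀ x, x < 2 * b → (embR a b g x < g + v ↔ x < v) := by
      intro x hx
      have : v < 2 * b - 1 := by omega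
      simp only [embR]
      split_ifs <;> omega
    refine ⟨g + v, ?_, ?_, fun c hc1 hc2 => ?_⟩
    · rw [h.mapR _ (by omega), hgap _ hpl]
      exact hv1
    · rw [← not_lt, hgap _ (by omega)]
      omega
    · rcases h.exists_chord (by simp only [Spans] at hc2; omega : c < C c) with
        ⟨x, hx, rfl⟩ | ⟨x, hx, rfl⟩
      · have := h.left.sink_lt hx
        rw [Under, h.mapL _ (by omega), h.mapR _ (by omega)] at hc1
        simp only [embL, embR] at hc1
        split_ifs at hc1 <;> omega
      · have := h.right.sink_lt hx
        exact hv3 x ((h.embR_emb.under_iff h.right (by omega) (by omega)).1 hc1)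
          ((h.embR_emb.spans_iff h.right hgap (by omega)).1 hc2)

end Matching.IsGlue

namespace Matching

/-- The number of chords of the spine. -/
noncomputable def spineCount (n : ℕ) (m : ℕ → ℕ) : ℕ := Nat.count (Spine n m) (2 * n)

variable {a b g n a' b' g' : ℕ} {A B C A' B' : ℕ → ℕ} {P Q : ℕ → Prop} {c d p q u x y z : ℕ}

/-- The spine of `C` consists of the chords of the spine of `A` before the gap and the spine of `B`.
-/
theorem IsGlue.spineCount_eq (h : IsGlue a b g A B C) (hg : g = 2 * a - 1 ∨ Spine a A g) :
    spineCount (a + b) C = Nat.count (Spine a A) g + spineCount b B := by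
  have hlt := h.lt
  have hb := h.one_le_right
  rw [spineCount, spineCount, Nat.count_eq_card_filter_range, Nat.count_eq_card_filter_range,
    Nat.count_eq_card_filter_range]
  rw [show (Finset.range (2 * (a + b))).filter (Spine (a + b) C) =
    ((Finset.range g).filter (Spine a A)).image (embL b g) ∪
      ((Finset.range (2 * b)).filter (Spine b B)).image (embR a b g) from ?_,
    Finset.card_union_of_disjoint, Finset.card_image_of_injOn, Finset.card_image_of_injOn]
  · intro x hx y hy hxy
    simp only [Finset.coe_filter, Finset.mem_range, Set.mem_ofPred_eq] at hx hy
    exact (h.embR_emb.eq_iff hx.1 hy.1).1 hxy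
  · intro x hx y hy hxy
    simp only [Finset.coe_filter, Finset.mem_range, Set.mem_ofPred_eq] at hx hy
    exact (h.embL_emb.eq_iff (by omega) (by omega)).1 hxy
  · rw [Finset.disjoint_left]
    intro z hz hz'
    simp only [Finset.mem_image, Finset.mem_filter, Finset.mem_range] at hz hz'
    obtain ⟨x, hx, rfl⟩ := hz
    obtain ⟨y, hy, hxy⟩ := hz'
    exact h.embL_ne_embR (by omega) hy.1 hxy.symm
  · ext z
    simp only [Finset.mem_union, Finset.mem_image, Finset.mem_filter, Finset.mem_range]
    constructor
    · rintro ⟨hz, hzs⟩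
      rcases h.exists_emb hz with ⟨x, hx, rfl⟩ | ⟨x, hx, rfl⟩
      · have := (h.spine_left_iff hg hx).1 hzs
        exact .inl ⟨x, ⟨this.2, this.1⟩, rfl⟩
      · exact .inr ⟨x, ⟨hx, (h.spine_right_iff hx).1 hzs⟩, rfl⟩
    · rintro (⟨x, hx, rfl⟩ | ⟨x, hx, rfl⟩)
      · have := h.embL_lt (x := x) (by omega)
        exact ⟨by omega, (h.spine_left_iff hg (by omega)).2 ⟨hx.2, hx.1⟩⟩
      · refine ⟨?_, (h.spine_right_iff hx.1).2 hx.2⟩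
        simp only [embR]
        split_ifs <;> omega

theorem exists_isGlue (hA : IsMatching a A) (hB : IsMatching b B) (hb : 1 ≤ b) (hg1 : 1 ≤ g)
    (hg : g < 2 * a) : ∃ C, IsGlue a b g A B C := by
  let R : ℕ → ℕ → Prop := fun z w => (2 * (a + b) ≤ z ∧ w = z) ∨
    (∃ x, x < 2 * a ∧ embL b g x = z ∧ embL b g (A x) = w) ∨
    ∃ x, x < 2 * b ∧ embR a b g x = z ∧ embR a b g (B x) = w
  have hLR : ∀ x y, x < 2 * a → y < 2 * b → embL b g x ≠ embR a b g y := by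
    intro x y hx hy
    simp only [embL, embR]
    split_ifs <;> omega
  have hLlt : ∀ x, x < 2 * a → embL b g x < 2 * (a + b) := by
    intro x hx
    simp only [embL]
    split_ifs <;> omega
  have hRlt : ∀ x, x < 2 * b → embR a b g x < 2 * (a + b) := by
    intro x hx
    simp only [embR]
    split_ifs <;> omega
  have hLi : ∀ x y, x < 2 * a → y < 2 * a → embL b g x = embL b g y → x = y := by
    intro x y hx hy
    simp only [embL]
    split_ifs <;> omega
  have hRi : ∀ x y, x < 2 * b → y < 2 * b → embR a b g x = embR a b g y → x = y := by
    intro x y hx hy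
    simp only [embR]
    split_ifs <;> omega
  have hex : ∀ z, ∃ w, R z w := by
    intro z
    by_cases h2 : 2 * (a + b) ≤ z
    · exact ⟨z, .inl ⟨h2, rfl⟩⟩
    by_cases h3 : z < g
    · exact ⟨_, .inr (.inl ⟨z, by omega, by simp [embL, h3], rfl⟩)⟩
    by_cases h4 : z < g + (2 * b - 1)
    · refine ⟨_, .inr (.inr ⟨z - g, by omega, ?_, rfl⟩)⟩
      rw [embR, if_pos (by omega)]
      omega
    by_cases h5 : z < 2 * (a + b) - 1
    · refine ⟨_, .inr (.inl ⟨z - (2 * b - 1), by omega, ?_, rfl⟩)⟩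
      rw [embL, if_neg (by omega)]
      omega
    · refine ⟨_, .inr (.inr ⟨2 * b - 1, by omega, ?_, rfl⟩)⟩
      rw [embR, if_neg (by omega)]
      omega
  have huniq : ∀ z w w', R z w → R z w' → w = w' := by
    rintro z w w' (⟨h1, rfl⟩ | ⟨x, hx, rfl, rfl⟩ | ⟨x, hx, rfl, rfl⟩)
      (⟨h2, rfl⟩ | ⟨y, hy, h2, rfl⟩ | ⟨y, hy, h2, rfl⟩)
    · rfl
    · have := hLlt y hy
      omega
    · have := hRlt y hy
      omega
    · have := hLlt x hx
      omega
    · rw [hLi _ _ hx hy h2.symm]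
    · exact (hLR _ _ hx hy h2.symm).elim
    · have := hRlt x hx
      omega
    · exact (hLR _ _ hy hx h2).elim
    · rw [hRi _ _ hx hy h2.symm]
  have hsymm : ∀ z w, R z w → R w z := by
    rintro z w (⟨h1, rfl⟩ | ⟨x, hx, rfl, rfl⟩ | ⟨x, hx, rfl, rfl⟩)
    · exact .inl ⟨h1, rfl⟩
    · exact .inr (.inl ⟨A x, hA.lt_iff.2 hx, rfl, by rw [hA.invol]⟩)
    · exact .inr (.inr ⟨B x, hB.lt_iff.2 hx, rfl, by rw [hB.invol]⟩)
  choose C hC using hex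
  refine ⟨C, hA, hB, ⟨fun z => huniq _ _ _ (hC _) (hsymm _ _ (hC z)), fun z => ⟨fun hz => ?_,
    fun hz => huniq _ _ _ (hC z) (.inl ⟨hz, rfl⟩)⟩⟩, hb, hg1, hg,
    fun x hx => huniq _ _ _ (hC _) (.inr (.inl ⟨x, hx, rfl, rfl⟩)),
    fun x hx => huniq _ _ _ (hC _) (.inr (.inr ⟨x, hx, rfl, rfl⟩))⟩
  rcases hC z with ⟨h1, -⟩ | ⟨x, hx, h1, h2⟩ | ⟨x, hx, h1, h2⟩
  · exact h1
  · exact (hA.ne hx (hLi _ _ (hA.lt_iff.2 hx) hx (by rw [h1, h2, hz]))).elim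
  · exact (hB.ne hx (hRi _ _ (hB.lt_iff.2 hx) hx (by rw [h1, h2, hz]))).elim

/-! ### Splitting off the component of the root -/

/-- The point `z` belongs to the connected component of the root after removing the chord with the
last sink. -/
def InFirst (n : ℕ) (C : ℕ → ℕ) (z : ℕ) : Prop := Reach C (· ≠ last n C) 0 (min z (C z))

theorem IsGlue.inFirst_iff (h : IsGlue a b g A B C) (hA : Conn a A) (hz : z < 2 * (a + b)) :
    InFirst (a + b) C z ↔ ∃ x, x < 2 * a ∧ embL b g x = z := by
  have hrc := h.left.root_isChord hA.1
  have h0 : embL b g 0 = 0 := by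
    have := h.one_le
    rw [embL, if_pos (by omega)]
  have hmin : ∀ x, x < 2 * a → min (embL b g x) (C (embL b g x)) = embL b g (min x (A x)) := by
    intro x hx
    have hAx := h.left.lt_iff.2 hx
    rw [h.mapL x hx]
    rcases le_total x (A x) with h1 | h1
    · rw [Nat.min_eq_left h1, Nat.min_eq_left ((h.embL_le_iff hx hAx).2 h1)]
    · rw [Nat.min_eq_right h1, Nat.min_eq_right ((h.embL_le_iff hAx hx).2 h1)]
  constructor
  · intro hr
    have key : ∀ w, Reach C (· ≠ last (a + b) C) 0 w → ∃ x, x < A x ∧ embL b g x = w := by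
      intro w hw
      induction hw with
      | refl => exact ⟨0, hrc, h0⟩
      | tail _ h2 ih =>
        obtain ⟨x, hx, rfl⟩ := ih
        rcases h.exists_chord h2.2.right with ⟨y, hy, rfl⟩ | ⟨y, hy, rfl⟩
        · exact ⟨y, hy, rfl⟩
        · refine (h2.1 ?_).elim
          rw [((h.cross_iff hx hy).1 h2.2).1, h.last_eq]
    obtain ⟨x, hx, hxz⟩ := key _ hr
    have := h.left.sink_lt hx
    rcases min_choice z (C z) with h1 | h1
    · exact ⟨x, by omega, by rw [hxz, h1]⟩
    · refine ⟨A x, by omega, ?_⟩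
      rw [← h.mapL _ (by omega), hxz, h1, h.total.invol]
  · rintro ⟨x, hx, rfl⟩
    rw [InFirst, hmin x hx, ← h0]
    have h1 : min x (A x) < A (min x (A x)) := by
      have h1 := h.left.ne hx
      have h2 := h.left.invol x
      rcases min_choice x (A x) with h3 | h3 <;> rw [h3] <;> omega
    have h2 : Reach A (fun z => z < 2 * a) 0 (min x (A x)) := by
      refine (hA.2 _ _ hrc h1).strengthen.mono fun z hz => ?_
      exact lt_trans (hz.2.isChord hrc) (h.left.sink_lt (hz.2.isChord hrc))
    refine h.embL_emb.reach h.left h2 fun z hz => ?_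
    rw [h.last_eq]
    exact h.embL_ne_embR hz (by have := h.last_lt; omega)

/-- A matching is restricted to an invariant set of points, listed by the increasing map `e`. -/
theorem exists_restrict (h : IsMatching n C) {e : ℕ → ℕ}
    (mono : ∀ x y, x < y → y < 2 * a → e x < e y)
    (hlt : ∀ x, x < 2 * a → e x < 2 * n) (hinv : ∀ x, x < 2 * a → ∃ y, y < 2 * a ∧ C (e x) = e y) :
    ∃ A, IsMatching a A ∧ ∀ x, x < 2 * a → C (e x) = e (A x) := by
  have inj : ∀ x y, x < 2 * a → y < 2 * a → e x = e y → x = y := by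
    intro x y hx hy hxy
    rcases lt_trichotomy x y with h1 | h1 | h1
    · have := mono _ _ h1 hy
      omega
    · exact h1
    · have := mono _ _ h1 hx
      omega
  have hex : ∀ x, ∃ y, (2 * a ≤ x ∧ y = x) ∨ (x < 2 * a ∧ y < 2 * a ∧ C (e x) = e y) := by
    intro x
    by_cases hx : x < 2 * a
    · obtain ⟨y, hy, hxy⟩ := hinv x hx
      exact ⟨y, .inr ⟨hx, hy, hxy⟩⟩
    · exact ⟨x, .inl ⟨by omega, rfl⟩⟩
  choose A hA using hex
  have hA1 : ∀ x, x < 2 * a → A x < 2 * a ∧ C (e x) = e (A x) := by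
    intro x hx
    rcases hA x with h1 | h1
    · omega
    · exact h1.2
  have hA2 : ∀ x, 2 * a ≤ x → A x = x := by
    intro x hx
    rcases hA x with h1 | h1
    · exact h1.2
    · omega
  refine ⟨A, ⟨fun x => ?_, fun x => ⟨fun hx => ?_, hA2 x⟩⟩, fun x hx => (hA1 x hx).2⟩
  · by_cases hx : x < 2 * a
    · obtain ⟨h1, h2⟩ := hA1 x hx
      obtain ⟨h3, h4⟩ := hA1 _ h1
      exact inj _ _ h3 hx (by rw [← h4, ← h2, h.invol])
    · rw [hA2 x (by omega), hA2 x (by omega)]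
  · by_contra h1
    obtain ⟨-, h3⟩ := hA1 x (by omega)
    rw [hx] at h3
    exact h.ne (hlt x (by omega)) h3

theorem even_card_of_invol (h : IsMatching n C) {s : Finset ℕ} (hs : ∀ x ∈ s, x < 2 * n ∧ C x ∈ s) :
    Even s.card := by
  rw [← ZMod.natCast_eq_zero_iff_even, Finset.card_eq_sum_ones, Nat.cast_sum]
  refine Finset.sum_involution (fun x _ => C x) (fun x hx => by decide)
    (fun x hx _ => h.ne (hs x hx).1) (fun x hx => (hs x hx).2) fun x hx => h.invol x

end Matching

namespace IsMatching

open Matching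

variable {n : ℕ} {C : ℕ → ℕ}

/-- Every connected diagram with at least two chords is composed of two connected diagrams.  The
first one is the component of the root after removing the chord with the last sink. -/
theorem exists_isGlue (h : IsMatching n C) (hc : Conn n C) (hn : 2 ≤ n) :
    ∃ a b g A B, a + b = n ∧ IsGlue a b g A B C ∧ Conn a A ∧ Conn b B := by
  have htl := h.sink_last
  have htc := h.last_isChord hc.1
  have hrc := h.root_isChord hc.1
  set t := last n C with ht
  have hchord : ∀ z, z < 2 * n → min z (C z) < C (min z (C z)) := by
    intro z hz
    have h1 := h.ne hz
    have h2 := h.invol z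
    rcases min_choice z (C z) with h3 | h3 <;> rw [h3] <;> omega
  have hends : ∀ z, z = min z (C z) ∨ z = C (min z (C z)) := by
    intro z
    rcases min_choice z (C z) with h3 | h3 <;> rw [h3]
    · exact .inl rfl
    · exact .inr (h.invol z).symm
  have h0t : 0 ≠ t := by
    intro h0
    have h1 : C 1 ≠ 0 := by
      intro h1
      have := h.invol 1
      rw [h1] at this
      rw [← h0, this] at htl
      omega
    have h2 := h.ne (x := 1) (by omega)
    obtain ⟨e, he, -⟩ := (hc.2 0 1 hrc (by omega)).exists_last (by omega)
    rcases he with he | he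
    · rw [h0, ht] at he
      exact h.not_nbr_last he
    · exact absurd he.1 (by omega)
  -- every chord is connected to one that crosses the last chord, after removing the last chord
  have hcross : ∀ k, k < C k → k ≠ t → ∃ a, Reach C (· ≠ t) k a ∧ Nbr C a t := by
    intro k hk hkt
    obtain ⟨a, b, h1, h2, -, h3⟩ := (hc.2 k t hk htc).exists_exit (P := (· ≠ t))
      fun h1 => h1.prop hkt rfl
    rw [not_not] at h3
    subst h3
    refine ⟨a, h1, ?_⟩
    rcases h2 with h2 | h2
    · exact h2
    · exact (h.not_nbr_last h2).elim
  let F : ℕ → Prop := InFirst n C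
  have hF0 : F 0 := by
    change Reach C _ 0 (min 0 (C 0))
    rw [min_eq_left hrc.le]
    exact .refl _ _ _
  have hFt : ¬ F t := by
    intro h1
    change Reach C _ 0 (min t (C t)) at h1
    rw [min_eq_left htc.le] at h1
    exact h1.prop h0t rfl
  have hFC : ∀ z, F (C z) ↔ F z := by
    intro z
    change Reach C _ 0 _ ↔ Reach C _ 0 _
    rw [h.invol, min_comm]
  have hFlast : ¬ F (2 * n - 1) := by
    rw [← htl, hFC]
    exact hFt
  have hFchord : ∀ k, k < C k → (F k ↔ Reach C (· ≠ t) 0 k) := by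
    intro k hk
    change Reach C _ 0 _ ↔ _
    rw [min_eq_left hk.le]
  -- the component of the root lies on one side of every other point together with the last chord
  have hsep : ∀ z y, z < 2 * n - 1 → ¬ F z → F y → y < 2 * n → ¬ (z < y ∧ y < t) ∧
      ¬ (t < y ∧ y < z) := by
    intro z y hz hFz hFy hy
    rw [← not_or]
    intro hcon
    have hkc := hchord z (by omega)
    have hkt : min z (C z) ≠ t := by
      intro h1
      rcases hends z with h2 | h2
      · omega
      · rw [h1] at h2
        omega
    obtain ⟨c, hc1, hc2⟩ := hcross _ hkc hkt
    have hnc : ∀ a k, Reach C (· ≠ t) 0 a → Reach C (· ≠ t) (min z (C z)) k →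
        ¬ (a = k ∨ Cross C a k) := by
      intro a k ha hk hak
      apply hFz
      have h1 : Reach C (· ≠ t) 0 k := by
        rcases hak with rfl | hak
        · exact ha
        · exact ha.tail hak (hk.prop hkt)
      exact h1.trans (hk.symm hkt)
    have hc0 : 0 < c := by
      rcases Nat.eq_zero_or_pos c with rfl | h1
      · exact (hnc 0 0 (.refl _ _ _) hc1 (.inl rfl)).elim
      · exact h1
    have hz0 : 0 < z := by
      rcases Nat.eq_zero_or_pos z with rfl | h1
      · exact (hFz hF0).elim
      · exact h1
    obtain ⟨q1, q2, q3⟩ := hc2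
    rcases hcon with hcon | hcon
    · obtain ⟨a, k, h1, h2, h3⟩ := h.exists_eq_or_cross (κ' := C c) hFy hc1 hrc hkc (hends y)
        (hends z) (.inr rfl) hz0 hcon.1 (by omega)
      exact hnc a k h1 h2 h3
    · obtain ⟨a, k, h1, h2, h3⟩ := h.exists_eq_or_cross (κ := c) hFy (hc1.symm hkt) hrc
        (hc1.isChord hkc) (hends y) (.inl rfl) (hends z) hc0 (by omega) hcon.2
      exact hnc a k h1 (hc1.trans h2) h3
  -- the points outside the component of the root form an interval and the last point
  have hexg : ∃ z, ¬ F z := ⟨t, hFt⟩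
  obtain ⟨hg1, hg2⟩ : ¬ F (Nat.find hexg) ∧ ∀ z, z < Nat.find hexg → F z :=
    ⟨Nat.find_spec hexg, fun z hz => not_not.1 (Nat.find_min hexg hz)⟩
  have hgt : Nat.find hexg ≤ t := Nat.find_min' hexg hFt
  generalize Nat.find hexg = g at hg1 hg2 hgt
  have hexg' : ∃ w, t < w ∧ ∀ z, w ≤ z → z < 2 * n - 1 → F z := ⟨2 * n - 1, by omega, by omega⟩
  obtain ⟨⟨hw1, hw2⟩, hw3⟩ : (t < Nat.find hexg' ∧ ∀ z, Nat.find hexg' ≤ z → z < 2 * n - 1 → F z) ∧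
      ∀ w, w < Nat.find hexg' → ¬ (t < w ∧ ∀ z, w ≤ z → z < 2 * n - 1 → F z) :=
    ⟨Nat.find_spec hexg', fun w hw => Nat.find_min hexg' hw⟩
  generalize Nat.find hexg' = w at hw1 hw2 hw3
  have hmid : ∀ z, g ≤ z → z < w → ¬ F z := by
    intro z hz1 hz2 hFz
    have hzt : z ≠ t := by
      rintro rfl
      exact hFt hFz
    have hzg : z ≠ g := by
      rintro rfl
      exact hg1 hFz
    rcases lt_or_gt_of_ne hzt with h1 | h1
    · exact (hsep g z (by omega) hg1 hFz (by omega)).1 ⟨by omega, h1⟩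
    · refine hw3 z hz2 ⟨h1, fun y hy1 hy2 => ?_⟩
      by_contra hFy
      have hyz : y ≠ z := by
        rintro rfl
        exact hFy hFz
      exact (hsep y z hy2 hFy hFz (by omega)).2 ⟨h1, by omega⟩
  have hg0 : 1 ≤ g := by
    by_contra h1
    obtain rfl : g = 0 := by omega
    exact hg1 hF0
  obtain ⟨p, hp1, hp2⟩ := hcross 0 hrc h0t
  have hFp : F (C p) := (hFC p).2 ((hFchord p (hp1.isChord hrc)).2 hp1)
  have hwlt : w < 2 * n - 1 := by
    have h1 := hmid (C p) (by have := hp2.2.1; omega)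
    have h2 := hp2.2
    rw [htl] at h2
    by_contra h3
    exact h1 (by omega) hFp
  have hFiff : ∀ z, z < 2 * n → (F z ↔ z < g ∨ w ≤ z ∧ z < 2 * n - 1) := by
    intro z hz
    constructor
    · intro h1
      by_contra h2
      by_cases h3 : z < w
      · exact hmid z (by omega) h3 h1
      · obtain rfl : z = 2 * n - 1 := by omega
        exact hFlast h1
    · rintro (h1 | h1)
      · exact hg2 z h1
      · exact hw2 z h1.1 h1.2
  -- so the number of points to be inserted is odd, as it has to be
  have hev : Even (w - g + 1) := by
    have h1 := even_card_of_invol h (s := insert (2 * n - 1) (Finset.Ico g w)) (by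
      intro x hx
      have hx1 : x < 2 * n := by
        simp only [Finset.mem_insert, Finset.mem_Ico] at hx
        omega
      have hx2 : ¬ F x := by
        rw [hFiff x hx1]
        simp only [Finset.mem_insert, Finset.mem_Ico] at hx
        omega
      have hx3 := h.lt_iff.2 hx1
      rw [← hFC, hFiff _ hx3] at hx2
      refine ⟨hx1, ?_⟩
      simp only [Finset.mem_insert, Finset.mem_Ico]
      omega)
    rwa [Finset.card_insert_of_notMem (by simp only [Finset.mem_Ico]; omega), Nat.card_Ico] at h1
  obtain ⟨b, hb⟩ := hev
  obtain ⟨a, rfl⟩ : ∃ a, n = a + b := ⟨n - b, by omega⟩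
  have hFL : ∀ z, z < 2 * (a + b) → (F z ↔ ∃ x, x < 2 * a ∧ z = embL b g x) := by
    intro z hz
    rw [hFiff z hz]
    constructor
    · rintro (h1 | h1)
      · exact ⟨z, by omega, by rw [embL, if_pos h1]⟩
      · exact ⟨z - (2 * b - 1), by omega, by rw [embL, if_neg (by omega)]; omega⟩
    · rintro ⟨x, hx, rfl⟩
      simp only [embL]
      split_ifs <;> omega
  have hFR : ∀ z, z < 2 * (a + b) → (¬ F z ↔ ∃ x, x < 2 * b ∧ z = embR a b g x) := by
    intro z hz
    rw [hFiff z hz]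
    constructor
    · intro h1
      by_cases h2 : z < w
      · exact ⟨z - g, by omega, by rw [embR, if_pos (by omega)]; omega⟩
      · exact ⟨2 * b - 1, by omega, by rw [embR, if_neg (by omega)]; omega⟩
    · rintro ⟨x, hx, rfl⟩
      simp only [embR]
      split_ifs <;> omega
  have hLlt : ∀ x, x < 2 * a → embL b g x < 2 * (a + b) := by
    intro x hx
    simp only [embL]
    split_ifs <;> omega
  have hRlt : ∀ x, x < 2 * b → embR a b g x < 2 * (a + b) := by
    intro x hx
    simp only [embR]
    split_ifs <;> omega
  obtain ⟨A, hA, hAC⟩ := exists_restrict (a := a) h (e := embL b g) (fun x y hxy hy => by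
    simp only [embL]
    split_ifs <;> omega) hLlt fun x hx =>
      (hFL _ (h.lt_iff.2 (hLlt x hx))).1 ((hFC _).2 ((hFL _ (hLlt x hx)).2 ⟨x, hx, rfl⟩))
  obtain ⟨B, hB, hBC⟩ := exists_restrict (a := b) h (e := embR a b g) (fun x y hxy hy => by
    simp only [embR]
    split_ifs <;> omega) hRlt fun x hx =>
      (hFR _ (h.lt_iff.2 (hRlt x hx))).1 (by rw [hFC]; exact (hFR _ (hRlt x hx)).2 ⟨x, hx, rfl⟩)
  have hG : IsGlue a b g A B C := ⟨hA, hB, h, by omega, hg0, by omega, hAC, hBC⟩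
  have hArc := hA.root_isChord (by omega)
  have hBlc := hB.last_isChord (by omega)
  have keyA : ∀ x, x < A x → Reach A (fun _ => True) 0 x := by
    have key : ∀ z, Reach C (· ≠ t) 0 z → ∃ x, x < A x ∧ embL b g x = z ∧
        Reach A (fun _ => True) 0 x := by
      intro z hz
      induction hz with
      | refl => exact ⟨0, hArc, by rw [embL, if_pos (by omega)], .refl _ _ _⟩
      | tail _ h2 ih =>
        obtain ⟨x, hx, rfl, hr⟩ := ih
        rcases hG.exists_chord h2.2.right with ⟨y, hy, rfl⟩ | ⟨y, hy, rfl⟩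
        · have h3 := (hG.embL_emb.cross_iff hA (lt_trans hx (hA.sink_lt hx))
            (lt_trans hy (hA.sink_lt hy))).1 h2.2
          exact ⟨y, hy, rfl, hr.tail h3 trivial⟩
        · refine (h2.1 ?_).elim
          rw [((hG.cross_iff hx hy).1 h2.2).1, ← hG.last_eq]
    intro x hx
    have hx2 := lt_trans hx (hA.sink_lt hx)
    obtain ⟨y, hy, hyx, hr⟩ := key _ ((hFchord _ ((hG.embL_emb.isChord_iff hA hx2).2 hx)).1
      ((hFL _ (hLlt x hx2)).2 ⟨x, hx2, rfl⟩))
    rwa [(hG.embL_emb.eq_iff (lt_trans hy (hA.sink_lt hy)) hx2).1 hyx] at hr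
  have keyB : ∀ x, x < B x → Reach B (fun _ => True) x (last b B) := by
    intro x hx
    have hx2 := lt_trans hx (hB.sink_lt hx)
    exact hG.reach_right hx (hc.2 _ _ ((hG.embR_emb.isChord_iff hB hx2).2 hx) htc)
      fun _ _ => trivial
  exact ⟨a, b, g, A, B, rfl, hG, ⟨by omega, fun x y hx hy => ((keyA x hx).symm trivial).trans
    (keyA y hy)⟩, ⟨by omega, fun x y hx hy => (keyB x hx).trans ((keyB y hy).symm trivial)⟩⟩

/-- Two matchings that embed into a third one in the same way are equal. -/
theorem eq_of_emb {a : ℕ} {A A' e : ℕ → ℕ} (hA : IsMatching a A) (hA' : IsMatching a A')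
    (h : Emb a A C e) (h' : Emb a A' C e) : A = A' := by
  funext x
  by_cases hx : x < 2 * a
  · refine (h.eq_iff (hA.lt_iff.2 hx) (hA'.lt_iff.2 hx)).1 ?_
    rw [← h.map x hx, h'.map x hx]
  · rw [(hA.eq_self_iff x).2 (by omega), (hA'.eq_self_iff x).2 (by omega)]

end IsMatching

namespace Matching.IsGlue

variable {a b g n a' b' g' : ℕ} {A B C C' A' B' : ℕ → ℕ} {x z : ℕ}

theorem total_unique (h : IsGlue a b g A B C) (h' : IsGlue a b g A B C') : C = C' := by
  funext z
  by_cases hz : z < 2 * (a + b)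
  · rcases h.exists_emb hz with ⟨x, hx, rfl⟩ | ⟨x, hx, rfl⟩
    · rw [h.mapL x hx, h'.mapL x hx]
    · rw [h.mapR x hx, h'.mapR x hx]
  · rw [(h.total.eq_self_iff z).2 (by omega), (h'.total.eq_self_iff z).2 (by omega)]

/-- The left part is the component of the root, by `inFirst_iff`, and this determines everything. -/
theorem unique (h : IsGlue a b g A B C) (h' : IsGlue a' b' g' A' B' C) (hn : a + b = a' + b')
    (hA : Conn a A) (hA' : Conn a' A') : a = a' ∧ b = b' ∧ g = g' ∧ A = A' ∧ B = B' := by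
  have key : ∀ z, z < 2 * (a + b) →
      ((∃ x, x < 2 * a ∧ embL b g x = z) ↔ ∃ x, x < 2 * a' ∧ embL b' g' x = z) := by
    intro z hz
    rw [← h.inFirst_iff hA hz, ← h'.inFirst_iff hA' (by omega), hn]
  have hval : ∀ z, (∃ x, x < 2 * a ∧ embL b g x = z) ↔
      z < g ∨ (g + (2 * b - 1) ≤ z ∧ z < 2 * (a + b) - 1) := by
    have h1 := h.lt
    have h2 := h.one_le_right
    intro z
    constructor
    · rintro ⟨x, hx, rfl⟩
      simp only [embL]
      split_ifs <;> omega
    · rintro (h3 | h3)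
      · exact ⟨z, by omega, by rw [embL, if_pos h3]⟩
      · exact ⟨z - (2 * b - 1), by omega, by rw [embL, if_neg (by omega)]; omega⟩
  have hval' : ∀ z, (∃ x, x < 2 * a' ∧ embL b' g' x = z) ↔
      z < g' ∨ (g' + (2 * b' - 1) ≤ z ∧ z < 2 * (a' + b') - 1) := by
    have h1 := h'.lt
    have h2 := h'.one_le_right
    intro z
    constructor
    · rintro ⟨x, hx, rfl⟩
      simp only [embL]
      split_ifs <;> omega
    · rintro (h3 | h3)
      · exact ⟨z, by omega, by rw [embL, if_pos h3]⟩
      · exact ⟨z - (2 * b' - 1), by omega, by rw [embL, if_neg (by omega)]; omega⟩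
  simp only [hval, hval'] at key
  have q1 := h.lt
  have q2 := h'.lt
  have q3 := h.one_le_right
  have q4 := h'.one_le_right
  obtain rfl : g = g' := by
    have k1 := key g (by omega)
    have k2 := key g' (by omega)
    omega
  obtain rfl : b = b' := by
    have k1 := key (g + (2 * b - 1)) (by omega)
    have k2 := key (g + (2 * b' - 1)) (by omega)
    omega
  obtain rfl : a = a' := by omega
  exact ⟨rfl, rfl, rfl, h.left.eq_of_emb h'.left h.embL_emb h'.embL_emb,
    h.right.eq_of_emb h'.right h.embR_emb h'.embR_emb⟩

end Matching.IsGlue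

/-! ### Chord diagrams as matchings of natural numbers -/

namespace ChordDiagram

open Matching

variable {n k : ℕ}

/-- The matching of a chord diagram, extended by the identity. -/
def toNat (C : ChordDiagram n) (x : ℕ) : ℕ := if h : x < 2 * n then C.mate ⟨x, h⟩ else x

theorem toNat_coe (C : ChordDiagram n) (x : Fin (2 * n)) : C.toNat x = C.mate x := by
  simp [toNat]

theorem isMatching_toNat (C : ChordDiagram n) : IsMatching n C.toNat where
  invol x := by
    by_cases h : x < 2 * n
    · obtain ⟨x, rfl⟩ : ∃ y : Fin (2 * n), (y : ℕ) = x := ⟨⟨x, h⟩, rfl⟩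
      rw [toNat_coe, toNat_coe, C.mate_mate]
    · rw [toNat, toNat, dif_neg h, dif_neg h]
  eq_self_iff x := by
    by_cases h : x < 2 * n
    · obtain ⟨x, rfl⟩ : ∃ y : Fin (2 * n), (y : ℕ) = x := ⟨⟨x, h⟩, rfl⟩
      rw [toNat_coe, Fin.val_inj]
      simp only [C.mate_ne, false_iff]
      omega
    · rw [toNat, dif_neg h]
      simp only [true_iff]
      omega

theorem toNat_injective {C D : ChordDiagram n} (h : C.toNat = D.toNat) : C = D := by
  have : C.mate = D.mate := by
    funext x
    rw [← Fin.val_inj, ← toNat_coe, ← toNat_coe, h]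
  cases C
  cases D
  simp_all

theorem exists_toNat_eq {m : ℕ → ℕ} (h : IsMatching n m) : ∃ C : ChordDiagram n, C.toNat = m := by
  refine ⟨⟨fun x => ⟨m x, h.lt_iff.2 x.2⟩, fun x => Fin.ext (h.invol x), fun x hx =>
    h.ne x.2 (congrArg Fin.val hx)⟩, ?_⟩
  funext x
  rw [toNat]
  split_ifs with hx
  · rfl
  · exact ((h.eq_self_iff x).2 (by omega)).symm

theorem chord_lt (C : ChordDiagram n) (c : C.Chord) : (c.1 : ℕ) < C.toNat c.1 := by
  rw [toNat_coe]
  exact c.2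

theorem exists_chord (C : ChordDiagram n) {x : ℕ} (hx : x < C.toNat x) :
    ∃ c : C.Chord, (c.1 : ℕ) = x := by
  have h1 := lt_trans hx (C.isMatching_toNat.sink_lt hx)
  refine ⟨⟨⟨x, h1⟩, ?_⟩, rfl⟩
  rw [Fin.lt_def, ← toNat_coe]
  exact hx

theorem chord_ext {C : ChordDiagram n} {c d : C.Chord} (h : (c.1 : ℕ) = d.1) : c = d :=
  Subtype.ext (Fin.ext h)

theorem rightNbr_iff (C : ChordDiagram n) (c d : C.Chord) :
    C.RightNbr c d ↔ Nbr C.toNat c.1 d.1 := by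
  rw [RightNbr, Nbr, toNat_coe, toNat_coe]
  exact Iff.rfl

theorem adj_iff (C : ChordDiagram n) (c d : C.Chord) :
    C.graph.Adj c d ↔ Cross C.toNat c.1 d.1 := by
  rw [graph, SimpleGraph.fromRel_adj, rightNbr_iff, rightNbr_iff]
  refine ⟨fun h => h.2, fun h => ⟨?_, h⟩⟩
  rintro rfl
  rcases h with h | h <;> exact lt_irrefl _ h.1

theorem connected_iff (C : ChordDiagram n) : C.graph.Connected ↔ Conn n C.toNat := by
  constructor
  · intro h
    obtain ⟨c⟩ := h.nonempty
    refine ⟨by have := c.1.2; omega, fun x y hx hy => ?_⟩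
    obtain ⟨c, rfl⟩ := C.exists_chord hx
    obtain ⟨d, rfl⟩ := C.exists_chord hy
    have := (SimpleGraph.reachable_iff_reflTransGen c d).1 (h.preconnected c d)
    clear hx hy
    induction this with
    | refl => exact .refl _ _ _
    | tail _ h2 ih => exact ih.tail ((C.adj_iff _ _).1 h2) trivial
  · intro h
    obtain ⟨c, -⟩ := C.exists_chord (C.isMatching_toNat.root_isChord h.1)
    have : Nonempty C.Chord := ⟨c⟩
    refine ⟨fun c d => ?_⟩
    have key : ∀ x, Reach C.toNat (fun _ => True) c.1 x → ∃ d : C.Chord, (d.1 : ℕ) = x ∧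
        C.graph.Reachable c d := by
      intro x hx
      induction hx with
      | refl => exact ⟨c, rfl, .refl _⟩
      | tail _ h2 ih =>
        obtain ⟨d, rfl, hd⟩ := ih
        obtain ⟨e, rfl⟩ := C.exists_chord h2.2.right
        exact ⟨e, rfl, hd.trans ((C.adj_iff _ _).2 h2.2).reachable⟩
    obtain ⟨e, he, hr⟩ := key d.1 (h.2 _ _ (C.chord_lt c) (C.chord_lt d))
    rwa [chord_ext he] at hr

/-- The position map of an embedding, extended by the identity. -/
def Embedding.toNat {D : ChordDiagram k} {C : ChordDiagram n} (e : D.Embedding C) (x : ℕ) : ℕ :=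
  if h : x < 2 * k then e.toFun ⟨x, h⟩ else x

theorem Embedding.toNat_coe {D : ChordDiagram k} {C : ChordDiagram n} (e : D.Embedding C)
    (x : Fin (2 * k)) : e.toNat x = e.toFun x := by
  simp [Embedding.toNat]

theorem Embedding.emb {D : ChordDiagram k} {C : ChordDiagram n} (e : D.Embedding C) :
    Emb k D.toNat C.toNat e.toNat where
  mono x y hxy hy := by
    obtain ⟨x, rfl⟩ : ∃ z : Fin (2 * k), (z : ℕ) = x := ⟨⟨x, by omega⟩, rfl⟩
    obtain ⟨y, rfl⟩ : ∃ z : Fin (2 * k), (z : ℕ) = y := ⟨⟨y, by omega⟩, rfl⟩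
    rw [e.toNat_coe, e.toNat_coe]
    exact e.toFun.strictMono hxy
  map x hx := by
    obtain ⟨x, rfl⟩ : ∃ z : Fin (2 * k), (z : ℕ) = x := ⟨⟨x, by omega⟩, rfl⟩
    rw [e.toNat_coe, ChordDiagram.toNat_coe, ChordDiagram.toNat_coe, e.toNat_coe, e.map_mate]

theorem exists_embedding {D : ChordDiagram k} {C : ChordDiagram n} {e : ℕ → ℕ}
    (h : Emb k D.toNat C.toNat e) : ∃ f : D.Embedding C, ∀ x, x < 2 * k → f.toNat x = e x := by
  have hlt : ∀ x, x < 2 * k → e x < 2 * n := by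
    intro x hx
    by_contra h1
    have h2 := (C.isMatching_toNat.eq_self_iff _).2 (not_lt.1 h1)
    rw [h.map x hx, h.eq_iff (D.isMatching_toNat.lt_iff.2 hx) hx] at h2
    exact D.isMatching_toNat.ne hx h2
  refine ⟨⟨OrderEmbedding.ofStrictMono (fun x => ⟨e x, hlt x x.2⟩)
    fun x y hxy => h.mono x y hxy y.2, fun x => ?_⟩, fun x hx => ?_⟩
  · apply Fin.ext
    change e (D.mate x) = C.mate ⟨e x, hlt x x.2⟩
    rw [← toNat_coe, ← toNat_coe]
    exact (h.map x x.2).symm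
  · rw [Embedding.toNat, dif_pos hx]
    rfl

theorem topCycle_toNat {k x : ℕ} (hk : 3 ≤ k) (hx : x < 2 * k) : (topCycle k hk).toNat x =
    if x = 1 then 2 * k - 2 else if x = 2 * k - 2 then 1 else if x % 2 = 0 then x + 3
      else x - 3 := by
  rw [toNat, dif_pos hx]
  simp only [topCycle]
  split_ifs <;> rfl

end ChordDiagram

/-! ### The local form of top-cycle-freeness -/

namespace Matching

variable {n : ℕ} {m : ℕ → ℕ}

/-- If the condition of `TopFree` fails at `p → q → r`, then there is a chain of chords from `p` to
`r`, with intermediate chords under `q`, such that each chord crosses precisely its neighbors in the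
chain.  It is found by choosing, at each step, the chord that reaches farthest. -/
theorem exists_chain (h : IsMatching n m) {p q r : ℕ} (hpq : Nbr m p q) (hqr : Nbr m q r)
    (hcov : ∀ u, m p < u → u ≤ r → ∃ c, Under m c q ∧ Spans m c u) :
    ∃ (l : ℕ) (P : ℕ → ℕ), 1 ≤ l ∧ P 0 = p ∧ P l = r ∧
      (∀ j, j < l → P (j + 1) < m (P j) ∧ m (P j) < m (P (j + 1))) ∧
      (∀ j, j + 2 ≤ l → m (P j) < P (j + 2)) ∧ ∀ j, 1 ≤ j → j < l → Under m (P j) q := by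
  have hrc : r < m r := by simp only [Nbr] at hqr; omega
  have hpc : p < m p := by simp only [Nbr] at hpq; omega
  suffices ∀ N v, r - m v < N → v < m v → m p ≤ m v → m v < m q →
      ∃ (l : ℕ) (P : ℕ → ℕ), 1 ≤ l ∧ P 0 = v ∧ P l = r ∧
      (∀ j, j < l → P (j + 1) < m (P j) ∧ m (P j) < m (P (j + 1))) ∧
      (∀ j, j + 2 ≤ l → m (P j) < P (j + 2)) ∧ ∀ j, 1 ≤ j → j < l → Under m (P j) q from
    this _ p (Nat.lt_succ_self _) hpc le_rfl hpq.2.2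
  intro N
  induction N with
  | zero => intro v hv; omega
  | succ N ih =>
    intro v hN hvc hpv hvq
    have hvr : v ≠ r := by
      rintro rfl
      simp only [Nbr] at hqr
      omega
    obtain ⟨e1, e2, e3⟩ := h.endpoints_ne hvc hrc hvr
    by_cases hlt : r < m v
    · refine ⟨1, fun j => if j = 0 then v else r, le_rfl, by simp, by simp, fun j hj => ?_,
        by omega, by omega⟩
      obtain rfl : j = 0 := by omega
      simp only [if_true, zero_add, one_ne_zero, if_false]
      simp only [Nbr] at hqr
      omega
    · have hex : ((Finset.range (2 * n)).filter
          fun c => Under m c q ∧ Spans m c (m v + 1)).Nonempty := by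
        obtain ⟨c, hc1, hc2⟩ := hcov (m v + 1) (by omega) (by omega)
        have := h.sink_lt (c := c) (by simp only [Spans] at hc2; omega)
        refine ⟨c, ?_⟩
        simp only [Finset.mem_filter, Finset.mem_range]
        refine ⟨?_, hc1, hc2⟩
        simp only [Spans] at hc2
        omega
      obtain ⟨c, hc, hmax'⟩ := Finset.exists_max_image _ m hex
      simp only [Finset.mem_filter, Finset.mem_range] at hc hmax'
      obtain ⟨-, hcq, hcs⟩ := hc
      have hmax : ∀ d, Under m d q → Spans m d (m v + 1) → m d ≤ m c := by
        intro d hd1 hd2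
        have := h.sink_lt (c := d) (by simp only [Spans] at hd2; omega)
        refine hmax' d ⟨?_, hd1, hd2⟩
        simp only [Spans] at hd2
        omega
      clear hmax' hex
      have hcc : c < m c := by simp only [Spans] at hcs; omega
      have hcv : c ≠ m v := by
        rintro rfl
        rw [h.invol] at hcc
        omega
      simp only [Under, Spans] at hcq hcs
      obtain ⟨l, P, h1, h2, h3, h4, h5, h6⟩ := ih c (by omega) hcc (by omega) hcq.2
      refine ⟨l + 1, fun j => if j = 0 then v else P (j - 1), by omega, by simp, by simp [h3],
        fun j hj => ?_, fun j hj => ?_, fun j hj1 hj2 => ?_⟩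
      · rcases Nat.eq_zero_or_pos j with rfl | hj0
        · simp only [if_true, zero_add, one_ne_zero, if_false, Nat.sub_self, h2]
          omega
        · obtain ⟨i, rfl⟩ := Nat.exists_eq_add_of_le' hj0
          simpa using h4 i (by omega)
      · rcases Nat.eq_zero_or_pos j with rfl | hj0
        · simp only [if_true, zero_add, OfNat.ofNat_ne_zero, if_false]
          change m v < P 1
          by_cases hl : l = 1
          · rw [← hl, h3]
            omega
          · have h7 := h6 1 le_rfl (by omega)
            have h8 := h4 0 (by omega)
            rw [h2, zero_add] at h8
            by_contra h9
            have := hmax (P 1) h7 ⟨by omega, by omega⟩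
            omega
        · obtain ⟨i, rfl⟩ := Nat.exists_eq_add_of_le' hj0
          simpa using h5 i (by omega)
      · rcases Nat.eq_or_lt_of_le hj1 with rfl | hj0
        · simp only [one_ne_zero, if_false, Nat.sub_self, h2]
          exact hcq
        · obtain ⟨i, rfl⟩ := Nat.exists_eq_add_of_le' hj1
          simpa using h6 i (by omega) (by omega)

end Matching

namespace ChordDiagram

open Matching

variable {n k : ℕ}

/-- A chain of chords `P 0, …, P l` in which only neighbors cross, together with a chord `q` that
crosses the first and the last one and lies above the others, is a top cycle with `l + 2` chords. -/
theorem exists_topCycle_emb {m : ℕ → ℕ} (h : IsMatching n m) {q l : ℕ} {P : ℕ → ℕ} (hl : 1 ≤ l)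
    (h0 : P 0 < q) (h1 : q < P 1)
    (h2 : ∀ j, j < l → P (j + 1) < m (P j) ∧ m (P j) < m (P (j + 1)))
    (h3 : ∀ j, j + 2 ≤ l → m (P j) < P (j + 2)) (h4 : m (P (l - 1)) < m q) (h5 : m q < m (P l)) :
    Emb (l + 2) (topCycle (l + 2) (by omega)).toNat m fun x => if x = 1 then q
      else if x = 2 * l + 2 then m q else if x % 2 = 0 then P (x / 2) else m (P ((x - 3) / 2)) where
  mono := by
    suffices ∀ y, y + 1 < 2 * (l + 2) → (if y = 1 then q
        else if y = 2 * l + 2 then m q else if y % 2 = 0 then P (y / 2) else m (P ((y - 3) / 2))) <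
        if y + 1 = 1 then q else if y + 1 = 2 * l + 2 then m q
          else if (y + 1) % 2 = 0 then P ((y + 1) / 2) else m (P ((y + 1 - 3) / 2)) by
      intro x y hxy hy
      induction y, hxy using Nat.le_induction with
      | base => exact this x hy
      | succ y hxy ih => exact lt_trans (ih (by omega)) (this y hy)
    intro y hy
    rcases Nat.even_or_odd' y with ⟨j, rfl | rfl⟩
    · rcases Nat.eq_zero_or_pos j with rfl | hj
      · simpa using h0
      by_cases hjl : j = l + 1
      · subst hjl
        rw [if_neg (by omega), if_pos (by omega), if_neg (by omega), if_neg (by omega),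
          if_neg (by omega), show (2 * (l + 1) + 1 - 3) / 2 = l by omega]
        exact h5
      · rw [if_neg (by omega), if_neg (by omega), if_pos (by omega), if_neg (by omega),
          if_neg (by omega), if_neg (by omega), show 2 * j / 2 = j - 1 + 1 by omega,
          show (2 * j + 1 - 3) / 2 = j - 1 by omega]
        exact (h2 (j - 1) (by omega)).1
    · rcases Nat.eq_zero_or_pos j with rfl | hj
      · rw [if_pos (by omega), if_neg (by omega), if_neg (by omega), if_pos (by omega)]
        exact h1
      by_cases hjl : j = l
      · subst hjl
        rw [if_neg (by omega), if_neg (by omega), if_neg (by omega), if_neg (by omega),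
          if_pos (by omega), show (2 * j + 1 - 3) / 2 = j - 1 by omega]
        exact h4
      · rw [if_neg (by omega), if_neg (by omega), if_neg (by omega), if_neg (by omega),
          if_neg (by omega), if_pos (by omega), show (2 * j + 1 - 3) / 2 = j - 1 by omega,
          show (2 * j + 1 + 1) / 2 = j - 1 + 2 by omega]
        exact h3 (j - 1) (by omega)
  map x hx := by
    rw [topCycle_toNat _ hx, show 2 * (l + 2) - 2 = 2 * l + 2 by omega]
    by_cases e1 : x = 1
    · rw [if_pos e1, if_pos e1, if_neg (by omega), if_pos rfl]
    by_cases e2 : x = 2 * l + 2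
    · rw [if_neg e1, if_neg e1, if_pos e2, if_pos e2, if_pos rfl, h.invol]
    by_cases e3 : x % 2 = 0
    · simp only [if_neg e1, if_neg e2, if_pos e3]
      rw [if_neg (by omega), if_neg (by omega), if_neg (by omega), show x + 3 - 3 = x by omega]
    · simp only [if_neg e1, if_neg e2, if_neg e3]
      rw [if_neg (by omega), if_neg (by omega), if_pos (by omega), h.invol]

/-- In a top cycle, the chords under `q` span all gaps between the sink of `p` and the source of
`r`, where `p` and `r` are the first and the last chord of the chain. Conversely, if these gaps are
all spanned, then `exists_chain` provides a top cycle. -/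
theorem topFree_iff (C : ChordDiagram n) : C.TopCycleFree ↔ TopFree C.toNat := by
  have hC := C.isMatching_toNat
  constructor
  · intro h p q r hpq hqr
    by_contra! hcon
    obtain ⟨l, P, h1, rfl, rfl, h2, h3, h4⟩ := exists_chain hC hpq hqr hcon
    obtain ⟨f, -⟩ := exists_embedding (exists_topCycle_emb hC (q := q) h1 hpq.1 (by
      by_cases hl : l = 1
      · subst hl
        exact hqr.1
      · exact (h4 1 le_rfl (by omega)).1) h2 h3 (by
      by_cases hl : l = 1
      · subst hl
        exact hpq.2.2
      · exact (h4 (l - 1) (by omega) (by omega)).2) hqr.2.2)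
    exact (h _ _).false f
  · intro h k hk
    refine ⟨fun f => ?_⟩
    have hf := f.emb
    have hT := (topCycle k hk).isMatching_toNat
    have hmap : ∀ x y, x < 2 * k → (topCycle k hk).toNat x = y → C.toNat (f.toNat x) = f.toNat y :=
      fun x y hx hxy => by rw [hf.map x hx, hxy]
    have hq : C.toNat (f.toNat 1) = f.toNat (2 * k - 2) := hmap _ _ (by omega) (by
      rw [topCycle_toNat hk (by omega), if_pos rfl])
    have hP : ∀ j, j + 2 ≤ k → C.toNat (f.toNat (2 * j)) = f.toNat (2 * j + 3) := by
      intro j hj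
      refine hmap _ _ (by omega) ?_
      rw [topCycle_toNat hk (by omega), if_neg (by omega), if_neg (by omega), if_pos (by omega)]
    have h01 := hf.mono 0 1 (by omega) (by omega)
    have hp := hP 0 (by omega)
    have hr := hP (k - 2) (by omega)
    obtain ⟨u, hu1, hu2, hu3⟩ := h (f.toNat (2 * 0)) (f.toNat 1) (f.toNat (2 * (k - 2)))
      ⟨h01, by rw [hp]; exact hf.mono _ _ (by omega) (by omega),
        by rw [hp, hq]; exact hf.mono _ _ (by omega) (by omega)⟩
      ⟨hf.mono _ _ (by omega) (by omega), by rw [hq]; exact hf.mono _ _ (by omega) (by omega),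
        by rw [hq, hr]; exact hf.mono _ _ (by omega) (by omega)⟩
    rw [hp] at hu1
    -- the first chord of the chain that ends after the gap
    have hex : ∃ j, u ≤ f.toNat (2 * j + 3) := by
      refine ⟨k - 2, hu2.trans (hf.mono _ _ (by omega) (by omega)).le⟩
    have hj := Nat.find_spec hex
    have hmin : ∀ i, i < Nat.find hex → ¬ u ≤ f.toNat (2 * i + 3) := fun i hi =>
      Nat.find_min hex hi
    have hjk : Nat.find hex ≤ k - 3 := Nat.find_min' hex (by
      refine hu2.trans ?_
      rw [show 2 * (k - 2) = 2 * (k - 3) + 2 by omega]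
      exact (hf.mono _ _ (by omega) (by omega)).le)
    generalize Nat.find hex = j at hj hmin hjk
    have hj0 : j ≠ 0 := by
      rintro rfl
      omega
    refine hu3 (f.toNat (2 * j)) ⟨hf.mono _ _ (by omega) (by omega), ?_⟩ ⟨?_, ?_⟩
    · rw [hP j (by omega), hq]
      exact hf.mono _ _ (by omega) (by omega)
    · have h1 := hmin (j - 1) (by omega)
      have h2 := hf.mono (2 * j) (2 * (j - 1) + 3) (by omega) (by omega)
      omega
    · rw [hP j (by omega)]
      exact hj

end ChordDiagram

/-! ### The intersection order -/

namespace ChordDiagram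

open Matching

variable {n : ℕ} {C : ChordDiagram n} {S : Finset C.Chord} {c d r t : C.Chord} {x : ℕ}

/-- The number `x` is a chord of the set `S`. -/
def IsIn (S : Finset C.Chord) (x : ℕ) : Prop := ∃ d ∈ S, (d.1 : ℕ) = x

theorem isIn_coe : IsIn S (d.1 : ℕ) ↔ d ∈ S := by
  constructor
  · rintro ⟨e, he, hed⟩
    rwa [← chord_ext hed]
  · exact fun h => ⟨d, h, rfl⟩

theorem mem_component : d ∈ C.component S r ↔ d ∈ S ∧ Reach C.toNat (IsIn S) r.1 d.1 := by
  rw [component, Finset.mem_filter]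
  refine and_congr_right fun _ => ⟨fun h => ?_, fun h => ?_⟩
  · rename_i hd
    clear hd
    induction h with
    | refl => exact .refl _ _ _
    | tail _ h2 ih => exact ih.tail ((C.adj_iff _ _).1 h2.2) (isIn_coe.2 h2.1)
  · have key : ∀ x, Reach C.toNat (IsIn S) r.1 x → ∃ d : C.Chord, (d.1 : ℕ) = x ∧
        Relation.ReflTransGen (fun a b => b ∈ S ∧ C.graph.Adj a b) r d := by
      intro x hx
      induction hx with
      | refl => exact ⟨r, rfl, .refl⟩
      | tail _ h2 ih =>
        obtain ⟨d, rfl, hd⟩ := ih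
        obtain ⟨e, he, rfl⟩ := h2.1
        exact ⟨e, rfl, hd.tail ⟨he, (C.adj_iff _ _).2 h2.2⟩⟩
    obtain ⟨e, he, hr⟩ := key _ h
    rwa [chord_ext he] at hr

/-- After removing the root `r` of a connected set of chords that contains the chord `t` with the
last sink, the component of `t` comes first: every component contains a right neighbor of `r`, hence
the component with the first source and the one with the last sink coincide. -/
theorem reach_min_erase (hr : r ∈ S) (hmin : ∀ d ∈ S, r ≤ d) (ht : (t.1 : ℕ) = last n C.toNat)
    (htS : t ∈ C.component S r) {r' : C.Chord} (hr' : r' ∈ (C.component S r).erase r)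
    (hmin' : ∀ d ∈ (C.component S r).erase r, r' ≤ d) (hrt : r ≠ t) :
    Reach C.toNat (IsIn ((C.component S r).erase r)) r'.1 t.1 := by
  have hC := C.isMatching_toNat
  set S' := (C.component S r).erase r
  have hS' : ∀ {x}, IsIn S' x ↔ x ≠ r.1 ∧ IsIn S x ∧ Reach C.toNat (IsIn S) r.1 x := by
    intro x
    constructor
    · rintro ⟨d, hd, rfl⟩
      rw [Finset.mem_erase, mem_component] at hd
      exact ⟨fun h => hd.1 (chord_ext h), isIn_coe.2 hd.2.1, hd.2.2⟩
    · rintro ⟨h1, ⟨d, hd, rfl⟩, h2⟩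
      exact ⟨d, Finset.mem_erase.2 ⟨fun h => h1 (by rw [h]), mem_component.2 ⟨hd, h2⟩⟩, rfl⟩
  have hrS : IsIn S (r.1 : ℕ) := isIn_coe.2 hr
  -- every chord of the remaining set is connected to a right neighbor of the root
  have hnbr : ∀ x, IsIn S' x → ∃ y, Reach C.toNat (IsIn S') x y ∧ Nbr C.toNat r.1 y := by
    intro x hx
    obtain ⟨h1, h2, h3⟩ := hS'.1 hx
    obtain ⟨a, b, h4, h5, h6, h7⟩ := (h3.symm hrS).exists_exit (P := fun z => z ≠ r.1 ∧ IsIn S z)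
      fun h => (h.prop ⟨h1, h2⟩).1 rfl
    have hb : b = r.1 := by
      by_contra hb
      exact h7 ⟨hb, h6⟩
    subst hb
    have ha := h4.prop ⟨h1, h2⟩
    refine ⟨a, h4.strengthen.mono fun z hz => hS'.2 ⟨hz.1.1, hz.1.2, h3.trans ?_⟩, ?_⟩
    · exact hz.2.mono fun w hw => hw.2
    · rcases h5 with h5 | h5
      · obtain ⟨e, he, rfl⟩ := ha.2
        have := hmin e he
        rw [← Subtype.coe_le_coe, Fin.le_def] at this
        exact absurd h5.1 (by omega)
      · exact h5
  have hr'S : IsIn S' (r'.1 : ℕ) := isIn_coe.2 hr'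
  have htS' : IsIn S' (t.1 : ℕ) := isIn_coe.2 (Finset.mem_erase.2 ⟨hrt.symm, htS⟩)
  obtain ⟨c, hc1, hc2⟩ := hnbr _ hr'S
  obtain ⟨d, hd1, hd2⟩ := hnbr _ htS'
  have hcS := hc1.prop hr'S
  have hdS := hd1.prop htS'
  have hdt := hd1.symm htS'
  have hle : ∀ x, IsIn S' x → (r'.1 : ℕ) ≤ x := by
    rintro x ⟨e, he, rfl⟩
    exact hmin' e he
  have hcc := hc1.isChord (C.chord_lt _)
  have hdc := hd1.isChord (C.chord_lt _)
  by_cases hcd : c = d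
  · exact hc1.trans (hcd ▸ hdt)
  obtain ⟨e1, e2, e3⟩ := hC.endpoints_ne hcc hdc hcd
  have h3 : Cross C.toNat c d ∨ Under C.toNat c d ∨ Under C.toNat d c := by
    simp only [Cross, Nbr, Under] at *
    omega
  rcases h3 with h3 | h3 | h3
  · exact (hc1.tail h3 hdS).trans hdt
  · obtain ⟨z, hz1, hz2⟩ := hC.exists_cross' hdc hc1 (fun h => by
      have := hle d hdS
      simp only [Under] at h
      omega) h3
    exact (hz1.tail hz2.symm hdS).trans hdt
  · obtain ⟨z, hz1, hz2⟩ := hC.exists_cross hcc hdt h3 (fun h => by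
      have := hC.sink_le_last hcc
      rw [ht] at h
      simp only [Under] at h
      omega)
    exact ((hc1.tail hz2 (hz1.prop hdS)).trans (hz1.symm hdS)).trans hdt

/-- The chords that are listed before the chord `t` with the last sink are those that are connected
to `t` through chords that do not precede them. -/
theorem exists_orderList_eq (ht : (t.1 : ℕ) = last n C.toNat) (S : Finset C.Chord)
    (htS : t ∈ S) (hS : ∀ r ∈ S, (∀ d ∈ S, r ≤ d) → Reach C.toNat (IsIn S) r.1 t.1) :
    ∃ L L', C.orderList S = L ++ t :: L' ∧ L.Nodup ∧ ∀ d, d ∈ L ↔ d ≠ t ∧ d ∈ S ∧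
      Reach C.toNat (fun x => IsIn S x ∧ (d.1 : ℕ) ≤ x) d.1 t.1 := by
  induction hN : S.card using Nat.strong_induction_on generalizing S with
  | _ N ih =>
    subst hN
    have hne : S.Nonempty := ⟨t, htS⟩
    have hrS := S.min'_mem hne
    have hmin : ∀ d ∈ S, S.min' hne ≤ d := fun d hd => S.min'_le d hd
    rw [orderList, dif_pos hne]
    generalize S.min' hne = r at hrS hmin
    have htr := hS r hrS hmin
    have htK : t ∈ C.component S r := mem_component.2 ⟨htS, htr⟩
    have hrK : r ∈ C.component S r := mem_component.2 ⟨hrS, .refl _ _ _⟩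
    by_cases hrt : r = t
    · subst hrt
      refine ⟨[], _, rfl, List.nodup_nil, fun d => ?_⟩
      simp only [List.not_mem_nil, false_iff]
      rintro ⟨h1, h2, h3⟩
      have h4 : (d.1 : ℕ) ≤ r.1 := (h3.prop ⟨isIn_coe.2 h2, le_rfl⟩).2
      have h5 := hmin d h2
      rw [← Subtype.coe_le_coe, Fin.le_def] at h5
      exact h1 (chord_ext (by omega))
    · have hlt : ((C.component S r).erase r).card < S.card :=
        lt_of_lt_of_le (Finset.card_erase_lt_of_mem hrK)
          (Finset.card_le_card (Finset.filter_subset _ _))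
      obtain ⟨L, L', h1, h2, h3⟩ := ih _ hlt ((C.component S r).erase r)
        (Finset.mem_erase.2 ⟨fun h => hrt h.symm, htK⟩)
        (fun r' hr' hmin' => reach_min_erase hrS hmin ht htK hr' hmin' hrt) rfl
      refine ⟨r :: L, L' ++ C.orderList (S \ C.component S r), ?_, ?_, fun d => ?_⟩
      · rw [h1]
        simp
      · refine List.nodup_cons.2 ⟨fun h => ?_, h2⟩
        have := ((h3 r).1 h).2.1
        simp at this
      · rw [List.mem_cons, h3]
        by_cases hdr : d = r
        · subst hdr
          simp only [true_or, true_iff]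
          refine ⟨hrt, hrS, htr.mono ?_⟩
          rintro x ⟨e, he, rfl⟩
          exact ⟨isIn_coe.2 he, hmin e he⟩
        · simp only [hdr, false_or, and_congr_right_iff]
          intro hdt
          constructor
          · rintro ⟨h4, h5⟩
            rw [Finset.mem_erase, mem_component] at h4
            refine ⟨h4.2.1, h5.mono ?_⟩
            rintro x ⟨⟨e, he, rfl⟩, hx⟩
            rw [Finset.mem_erase, mem_component] at he
            exact ⟨isIn_coe.2 he.2.1, hx⟩
          · rintro ⟨h4, h5⟩
            have h6 : Reach C.toNat (IsIn S) r.1 d.1 :=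
              htr.trans ((h5.mono fun x hx => hx.1).symm (isIn_coe.2 h4))
            have hrd : (r.1 : ℕ) < d.1 := by
              have h7 := hmin d h4
              rw [← Subtype.coe_le_coe, Fin.le_def] at h7
              have : (r.1 : ℕ) ≠ d.1 := fun h => hdr (chord_ext h.symm)
              omega
            refine ⟨Finset.mem_erase.2 ⟨hdr, mem_component.2 ⟨h4, h6⟩⟩, h5.strengthen.mono ?_⟩
            rintro x ⟨⟨⟨e, he, rfl⟩, hx⟩, hx2⟩
            refine ⟨isIn_coe.2 (Finset.mem_erase.2 ⟨?_, mem_component.2 ⟨he, ?_⟩⟩), hx⟩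
            · rintro rfl
              omega
            · exact h6.trans (hx2.mono fun x hx => hx.1)

theorem exists_last (hn : 1 ≤ n) : ∃ t : C.Chord, (t.1 : ℕ) = last n C.toNat :=
  C.exists_chord (C.isMatching_toNat.last_isChord hn)

theorem exists_intersectionOrder_eq (hc : Conn n C.toNat) (ht : (t.1 : ℕ) = last n C.toNat) :
    ∃ L L', C.intersectionOrder = L ++ t :: L' ∧ L.Nodup ∧ ∀ d, d ∈ L ↔ d ≠ t ∧
      Spine n C.toNat d.1 := by
  have huniv : ∀ (x y : ℕ) (P : ℕ → Prop), x < C.toNat x → Reach C.toNat P x y →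
      Reach C.toNat (fun z => IsIn (Finset.univ : Finset C.Chord) z ∧ P z) x y := by
    intro x y P hx h
    refine h.strengthen.mono fun z hz => ⟨?_, hz.1⟩
    obtain ⟨e, rfl⟩ := C.exists_chord (hz.2.isChord hx)
    exact isIn_coe.2 (Finset.mem_univ _)
  obtain ⟨L, L', h1, h2, h3⟩ := exists_orderList_eq ht Finset.univ (Finset.mem_univ _)
    fun r _ _ => (huniv _ _ _ (C.chord_lt r) (hc.2 _ _ (C.chord_lt r) (C.chord_lt t))).mono
      fun x hx => hx.1
  refine ⟨L, L', h1, h2, fun d => ?_⟩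
  rw [h3, Spine, ← ht]
  refine and_congr_right fun _ => ⟨fun h => ⟨C.chord_lt d, h.2.mono fun x hx => hx.2⟩,
    fun h => ⟨Finset.mem_univ _, huniv _ _ _ h.1 h.2⟩⟩

theorem isTerminal_last (ht : (t.1 : ℕ) = last n C.toNat) : C.IsTerminal t := by
  intro d hd
  rw [rightNbr_iff, ht] at hd
  exact C.isMatching_toNat.not_nbr_last hd

/-- A path to the last chord through later chords starts with a right neighbor. -/
theorem not_isTerminal_of_spine (ht : (t.1 : ℕ) = last n C.toNat) (hd : Spine n C.toNat d.1)
    (hdt : d ≠ t) : ¬ C.IsTerminal d := by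
  intro hterm
  obtain ⟨e, h1, h2, -⟩ := hd.2.exists_last (fun h => hdt (chord_ext (h.trans ht.symm)))
  obtain ⟨e, rfl⟩ := C.exists_chord h1.right
  refine hterm e ((C.rightNbr_iff _ _).2 ?_)
  rcases h1 with h1 | h1
  · exact h1
  · exact absurd h1.1 (by omega)

/-- The position of the first terminal chord, together with the chords before it. -/
theorem exists_t1_eq (hc : Conn n C.toNat) (ht : (t.1 : ℕ) = last n C.toNat) :
    ∃ L L', C.intersectionOrder = L ++ t :: L' ∧ L.Nodup ∧
      (∀ d, d ∈ L ↔ d ≠ t ∧ Spine n C.toNat d.1) ∧ C.t1 = L.length + 1 := by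
  obtain ⟨L, L', h1, h2, h3⟩ := exists_intersectionOrder_eq hc ht
  refine ⟨L, L', h1, h2, h3, ?_⟩
  rw [t1, h1, List.findIdx_append]
  have h4 : L.findIdx (fun c => decide (C.IsTerminal c)) = L.length := by
    rw [List.findIdx_eq_length]
    intro d hd
    have := (h3 d).1 hd
    simpa using not_isTerminal_of_spine ht this.2 this.1
  rw [h4, if_neg (lt_irrefl _), List.findIdx_cons]
  simp [isTerminal_last ht]

theorem t1_eq_spineCount (hc : Conn n C.toNat) : C.t1 = spineCount n C.toNat := by
  obtain ⟨t, ht⟩ := C.exists_last hc.1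
  obtain ⟨L, L', -, h2, h3, h4⟩ := exists_t1_eq hc ht
  have hlast := C.isMatching_toNat.spine_last hc
  rw [h4, spineCount, Nat.count_eq_card_filter_range, ← List.toFinset_card_of_nodup h2,
    ← Finset.card_image_of_injective (f := fun d : C.Chord => (d.1 : ℕ)) _
      (fun d e h => chord_ext h), ← Finset.card_insert_of_notMem (a := last n C.toNat)]
  · congr 1
    ext x
    simp only [Finset.mem_insert, Finset.mem_image, List.mem_toFinset, Finset.mem_filter,
      Finset.mem_range]
    constructor
    · rintro (rfl | ⟨d, hd, rfl⟩)
      · exact ⟨ht ▸ t.1.2, hlast⟩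
      · exact ⟨d.1.2, ((h3 d).1 hd).2⟩
    · rintro ⟨-, h5⟩
      obtain ⟨d, rfl⟩ := C.exists_chord h5.1
      by_cases hd : d = t
      · exact .inl (hd ▸ ht)
      · exact .inr ⟨d, (h3 d).2 ⟨hd, h5⟩, rfl⟩
  · simp only [Finset.mem_image, List.mem_toFinset, not_exists, not_and]
    intro d hd hdt
    exact ((h3 d).1 hd).1 (chord_ext (hdt.trans ht.symm))

theorem index_lt_t1_iff (hc : Conn n C.toNat) (ht : (t.1 : ℕ) = last n C.toNat) :
    C.index d < C.t1 ↔ d ≠ t ∧ Spine n C.toNat d.1 := by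
  obtain ⟨L, L', h1, h2, h3, h4⟩ := exists_t1_eq hc ht
  rw [← h3, h4, index, h1, List.idxOf_append]
  split_ifs with h5
  · have := List.idxOf_lt_length_of_mem h5
    simp only [h5, iff_true]
    omega
  · simp only [h5, iff_false]
    omega

theorem index_eq_t1_iff (hc : Conn n C.toNat) (ht : (t.1 : ℕ) = last n C.toNat) :
    C.index d = C.t1 ↔ d = t := by
  obtain ⟨L, L', h1, h2, h3, h4⟩ := exists_t1_eq hc ht
  rw [h4, index, h1, List.idxOf_append]
  split_ifs with h5
  · have := List.idxOf_lt_length_of_mem h5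
    have h6 := ((h3 d).1 h5).1
    simp only [h6, iff_false]
    omega
  · rw [List.idxOf_cons]
    by_cases h6 : d = t
    · simp [h6]
    · have h7 : (t == d) = false := beq_false_of_ne fun h => h6 h.symm
      rw [h7]
      simp [h6]

end ChordDiagram

/-! ### The composition system of connected top-cycle-free diagrams -/

namespace TopFreeDiagram

open Matching

variable {C D : TopFreeDiagram}

theorem ext_toNat (h : C.size = D.size) (h' : C.diagram.toNat = D.diagram.toNat) : C = D := by
  obtain ⟨n, C, h1, h2⟩ := C
  obtain ⟨n', D, h3, h4⟩ := D
  obtain rfl : n = n' := h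
  obtain rfl : C = D := ChordDiagram.toNat_injective h'
  rfl

theorem isMatching (C : TopFreeDiagram) : IsMatching C.size C.diagram.toNat :=
  C.diagram.isMatching_toNat

theorem conn (C : TopFreeDiagram) : Conn C.size C.diagram.toNat :=
  C.diagram.connected_iff.1 C.connected

theorem topFree (C : TopFreeDiagram) : TopFree C.diagram.toNat :=
  C.diagram.topFree_iff.1 C.topCycleFree

theorem exists_toNat_eq {n : ℕ} {m : ℕ → ℕ} (h : IsMatching n m) (hc : Conn n m)
    (ht : TopFree m) : ∃ C : TopFreeDiagram, C.size = n ∧ C.diagram.toNat = m := by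
  obtain ⟨C, rfl⟩ := ChordDiagram.exists_toNat_eq h
  exact ⟨⟨n, C, C.connected_iff.2 hc, C.topFree_iff.2 ht⟩, rfl, rfl⟩

theorem t1_eq (C : TopFreeDiagram) : C.diagram.t1 = spineCount C.size C.diagram.toNat :=
  C.diagram.t1_eq_spineCount C.conn

theorem eq_of_size_eq_one (hC : C.size = 1) (hD : D.size = 1) : C = D := by
  refine ext_toNat (hC.trans hD.symm) ?_
  have key : ∀ {C : TopFreeDiagram}, C.size = 1 → C.diagram.toNat = fun x =>
      if x = 0 then 1 else if x = 1 then 0 else x := by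
    intro C hC
    have h : IsMatching 1 C.diagram.toNat := hC ▸ C.isMatching
    funext x
    have h1 := h.lt_iff (x := x)
    have h2 := h.eq_self_iff x
    split_ifs <;> omega
  rw [key hC, key hD]

theorem exists_size_eq_one : ∃ C : TopFreeDiagram, C.size = 1 := by
  obtain ⟨C, hC, -⟩ := exists_toNat_eq (n := 1)
    (m := fun x => if x = 0 then 1 else if x = 1 then 0 else x)
    ⟨fun x => by grind, fun x => by split_ifs <;> omega⟩
    ⟨le_rfl, fun c d hc hd => by
      dsimp only at hc hd
      obtain rfl : c = 0 := by split_ifs at hc <;> omega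
      obtain rfl : d = 0 := by split_ifs at hd <;> omega
      exact .refl _ _ _⟩
    fun p q r hpq _ => by
      simp only [Nbr] at hpq
      split_ifs at hpq <;> omega
  exact ⟨C, hC⟩

/-- The diagram with one chord. -/
noncomputable def singleChord : TopFreeDiagram := exists_size_eq_one.choose

theorem size_singleChord : singleChord.size = 1 := exists_size_eq_one.choose_spec

/-- The diagram `C` arises by inserting `B` into `A` at the gap that is preceded by `i` sources of
chords of the spine of `A`, namely at the source of such a chord or before the last point. -/
def IsComp (A : TopFreeDiagram) (i : ℕ) (B C : TopFreeDiagram) : Prop :=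
  ∃ g, C.size = A.size + B.size ∧
    IsGlue A.size B.size g A.diagram.toNat B.diagram.toNat C.diagram.toNat ∧
    (g = 2 * A.size - 1 ∨ Spine A.size A.diagram.toNat g) ∧
    i = Nat.count (Spine A.size A.diagram.toNat) g

theorem exists_count_eq {p : ℕ → Prop} {i N : ℕ} (h : i < Nat.count p N) :
    ∃ g, g < N ∧ p g ∧ Nat.count p g = i := by
  induction N with
  | zero => simp at h
  | succ N ih =>
    rw [Nat.count_succ] at h
    by_cases hi : i < Nat.count p N
    · obtain ⟨g, h1, h2, h3⟩ := ih hi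
      exact ⟨g, by omega, h2, h3⟩
    · refine ⟨N, by omega, ?_, ?_⟩
      · by_contra hN
        rw [if_neg hN] at h
        omega
      · split_ifs at h <;> omega

theorem count_pred_eq (C : TopFreeDiagram) :
    Nat.count (Spine C.size C.diagram.toNat) (2 * C.size - 1) =
      spineCount C.size C.diagram.toNat := by
  have hn := C.conn.1
  have h1 : ¬ Spine C.size C.diagram.toNat (2 * C.size - 1) := by
    intro h1
    have h2 := C.isMatching.sink_lt h1.1
    have := h1.1
    omega
  rw [spineCount, show 2 * C.size = 2 * C.size - 1 + 1 by omega, Nat.count_succ, if_neg h1]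
  simp

theorem one_le_count (C : TopFreeDiagram) {g : ℕ} (hg : 1 ≤ g) :
    1 ≤ Nat.count (Spine C.size C.diagram.toNat) g := by
  have := Nat.count_strict_mono (C.isMatching.spine_zero C.conn) hg
  omega

theorem gap_unique {A : TopFreeDiagram} {g g' : ℕ} (hg : g < 2 * A.size) (hg' : g' < 2 * A.size)
    (h : g = 2 * A.size - 1 ∨ Spine A.size A.diagram.toNat g)
    (h' : g' = 2 * A.size - 1 ∨ Spine A.size A.diagram.toNat g')
    (hc : Nat.count (Spine A.size A.diagram.toNat) g =
      Nat.count (Spine A.size A.diagram.toNat) g') : g = g' := by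
  rcases lt_trichotomy g g' with h1 | h1 | h1
  · have := Nat.count_strict_mono (h.resolve_left (by omega)) h1
    omega
  · exact h1
  · have := Nat.count_strict_mono (h'.resolve_left (by omega)) h1
    omega

theorem isCompositionSystem :
    IsCompositionSystem size (fun C => C.diagram.t1) singleChord IsComp where
  size_atom := size_singleChord
  t_atom := by
    have h0 : 2 * singleChord.size - 1 = 1 := by rw [size_singleChord]
    have h1 := one_le_count singleChord (le_refl 1)
    have h2 := Nat.count_le (p := Spine singleChord.size singleChord.diagram.toNat) (n := 1)
    rw [t1_eq, ← count_pred_eq, h0]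
    omega
  size_pos C := C.conn.1
  bounds := by
    rintro A i B C ⟨g, hs, hG, hg, rfl⟩
    refine ⟨one_le_count A hG.one_le, ?_⟩
    rw [t1_eq]
    exact Nat.count_monotone _ hG.lt.le
  size_comp := by
    rintro A i B C ⟨g, hs, hG, hg, rfl⟩
    exact hs
  t_comp := by
    rintro A i B C ⟨g, hs, hG, hg, rfl⟩
    rw [t1_eq, t1_eq]
    refine (congrArg (spineCount · C.diagram.toNat) hs).trans ?_
    rw [hG.spineCount_eq hg]
  exists_comp := by
    intro A i B h1 h2
    rw [t1_eq] at h2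
    have hex : ∃ g, 1 ≤ g ∧ g < 2 * A.size ∧
        (g = 2 * A.size - 1 ∨ Spine A.size A.diagram.toNat g) ∧
        i = Nat.count (Spine A.size A.diagram.toNat) g := by
      have hA := A.conn.1
      rcases eq_or_lt_of_le h2 with h3 | h3
      · exact ⟨2 * A.size - 1, by omega, by omega, .inl rfl, by rw [count_pred_eq, h3]⟩
      · obtain ⟨g, q1, q2, q3⟩ := exists_count_eq h3
        refine ⟨g, ?_, q1, .inr q2, q3.symm⟩
        rcases Nat.eq_zero_or_pos g with rfl | hg
        · rw [Nat.count_zero] at q3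
          omega
        · exact hg
    obtain ⟨g, hg1, hg2, hg3, hi⟩ := hex
    obtain ⟨m, hm⟩ := exists_isGlue A.isMatching B.isMatching B.conn.1 hg1 hg2
    have hgood : Good A.diagram.toNat g := by
      rcases hg3 with rfl | hg3
      · exact A.isMatching.good_end
      · exact A.isMatching.good_of_spine A.topFree hg3
    obtain ⟨C, hC, rfl⟩ := exists_toNat_eq hm.total (hm.conn A.conn B.conn)
      (hm.topFree A.topFree B.topFree hgood)
    exact ⟨C, g, hC, hm, hg3, hi⟩
  comp_unique := by
    rintro A i B C C' ⟨g, hs, hG, hg, rfl⟩ ⟨g', hs', hG', hg', hi⟩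
    obtain rfl := gap_unique hG.lt hG'.lt hg hg' hi
    exact ext_toNat (hs.trans hs'.symm) (hG.total_unique hG')
  decomp := by
    intro C
    have hn := C.conn.1
    by_cases h1 : C.size = 1
    · exact .inl (eq_of_size_eq_one h1 size_singleChord)
    obtain ⟨a, b, g, mA, mB, hs, hG, hA, hB⟩ := C.isMatching.exists_isGlue C.conn (by omega)
    obtain ⟨A, rfl, rfl⟩ := exists_toNat_eq hG.left hA (hG.embL_emb.topFree hG.left C.topFree)
    obtain ⟨B, rfl, rfl⟩ := exists_toNat_eq hG.right hB (hG.embR_emb.topFree hG.right C.topFree)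
    refine .inr ⟨A, _, B, g, hs.symm, hG, ?_, rfl⟩
    by_cases hg : g = 2 * A.size - 1
    · exact .inl hg
    · exact .inr (A.isMatching.spine_of_good hA hG.one_le (by have := hG.lt; omega)
        (hG.good_of_topFree C.topFree))
  decomp_unique := by
    rintro A i B A' i' B' C ⟨g, hs, hG, hg, rfl⟩ ⟨g', hs', hG', hg', rfl⟩
    obtain ⟨h1, h2, rfl, h4, h5⟩ := hG.unique hG' (by omega) A.conn A'.conn
    obtain rfl := ext_toNat h1 h4
    obtain rfl := ext_toNat h2 h5
    exact ⟨rfl, rfl, rfl⟩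

end TopFreeDiagram

/-! ### Decompositions of diagrams -/

/-- Strictly increasing maps of initial segments with the same range are equal. -/
theorem eq_of_range_eq {N M : ℕ} {f g : ℕ → ℕ} (hf : ∀ x y, x < y → y < N → f x < f y)
    (hg : ∀ x y, x < y → y < M → g x < g y)
    (h : ∀ z, (∃ x, x < N ∧ f x = z) ↔ ∃ x, x < M ∧ g x = z) :
    N = M ∧ ∀ x, x < N → f x = g x := by
  have key : ∀ x, (x < N → x < M ∧ f x = g x) ∧ (x < M → x < N ∧ f x = g x) := by
    intro x
    induction x using Nat.strong_induction_on with
    | _ x ih =>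
      have aux : x < N → x < M ∧ f x ≤ g x ∧ g x ≤ f x ∨ x < N ∧ x < M ∧ f x = g x := by
        intro hx
        obtain ⟨y, hy, hxy⟩ := (h (f x)).1 ⟨x, hx, rfl⟩
        rcases lt_trichotomy y x with h1 | rfl | h1
        · have := (ih y h1).2 hy
          have := hf _ _ h1 hx
          omega
        · exact .inr ⟨hx, hy, hxy.symm⟩
        · obtain ⟨z, hz, hzx⟩ := (h (g x)).2 ⟨x, by omega, rfl⟩
          have h2 := hg _ _ h1 hy
          rcases lt_trichotomy z x with h3 | rfl | h3
          · have := (ih z h3).1 hz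
            have := hg _ _ h3 (by omega)
            omega
          · omega
          · have := hf _ _ h3 hz
            omega
      refine ⟨fun hx => by have := aux hx; omega, fun hx => ?_⟩
      by_cases hxN : x < N
      · have := aux hxN
        omega
      · obtain ⟨y, hy, hxy⟩ := (h (g x)).2 ⟨x, hx, rfl⟩
        have := (ih y (by omega)).1 hy
        have := hg _ _ (show y < x by omega) hx
        omega
  refine ⟨?_, fun x hx => ((key x).1 hx).2⟩
  have h1 := (key M).1
  have h2 := (key N).2
  omega

namespace ChordDiagram

open Matching

variable {n k : ℕ} {D : ChordDiagram k} {C : ChordDiagram n}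

theorem Embedding.contains_iff (e : D.Embedding C) {d : C.Chord} :
    e.Contains d ↔ ∃ x, x < D.toNat x ∧ e.toNat x = d.1 := by
  constructor
  · rintro ⟨x, hx⟩
    have h1 : e.toNat x = d.1 := by rw [e.toNat_coe, hx]
    refine ⟨x, ?_, h1⟩
    rw [← e.emb.isChord_iff D.isMatching_toNat x.2, h1]
    exact C.chord_lt d
  · rintro ⟨x, hx, hd⟩
    have h1 := lt_trans hx (D.isMatching_toNat.sink_lt hx)
    refine ⟨⟨x, h1⟩, Fin.ext ?_⟩
    rw [← hd]
    exact (e.toNat_coe ⟨x, h1⟩).symm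

theorem Embedding.exists_contains (e : D.Embedding C) {x : ℕ} (hx : x < D.toNat x) :
    ∃ d : C.Chord, (d.1 : ℕ) = e.toNat x ∧ e.Contains d := by
  have h1 := lt_trans hx (D.isMatching_toNat.sink_lt hx)
  obtain ⟨d, hd⟩ := C.exists_chord ((e.emb.isChord_iff D.isMatching_toNat h1).2 hx)
  exact ⟨d, hd, e.contains_iff.2 ⟨x, hx, hd.symm⟩⟩

end ChordDiagram

namespace TopFreeDiagram

open Matching ChordDiagram

/-- Only the single chord has no parts: in a composition, the root is not the last chord. -/
theorem eq_singleChord_of_isDecomposition {C : TopFreeDiagram} {Cs : Fin 0 → TopFreeDiagram}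
    {is : Fin 0 → ℕ} (h : C.IsDecomposition Cs is) : C = singleChord := by
  rcases isCompositionSystem.decomp C with h1 | ⟨A, i, B, g, hs, hG, -⟩
  · exact h1
  obtain ⟨c, e, -, h2, h3, -⟩ := h
  obtain ⟨t, ht⟩ := exists_last (C := C.diagram) C.conn.1
  obtain rfl := (index_eq_t1_iff C.conn ht).1 h2
  have hA := A.conn.1
  obtain ⟨d, hd⟩ := C.diagram.exists_chord ((hG.embL_emb.isChord_iff hG.left (x := 0)
    (by omega)).2 (hG.left.root_isChord hA))
  have hdc : d ≠ c := by
    rintro rfl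
    rw [hd, (congrArg (last · C.diagram.toNat) hs).trans hG.last_eq] at ht
    exact hG.embL_ne_embR (by omega) (by have := hG.last_lt; omega) ht
  obtain ⟨l, -⟩ := h3 d hdc
  exact l.elim0

variable {C : TopFreeDiagram} {k : ℕ} {Cs : Fin (k + 1) → TopFreeDiagram}
  {t : C.diagram.Chord} {e : ∀ l, (Cs l).diagram.Embedding C.diagram}

/-- The first part of a decomposition is the connected component of the root. -/
theorem exists_emb_zero_iff (ht : (t.1 : ℕ) = last C.size C.diagram.toNat)
    (h3 : ∀ d, d ≠ t → ∃! l, (e l).Contains d) (h4 : ∀ l, ¬ (e l).Contains t)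
    (h5 : ∀ l l' d d', l ≠ l' → (e l).Contains d → (e l').Contains d' →
      ¬ C.diagram.graph.Adj d d')
    (h6 : ∀ l l', l < l' → ∃ d, (e l).Contains d ∧ ∀ d', (e l').Contains d' → d < d')
    {z : ℕ} (hz : z < 2 * C.size) :
    (∃ x, x < 2 * (Cs 0).size ∧ (e 0).toNat x = z) ↔ InFirst C.size C.diagram.toNat z := by
  have hC := C.isMatching
  have h0 := (Cs 0).isMatching
  have hrc := h0.root_isChord (Cs 0).conn.1
  have hsz := (Cs 0).conn.1
  have he := (e 0).emb
  have hmem : ∀ x, x < (Cs 0).diagram.toNat x → (e 0).toNat x ≠ last C.size C.diagram.toNat := by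
    intro x hx hxt
    exact h4 0 ((e 0).contains_iff.2 ⟨x, hx, hxt.trans ht.symm⟩)
  -- the root of `C` is not the last chord, hence it belongs to some part, and to no later one
  have hroot : (e 0).toNat 0 = 0 := by
    obtain ⟨r, hr⟩ := C.diagram.exists_chord (hC.root_isChord C.conn.1)
    have hrt : r ≠ t := by
      rintro rfl
      obtain ⟨d, hd, hd2⟩ := (e 0).exists_contains hrc
      have h7 : d ≠ r := by
        rintro rfl
        exact h4 0 hd2
      have h8 : (d.1 : ℕ) ≠ r.1 := fun h => h7 (chord_ext h)
      have h9 := hC.sink_lt (C.diagram.chord_lt d)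
      obtain ⟨f, hf, -⟩ := (C.conn.2 _ _ (C.diagram.chord_lt r) (C.diagram.chord_lt d)).exists_last
        h8.symm
      rcases hf with hf | hf
      · rw [ht] at hf
        exact hC.not_nbr_last hf
      · exact absurd hf.1 (by omega)
    obtain ⟨l, hl, -⟩ := h3 r hrt
    obtain rfl : l = 0 := by
      by_contra hl0
      obtain ⟨d, -, hd⟩ := h6 0 l (Fin.pos_of_ne_zero hl0)
      have := hd r hl
      rw [← Subtype.coe_lt_coe, Fin.lt_def] at this
      omega
    obtain ⟨x, hx, hxr⟩ := (e 0).contains_iff.1 hl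
    rcases Nat.eq_zero_or_pos x with rfl | hx0
    · rw [hxr, hr]
    · have := he.mono 0 x hx0 (lt_trans hx (h0.sink_lt hx))
      omega
  have key : ∀ w, (∃ x, x < (Cs 0).diagram.toNat x ∧ (e 0).toNat x = w) ↔
      Reach C.diagram.toNat (· ≠ last C.size C.diagram.toNat) 0 w := by
    intro w
    constructor
    · rintro ⟨x, hx, rfl⟩
      have := he.reach h0 (Q := (· ≠ last C.size C.diagram.toNat))
        (P := fun y => y < (Cs 0).diagram.toNat y)
        (((Cs 0).conn.2 _ _ hrc hx).strengthen.mono fun y hy => hy.2.isChord hrc) hmem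
      rwa [hroot] at this
    · intro hw
      induction hw with
      | refl => exact ⟨0, hrc, hroot⟩
      | @tail a b _ h2 ih =>
        obtain ⟨d, rfl⟩ := C.diagram.exists_chord h2.2.left
        obtain ⟨d', rfl⟩ := C.diagram.exists_chord h2.2.right
        have hd := (e 0).contains_iff.2 ih
        obtain ⟨l, hl, -⟩ := h3 d' fun h => h2.1 (by rw [h, ht])
        by_cases hl0 : l = 0
        · subst hl0
          exact (e 0).contains_iff.1 hl
        · exact (h5 0 l d d' (fun h => hl0 h.symm) hd hl ((C.diagram.adj_iff _ _).2 h2.2)).elim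
  rw [InFirst, ← key]
  constructor
  · rintro ⟨x, hx, rfl⟩
    have h1 := h0.ne hx
    have h2 := h0.invol x
    have h7 := h0.lt_iff.2 hx
    rcases lt_or_gt_of_ne h1 with h8 | h8
    · refine ⟨_, by rwa [h2], ?_⟩
      rw [he.map x hx, Nat.min_eq_right (he.mono _ _ h8 hx).le]
    · exact ⟨x, h8, by rw [he.map x hx, Nat.min_eq_left (he.mono _ _ h8 h7).le]⟩
  · rintro ⟨x, hx, hxz⟩
    have h1 := lt_trans hx (h0.sink_lt hx)
    rcases min_choice z (C.diagram.toNat z) with h2 | h2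
    · exact ⟨x, h1, hxz.trans h2⟩
    · refine ⟨_, h0.lt_iff.2 h1, ?_⟩
      rw [← he.map x h1, hxz, h2, hC.invol]

/-- A decomposition is a composition of its first part and a diagram that is decomposed into the
other parts. -/
theorem IsDecomposition.exists_isComp {is : Fin (k + 1) → ℕ} (h : C.IsDecomposition Cs is) :
    ∃ B, IsComp (Cs 0) (is 0) B C ∧
      B.IsDecomposition (fun l => Cs l.succ) fun l => is l.succ := by
  obtain ⟨t, e, h1, h2, h3, h4, h5, h6, h7⟩ := h
  have ht : (t.1 : ℕ) = last C.size C.diagram.toNat := by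
    obtain ⟨t', ht'⟩ := exists_last (C := C.diagram) C.conn.1
    rw [(index_eq_t1_iff C.conn ht').1 h2, ht']
  have hfirst := fun z hz => exists_emb_zero_iff (z := z) ht h3 h4 h5 h6 hz
  have hElt : ∀ l x, x < 2 * (Cs l).size → (e l).toNat x < 2 * C.size := by
    intro l x hx
    have := (e l).toNat_coe ⟨x, hx⟩
    rw [this]
    exact Fin.is_lt _
  obtain ⟨A, i, B, hcomp⟩ : ∃ A i B, IsComp A i B C := by
    rcases isCompositionSystem.decomp C with h8 | h8
    · exfalso
      have hsz : C.size = 1 := by rw [h8, size_singleChord]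
      obtain ⟨d, hd1, hd2⟩ := (e 0).exists_contains
        ((Cs 0).isMatching.root_isChord (Cs 0).conn.1)
      have q1 := C.isMatching.sink_lt (C.diagram.chord_lt d)
      have q2 := C.isMatching.sink_lt (C.diagram.chord_lt t)
      have q3 := C.diagram.chord_lt d
      have q4 := C.diagram.chord_lt t
      refine h4 0 ?_
      rwa [show t = d from chord_ext (by omega)]
    · exact h8
  obtain ⟨g, hs, hG, hg, hi⟩ := hcomp
  have hfirst' : ∀ z, (∃ x, x < 2 * (Cs 0).size ∧ (e 0).toNat x = z) ↔
      ∃ x, x < 2 * A.size ∧ embL B.size g x = z := by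
    intro z
    by_cases hz : z < 2 * C.size
    · rw [hfirst z hz, ← hG.inFirst_iff A.conn (by omega)]
      exact iff_of_eq (congrArg (InFirst · C.diagram.toNat z) hs)
    · constructor
      · rintro ⟨x, hx, rfl⟩
        exact (hz (hElt 0 x hx)).elim
      · rintro ⟨x, hx, rfl⟩
        have := hG.embL_lt hx
        omega
  have hmemL : ∀ d, (e 0).Contains d ↔ ∃ x, x < A.diagram.toNat x ∧ embL B.size g x = d.1 := by
    intro d
    rw [(e 0).contains_iff]
    constructor
    · rintro ⟨x, hx, hxd⟩
      obtain ⟨y, hy, hyd⟩ := (hfirst' d.1).1 ⟨x, lt_trans hx ((Cs 0).isMatching.sink_lt hx), hxd⟩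
      refine ⟨y, ?_, hyd⟩
      rw [← hG.embL_emb.isChord_iff hG.left hy, hyd]
      exact C.diagram.chord_lt d
    · rintro ⟨x, hx, hxd⟩
      obtain ⟨y, hy, hyd⟩ := (hfirst' d.1).2 ⟨x, lt_trans hx (A.isMatching.sink_lt hx), hxd⟩
      refine ⟨y, ?_, hyd⟩
      rw [← (e 0).emb.isChord_iff (Cs 0).isMatching hy, hyd]
      exact C.diagram.chord_lt d
  have hA : A = Cs 0 := by
    obtain ⟨q1, q2⟩ := eq_of_range_eq (e 0).emb.mono hG.embL_emb.mono hfirst'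
    have q3 : (Cs 0).size = A.size := by omega
    refine ext_toNat q3.symm (hG.left.eq_of_emb (q3 ▸ (Cs 0).isMatching) hG.embL_emb
      ⟨hG.embL_emb.mono, fun x hx => ?_⟩)
    have hx' : x < 2 * (Cs 0).size := by omega
    rw [← q2 x hx', (e 0).emb.map x hx', q2 _ ((Cs 0).isMatching.lt_iff.2 hx')]
  have hsp : ∀ x, x < 2 * A.size → (Spine C.size C.diagram.toNat (embL B.size g x) ↔
      Spine A.size A.diagram.toNat x ∧ x < g) := by
    intro x hx
    exact (iff_of_eq (congrArg (Spine · C.diagram.toNat _) hs)).trans (hG.spine_left_iff hg hx)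
  have his : is 0 = i := by
    rw [h7 0, hi, Nat.count_eq_card_filter_range, ← Nat.card_eq_finsetCard]
    have hval : ∀ d : {d // (e 0).Contains d ∧ C.diagram.index d < C.diagram.t1},
        (d.1.1 : ℕ) ∈ (Finset.range g).filter (Spine A.size A.diagram.toNat) := by
      rintro ⟨d, hd1, hd2⟩
      obtain ⟨x, hx, hxd⟩ := (hmemL d).1 hd1
      have hd3 := ((index_lt_t1_iff C.conn ht).1 hd2).2
      rw [← hxd, hsp x (lt_trans hx (A.isMatching.sink_lt hx))] at hd3
      have : (d.1 : ℕ) = x := by rw [← hxd, embL, if_pos hd3.2]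
      rw [Finset.mem_filter, Finset.mem_range, this]
      exact ⟨hd3.2, hd3.1⟩
    refine Nat.card_congr (Equiv.ofBijective (fun d => ⟨(d.1.1 : ℕ), hval d⟩) ⟨?_, ?_⟩)
    · intro d d' hdd
      exact Subtype.ext (chord_ext (congrArg Subtype.val hdd))
    · rintro ⟨x, hx⟩
      have hx' := hx
      rw [Finset.mem_filter, Finset.mem_range] at hx'
      have hxL : embL B.size g x = x := by rw [embL, if_pos hx'.1]
      have hlt := hG.lt
      have hxc : x < C.diagram.toNat x := by
        have := (hG.embL_emb.isChord_iff hG.left (x := x) (by omega)).2 hx'.2.1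
        rwa [hxL] at this
      obtain ⟨d, hd⟩ := C.diagram.exists_chord hxc
      have hdc : (e 0).Contains d := (hmemL d).2 ⟨x, hx'.2.1, by rw [hxL, hd]⟩
      refine ⟨⟨d, hdc, (index_lt_t1_iff C.conn ht).2 ⟨?_, ?_⟩⟩, Subtype.ext hd⟩
      · rintro rfl
        exact h4 0 hdc
      · rw [hd, ← hxL, hsp x (by omega)]
        exact ⟨hx'.2, hx'.1⟩
  subst hA
  refine ⟨B, ⟨g, hs, hG, hg, his.trans hi⟩, ?_⟩
  -- the chords of `B` as chords of `C`
  have hφ : ∀ d : B.diagram.Chord, ∃ d' : C.diagram.Chord,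
      (d'.1 : ℕ) = embR (Cs 0).size B.size g d.1 := fun d =>
    C.diagram.exists_chord ((hG.embR_emb.isChord_iff hG.right d.1.2).2 (B.diagram.chord_lt d))
  choose φ hφ using hφ
  have hφi : ∀ d d', φ d = φ d' → d = d' := by
    intro d d' hdd
    have h8 := congrArg (fun d => (d.1 : ℕ)) hdd
    simp only [hφ] at h8
    exact chord_ext ((hG.embR_emb.eq_iff d.1.2 d'.1.2).1 h8)
  have hφ0 : ∀ d, ¬ (e 0).Contains (φ d) := by
    intro d hd
    obtain ⟨x, hx, hxd⟩ := (hmemL _).1 hd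
    rw [hφ] at hxd
    exact hG.embL_ne_embR (lt_trans hx ((Cs 0).isMatching.sink_lt hx)) d.1.2 hxd
  have hφs : ∀ d, ¬ (e 0).Contains d → ∃ d', φ d' = d := by
    intro d hd
    have hdc := C.diagram.chord_lt d
    rcases hG.exists_chord hdc with ⟨x, hx, hxd⟩ | ⟨x, hx, hxd⟩
    · exact (hd ((hmemL _).2 ⟨x, hx, hxd⟩)).elim
    · obtain ⟨d', rfl⟩ := B.diagram.exists_chord hx
      exact ⟨d', chord_ext (by rw [hφ, hxd])⟩
  have hdisj : ∀ {l : Fin k} {d}, (e l.succ).Contains d → ¬ (e 0).Contains d := by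
    intro l d q1 q2
    have hdt : d ≠ t := by
      rintro rfl
      exact h4 0 q2
    exact Fin.succ_ne_zero l ((h3 d hdt).unique q1 q2)
  obtain ⟨t', ht'⟩ := exists_last (C := B.diagram) B.conn.1
  have hφt : φ t' = t := chord_ext (by
    rw [hφ, ht', ← hG.last_eq, ht]
    exact (congrArg (last · C.diagram.toNat) hs).symm)
  -- the remaining embeddings factor through `B`
  have hfac : ∀ l : Fin k, ∃ f : (Cs l.succ).diagram.Embedding B.diagram,
      ∀ x, x < 2 * (Cs l.succ).size →
        embR (Cs 0).size B.size g (f.toNat x) = (e l.succ).toNat x := by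
    intro l
    have hD := (Cs l.succ).isMatching
    have hpt : ∀ x, ∃ y, x < 2 * (Cs l.succ).size → y < 2 * B.size ∧
        embR (Cs 0).size B.size g y = (e l.succ).toNat x := by
      intro x
      by_cases hx : x < 2 * (Cs l.succ).size
      swap
      · exact ⟨0, fun h => (hx h).elim⟩
      have hch : ∀ y, y < (Cs l.succ).diagram.toNat y → ∃ w : B.diagram.Chord,
          embR (Cs 0).size B.size g w.1 = (e l.succ).toNat y := by
        intro y hy
        obtain ⟨d, hd1, hd2⟩ := (e l.succ).exists_contains hy
        obtain ⟨d', rfl⟩ := hφs d (hdisj hd2)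
        exact ⟨d', by rw [← hφ, hd1]⟩
      have q1 := hD.ne hx
      have q2 := hD.invol x
      rcases lt_or_gt_of_ne q1 with q3 | q3
      · obtain ⟨w, hw⟩ := hch ((Cs l.succ).diagram.toNat x) (by rwa [q2])
        refine ⟨B.diagram.toNat w.1, fun _ => ⟨B.isMatching.lt_iff.2 w.1.2, ?_⟩⟩
        rw [← hG.mapR _ w.1.2, hw, (e l.succ).emb.map _ (hD.lt_iff.2 hx), q2]
      · obtain ⟨w, hw⟩ := hch x q3
        exact ⟨w.1, fun _ => ⟨w.1.2, hw⟩⟩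
    choose f hf using hpt
    obtain ⟨f', hf'⟩ := exists_embedding (D := (Cs l.succ).diagram) (C := B.diagram) (e := f)
      ⟨fun x y hxy hy => by
        have := (e l.succ).emb.mono x y hxy hy
        rw [← (hf x (by omega)).2, ← (hf y hy).2] at this
        exact (hG.embR_emb.lt_iff (hf x (by omega)).1 (hf y hy).1).1 this, fun x hx => by
        have hx' := hD.lt_iff.2 hx
        refine (hG.embR_emb.eq_iff (B.isMatching.lt_iff.2 (hf x hx).1) (hf _ hx').1).1 ?_
        rw [← hG.mapR _ (hf x hx).1, (hf x hx).2, (hf _ hx').2, (e l.succ).emb.map x hx]⟩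
    exact ⟨f', fun x hx => by rw [hf' x hx, (hf x hx).2]⟩
  choose f hf using hfac
  have hfc : ∀ l d, (f l).Contains d ↔ (e l.succ).Contains (φ d) := by
    intro l d
    rw [(f l).contains_iff, (e l.succ).contains_iff]
    refine exists_congr fun x => and_congr_right fun hx => ?_
    have hx' := lt_trans hx ((Cs l.succ).isMatching.sink_lt hx)
    rw [← hf l x hx', hφ, hG.embR_emb.eq_iff _ d.1.2]
    have := (f l).toNat_coe ⟨x, hx'⟩
    rw [this]
    exact Fin.is_lt _
  have hlt : ∀ d d', φ d < φ d' ↔ d < d' := by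
    intro d d'
    rw [← Subtype.coe_lt_coe, ← Subtype.coe_lt_coe, Fin.lt_def, Fin.lt_def, hφ, hφ,
      hG.embR_emb.lt_iff d.1.2 d'.1.2]
  have hidx : ∀ d, B.diagram.index d < B.diagram.t1 ↔ C.diagram.index (φ d) < C.diagram.t1 := by
    intro d
    rw [index_lt_t1_iff B.conn ht', index_lt_t1_iff C.conn ht, ← hφt, hφ,
      ← hG.spine_right_iff d.1.2, congrArg (Spine · C.diagram.toNat _) hs]
    exact and_congr_left fun _ => not_congr ⟨fun h => by rw [h], hφi d t'⟩
  refine ⟨t', f, isTerminal_last ht', (index_eq_t1_iff B.conn ht').2 rfl, ?_, ?_, ?_, ?_, ?_⟩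
  · intro d hd
    obtain ⟨l, hl, hu⟩ := h3 (φ d) fun h => hd (hφi _ _ (h.trans hφt.symm))
    obtain ⟨l, rfl⟩ := Fin.exists_succ_eq.2 (show l ≠ 0 by rintro rfl; exact hφ0 d hl)
    exact ⟨l, (hfc l d).2 hl, fun l' hl' => Fin.succ_injective _ (hu _ ((hfc l' d).1 hl'))⟩
  · intro l hl
    rw [hfc, hφt] at hl
    exact h4 _ hl
  · intro l l' d d' hll hd hd' hadj
    refine h5 l.succ l'.succ (φ d) (φ d') (fun h => hll (Fin.succ_injective _ h))
      ((hfc _ _).1 hd) ((hfc _ _).1 hd') ?_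
    rw [adj_iff] at hadj ⊢
    rw [hφ, hφ, hG.embR_emb.cross_iff hG.right d.1.2 d'.1.2]
    exact hadj
  · intro l l' hll
    obtain ⟨d, hd1, hd2⟩ := h6 l.succ l'.succ (Fin.succ_lt_succ_iff.2 hll)
    obtain ⟨d, rfl⟩ := hφs d (hdisj hd1)
    exact ⟨d, (hfc _ _).2 hd1, fun d' hd' => (hlt _ _).1 (hd2 _ ((hfc _ _).1 hd'))⟩
  · intro l
    refine (h7 l.succ).trans (Eq.symm ?_)
    refine Nat.card_congr (Equiv.ofBijective
      (fun d => ⟨φ d.1, (hfc l d.1).1 d.2.1, (hidx d.1).1 d.2.2⟩) ⟨?_, ?_⟩)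
    · intro d d' hdd
      exact Subtype.ext (hφi _ _ (congrArg Subtype.val hdd))
    · rintro ⟨d, hd1, hd2⟩
      obtain ⟨d, rfl⟩ := hφs d (hdisj hd1)
      exact ⟨⟨d, (hfc l d).2 hd1, (hidx d).2 hd2⟩, rfl⟩

end TopFreeDiagram

end

theorem theorem7p3 :
    ∃ ω : TopFreeDiagram → RootedTriangulation,
      (∀ n i : ℕ, Set.BijOn ω
        {C | C.size = n ∧ C.diagram.t1 = i}
        {T | (T.numInterior : ℤ) = (n : ℤ) - (i : ℤ) ∧ T.numExterior = i + 1}) ∧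
      (∀ (C : TopFreeDiagram) (k : ℕ) (Cs : Fin k → TopFreeDiagram) (is : Fin k → ℕ),
        C.IsDecomposition Cs is → (ω C).IsDecomposition (fun l => ω (Cs l)) is) := by
  obtain ⟨ω, hbij, hsize, ht, hatom, hcomp⟩ :=
    TopFreeDiagram.isCompositionSystem.exists_bijective RootedTriangulation.isCompositionSystem
  have hiff : ∀ (C) (n i : ℕ), (C.size = n ∧ C.diagram.t1 = i) ↔
      (((ω C).numInterior : ℤ) = (n : ℤ) - (i : ℤ) ∧ (ω C).numExterior = i + 1) := by
    intro C n i
    have h1 := hsize C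
    have h2 := ht C
    have h3 := (ω C).two_le_numExterior
    rw [RootedTriangulation.size] at h1
    omega
  refine ⟨ω, fun n i => ⟨fun C hC => (hiff C n i).1 hC, hbij.1.injOn, fun T hT => ?_⟩, ?_⟩
  · obtain ⟨C, rfl⟩ := hbij.2 T
    exact ⟨C, (hiff C n i).2 hT, rfl⟩
  · intro C k
    induction k generalizing C with
    | zero =>
      intro Cs is h
      rw [TopFreeDiagram.eq_singleChord_of_isDecomposition h, hatom]
      exact RootedTriangulation.isDecomposition_singleEdge _ is
    | succ k ih =>
      intro Cs is h
      obtain ⟨B, hB, hBd⟩ := h.exists_isComp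
      exact (hcomp hB).isDecomposition (ih B _ _ hBd)
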